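/- For $\theta\in\mathbb R$ let $\mathbb C_\theta=\{s\in\mathbb C:\operatorname{Re}s>\theta\}$. Fix $1\le p<\infty$. Let $\mathcal H^p$ be the completion of the space of Dirichlet polynomials $P(s)=\sum_{n=1}^N a_n n^{-s}$ in the norm $$\|P\|_{\mathcal H^p}=\lim_{T\to\infty}\Big(\frac1{2T}\int_{-T}^T|P(it)|^p\,dt\Big)^{1/p},$$ regarded as a space of functions on $\mathbb C_{1/2}$ (convergence in this norm implies pointwise convergence on $\mathbb C_{1/2}$). For $\varphi:\mathbb C_{1/2}\to\mathbb C_{1/2}$ put $\mathcal C_\varphi f=f\circ\varphi$; we say that $\mathcal C_\varphi$ acts boundedly on $\mathcal H^p$ if $f\circ\varphi\in\mathcal H^p$ for all $f\in\mathcal H^p$ and there is a constant $C$ with $\|f\circ\varphi\|_{\mathcal H^p}\le C\|f\|_{\mathcal H^p}$ for all $f\in\mathcal H^p$. The Gordon–Hedenmalm class $\mathcal G$ consists of the functions $\varphi:\mathbb C_{1/2}\to\mathbb C_{1/2}$ of the form $\varphi(s)=c_0s+\varphi_0(s)$, $\varphi_0(s)=\sum_{n\ge1}c_nn^{-s}$,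 where the characteristic $c_0$ is a non-negative integer, the Dirichlet series $\varphi_0$ converges uniformly in $\mathbb C_\varepsilon$ for every $\varepsilon>0$, and: if $c_0=0$, then $\varphi_0(\mathbb C_0)\subset\mathbb C_{1/2}$; if $c_0\ge1$, then either $\varphi_0\equiv0$ or $\varphi_0(\mathbb C_0)\subset\mathbb C_0$. The following are equivalent. (a) There is a constant $C$ such that, for every Dirichlet polynomial $P$, $$\sup_{\tau\in\mathbb R}\int_\tau^{\tau+1}|P(1/2+it)|^p\,dt\le C\,\|P\|_{\mathcal H^p}^p .$$ (b) For every $\varphi\in\mathcal G$ of characteristic $0$, the composition operator $\mathcal C_\varphi$ acts boundedly on $\mathcal H^p$. (c) The composition operator $\mathcal C_\psi$ acts boundedly on $\mathcal H^p$, where $\psi(s)=\mathcal T(2^{-s})$ and $\mathcal T(z)=\frac12+\frac{1-z}{1+z}$ maps the unit disc onto $\mathbb C_{1/2}$. -/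

import Mathlib

open Filter Topology Set

noncomputable section

/-- The open half-plane of complex numbers with real part greater than `θ`. -/
def halfPlane (θ : ℝ) : Set ℂ := {s : ℂ | θ < s.re}

/-- Dirichlet polynomials, given by their finitely supported coefficients `n ↦ aₙ`, `n ≥ 1`. -/
abbrev DirichletPoly : Type := ℕ+ →₀ ℂ

/-- The value `P(s) = ∑ aₙ n⁻ˢ` of a Dirichlet polynomial. -/
def DirichletPoly.eval (P : DirichletPoly) (s : ℂ) : ℂ :=
  P.sum fun n a => a * ((n : ℕ) : ℂ) ^ (-s)

/-- The Besicovitch norm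
`lim_{T → ∞} ((2T)⁻¹ ∫_{-T}^{T} |P(it)|ᵖ dt)^(1/p)` of a Dirichlet polynomial
(the limit exists for every Dirichlet polynomial, `t ↦ P(it)` being almost periodic). -/
def besicovitchNorm (p : ℝ) (P : DirichletPoly) : ℝ :=
  limUnder atTop fun T : ℝ =>
    ((1 / (2 * T)) * ∫ t in (-T)..T, ‖P.eval (Complex.I * t)‖ ^ p) ^ (1 / p)

/-- The sequence `P` of Dirichlet polynomials is Cauchy for the Besicovitch norm, and the element
of the completion that it represents is, as a function on the half-plane `Re s > 1/2`,
equal to `f` (convergence in norm implies pointwise convergence there). -/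
structure HpApprox (p : ℝ) (P : ℕ → DirichletPoly) (f : ℂ → ℂ) : Prop where
  cauchy : ∀ ε > 0, ∃ K, ∀ j ≥ K, ∀ k ≥ K, besicovitchNorm p (P j - P k) < ε
  tendsto : ∀ s ∈ halfPlane (1 / 2), Tendsto (fun k => (P k).eval s) atTop (𝓝 (f s))

/-- The Hardy space `ℋᵖ` of Dirichlet series: the completion of the Dirichlet polynomials in the
Besicovitch norm, realised as a space of functions on the half-plane `Re s > 1/2`. Only the values
of `f` on this half-plane matter. -/
def MemHp (p : ℝ) (f : ℂ → ℂ) : Prop := ∃ P, HpApprox p P f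

/-- The norm of `ℋᵖ`: the limit of the Besicovitch norms of an approximating sequence. For
`f ∈ ℋᵖ` the limit is the same for all such sequences, so the set below has one element. -/
def hpNorm (p : ℝ) (f : ℂ → ℂ) : ℝ :=
  sInf {N : ℝ | ∃ P, HpApprox p P f ∧
    Tendsto (fun k => besicovitchNorm p (P k)) atTop (𝓝 N)}

/-- `φ` belongs to the Gordon–Hedenmalm class and has characteristic `c₀`. Here `φ` is a function
on the half-plane `Re s > 1/2`; its values elsewhere do not matter. -/
def GordonHedenmalm (c₀ : ℕ) (φ : ℂ → ℂ) : Prop :=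
  MapsTo φ (halfPlane (1 / 2)) (halfPlane (1 / 2)) ∧
  ∃ (c : ℕ → ℂ) (φ₀ : ℂ → ℂ),
    (∀ ε > 0, TendstoUniformlyOn
      (fun (N : ℕ) (s : ℂ) => ∑ n ∈ Finset.Icc 1 N, c n * (n : ℂ) ^ (-s))
      φ₀ atTop (halfPlane ε)) ∧
    (∀ s ∈ halfPlane (1 / 2), φ s = c₀ * s + φ₀ s) ∧
    (c₀ = 0 → MapsTo φ₀ (halfPlane 0) (halfPlane (1 / 2))) ∧
    (1 ≤ c₀ → (∀ s ∈ halfPlane 0, φ₀ s = 0) ∨ MapsTo φ₀ (halfPlane 0) (halfPlane 0))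

/-- The composition operator `f ↦ f ∘ φ` maps `ℋᵖ` into itself and is bounded. -/
def CompositionBounded (p : ℝ) (φ : ℂ → ℂ) : Prop :=
  ∃ C : ℝ, ∀ f : ℂ → ℂ, MemHp p f →
    MemHp p (fun s => f (φ s)) ∧ hpNorm p (fun s => f (φ s)) ≤ C * hpNorm p f

/-- The local embedding: `sup_τ ∫_τ^{τ+1} |P(1/2+it)|ᵖ dt ≤ C ‖P‖ᵖ` for all Dirichlet
polynomials `P`. -/
def LocalEmbedding (p : ℝ) : Prop :=
  ∃ C : ℝ, ∀ (P : DirichletPoly) (τ : ℝ),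
    ∫ t in τ..(τ + 1), ‖P.eval (1 / 2 + Complex.I * t)‖ ^ p ≤ C * besicovitchNorm p P ^ p

/-- The conformal map `𝒯(z) = 1/2 + (1 - z)/(1 + z)` from the unit disc onto `Re s > 1/2`. -/
def cayleyMap (z : ℂ) : ℂ := 1 / 2 + (1 - z) / (1 + z)

end

/-! The link between the line Re s = 1/2 and the norm of ℋᵖ is harmonic measure.

From (a) to (b). Let φ₀ be the Dirichlet series of φ, δ > 0 and w(s) = φ₀(s + δ); on Re s ≥ 0 this
is a uniform limit of Dirichlet polynomials (`IsDirichletLimit`), with a value m at +∞. The Poisson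
formula and Jensen's inequality bound |P(w)|ᵖ by the Poisson integral of |P(1/2 + iy)|ᵖ at w. For
fixed y the Poisson kernel is the real part of 1/(w - 1/2 - iy), again a uniform limit of Dirichlet
polynomials once w keeps away from the boundary line, so its mean along the imaginary axis is its
value at +∞. Hence the p-th power of the norm of P ∘ w is at most the Poisson integral of |P|ᵖ at
the single point m (`IsDirichletLimit.mean_eval_comp_le`). Since Re m > 1/2
(`half_lt_re_of_tendsto`), the kernel there is dominated by a multiple of 1/(1 + y²), and the local
embedding, summed over unit intervals, gives a bound C‖P‖ with C independent of δ. To turn this into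
membership in ℋᵖ, polynomials close to Pₖ(φ₀(s + δₖ)) must form a Cauchy sequence; this needs norm
continuity as δ → 0, which follows from Parseval and boundedness
(`exists_besicovitchFun_shift_sub_le`).

From (b) to (c). The symbol ψ has an explicit Dirichlet series over the powers of two, so it lies in
the class.

From (c) to (a). The function f = P ∘ ψ has the imaginary period 2πi/log 2. Averaging an
approximating polynomial over multiples of this period keeps exactly its terms on powers of two and
does not increase the norm (`besicovitchNorm_twoPart_le`). The averaged polynomials converge to f
uniformly on each Re s > σ > 0 (`HpApprox.tendstoUniformlyOn_twoPart`), so the integral of |f|ᵖ over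
one period of the line Re s = σ is controlled by the norm of f in ℋᵖ. Let σ → 0: ψ(it) = 1/2 + i
tan(t log 2 / 2), and a change of variables bounds the integral of |P|ᵖ over [1/2, 1/2 + i].
Vertical translation of P preserves the norm and yields every other unit segment. -/

open MeasureTheory

/-! ### Mean values over the real line -/

section Mean

variable {E : Type*} [NormedAddCommGroup E] [NormedSpace ℝ E]

/-- `f` has the mean value `m` over the real line. -/
def HasMean (f : ℝ → E) (m : E) : Prop :=
  Tendsto (fun T : ℝ => (1 / (2 * T)) • ∫ t in (-T)..T, f t) atTop (𝓝 m)

theorem HasMean.unique {f : ℝ → E} {m m' : E} (h : HasMean f m) (h' : HasMean f m') : m = m' :=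
  tendsto_nhds_unique h h'

theorem HasMean.add {f g : ℝ → E} {m m' : E} (hf : Continuous f) (hg : Continuous g)
    (h : HasMean f m) (h' : HasMean g m') : HasMean (fun t => f t + g t) (m + m') := by
  refine (Tendsto.add h h').congr fun T => ?_
  rw [← smul_add, intervalIntegral.integral_add (hf.intervalIntegrable _ _)
    (hg.intervalIntegrable _ _)]

theorem HasMean.sub {f g : ℝ → E} {m m' : E} (hf : Continuous f) (hg : Continuous g)
    (h : HasMean f m) (h' : HasMean g m') : HasMean (fun t => f t - g t) (m - m') := by
  refine (Tendsto.sub h h').congr fun T => ?_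
  rw [← smul_sub, intervalIntegral.integral_sub (hf.intervalIntegrable _ _)
    (hg.intervalIntegrable _ _)]

theorem HasMean.clm {F : Type*} [NormedAddCommGroup F] [NormedSpace ℝ F] [CompleteSpace E]
    [CompleteSpace F] {f : ℝ → E} {m : E}
    (hf : Continuous f) (h : HasMean f m) (A : E →L[ℝ] F) : HasMean (fun t => A (f t)) (A m) := by
  refine ((A.continuous.tendsto m).comp h).congr fun T => ?_
  simp only [Function.comp]
  rw [A.map_smul, A.intervalIntegral_comp_comm (hf.intervalIntegrable _ _)]

theorem HasMean.const_mul {f : ℝ → ℂ} {m : ℂ} (h : HasMean f m) (c : ℂ) :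
    HasMean (fun t => c * f t) (c * m) := by
  refine (Tendsto.const_mul c h).congr fun T => ?_
  rw [intervalIntegral.integral_const_mul, mul_smul_comm]

theorem HasMean.const_mul_real {f : ℝ → ℝ} {m : ℝ} (h : HasMean f m) (c : ℝ) :
    HasMean (fun t => c * f t) (c * m) := by
  refine (Tendsto.const_mul c h).congr fun T => ?_
  rw [intervalIntegral.integral_const_mul, mul_smul_comm]

theorem hasMean_const [CompleteSpace E] (c : E) : HasMean (fun _ => c) c := by
  refine tendsto_const_nhds.congr' ?_
  filter_upwards [eventually_gt_atTop 0] with T hT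
  rw [intervalIntegral.integral_const, smul_smul]
  have : 1 / (2 * T) * (T - -T) = 1 := by field_simp; ring
  rw [this, one_smul]

theorem hasMean_sum [CompleteSpace E] {ι : Type*} (s : Finset ι) {f : ι → ℝ → E} {m : ι → E}
    (hf : ∀ i, Continuous (f i)) (h : ∀ i, HasMean (f i) (m i)) :
    HasMean (fun t => ∑ i ∈ s, f i t) (∑ i ∈ s, m i) := by
  classical
  induction s using Finset.induction_on with
  | empty => simpa using hasMean_const (0 : E)
  | insert i s hi ih =>
    simp only [Finset.sum_insert hi]
    exact (h i).add (hf i) (continuous_finsetSum _ fun j _ => hf j) ih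

theorem norm_average_le {f : ℝ → E} {B T : ℝ} (hT : 0 < T) (hf : ∀ t, ‖f t‖ ≤ B) :
    ‖(1 / (2 * T)) • ∫ t in (-T)..T, f t‖ ≤ B := by
  rw [norm_smul]
  have h := intervalIntegral.norm_integral_le_of_norm_le_const (a := -T) (b := T)
    fun t _ => hf t
  have h2 : ‖1 / (2 * T)‖ = 1 / (2 * T) := Real.norm_of_nonneg (by positivity)
  rw [h2, show |T - -T| = 2 * T by rw [abs_of_pos] <;> linarith] at *
  calc _ ≤ 1 / (2 * T) * (B * (2 * T)) := by gcongr
    _ = B := by field_simp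

theorem average_sub {f g : ℝ → E} (hf : Continuous f) (hg : Continuous g) (T : ℝ) :
    (1 / (2 * T)) • (∫ t in (-T)..T, f t) - (1 / (2 * T)) • (∫ t in (-T)..T, g t) =
      (1 / (2 * T)) • ∫ t in (-T)..T, (f t - g t) := by
  rw [← smul_sub, intervalIntegral.integral_sub (hf.intervalIntegrable _ _)
    (hg.intervalIntegrable _ _)]

/-- Averaging over [-T, T] contracts the sup norm, so the averages of f eventually stay within a
small multiple of ε of the mean of g; they are therefore Cauchy. -/
theorem exists_hasMean_of_approx [CompleteSpace E] {f : ℝ → E} (hf : Continuous f)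
    (h : ∀ ε > 0, ∃ (g : ℝ → E) (m : E), Continuous g ∧ HasMean g m ∧
      ∀ t, ‖f t - g t‖ ≤ ε) : ∃ m, HasMean f m := by
  refine cauchySeq_tendsto_of_complete ?_
  rw [Metric.cauchySeq_iff']
  intro ε hε
  obtain ⟨g, m, hg, hm, hfg⟩ := h (ε / 5) (by linarith)
  rw [HasMean, Metric.tendsto_nhds] at hm
  obtain ⟨N, hN⟩ := eventually_atTop.1 ((hm (ε / 5) (by linarith)).and (eventually_gt_atTop 0))
  have key : ∀ T ≥ N, dist ((1 / (2 * T)) • ∫ t in (-T)..T, f t) m < 2 * (ε / 5) := by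
    intro T hT
    have h1 := norm_average_le (hN T hT).2 hfg
    rw [← average_sub hf hg, ← dist_eq_norm] at h1
    have := dist_triangle ((1 / (2 * T)) • ∫ t in (-T)..T, f t)
      ((1 / (2 * T)) • ∫ t in (-T)..T, g t) m
    linarith [(hN T hT).1]
  refine ⟨N, fun T hT => ?_⟩
  have h1 := key T hT
  have h2 := key N le_rfl
  rw [dist_comm] at h2
  have := dist_triangle ((1 / (2 * T)) • ∫ t in (-T)..T, f t) m
    ((1 / (2 * N)) • ∫ t in (-N)..N, f t)
  linarith

theorem HasMean.mono {f g : ℝ → ℝ} {m m' : ℝ} (hf : Continuous f) (hg : Continuous g)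
    (h : HasMean f m) (h' : HasMean g m') (hfg : ∀ t, f t ≤ g t) : m ≤ m' := by
  refine le_of_tendsto_of_tendsto h h' ?_
  filter_upwards [eventually_gt_atTop 0] with T hT
  simp only [smul_eq_mul]
  gcongr
  exact intervalIntegral.integral_mono (by linarith) (hf.intervalIntegrable _ _)
    (hg.intervalIntegrable _ _) hfg

theorem HasMean.norm_le {f : ℝ → E} {g : ℝ → ℝ} {m : E} {m' : ℝ}
    (hg : Continuous g) (h : HasMean f m) (h' : HasMean g m')
    (hfg : ∀ t, ‖f t‖ ≤ g t) : ‖m‖ ≤ m' := by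
  refine le_of_tendsto_of_tendsto h.norm h' ?_
  filter_upwards [eventually_gt_atTop 0] with T hT
  rw [norm_smul, smul_eq_mul, Real.norm_of_nonneg (by positivity)]
  gcongr
  exact intervalIntegral.norm_integral_le_of_norm_le (by linarith)
    (Eventually.of_forall fun t _ => hfg t) (hg.intervalIntegrable _ _)

theorem HasMean.le_const {f : ℝ → ℝ} {m B : ℝ} (hf : Continuous f)
    (h : HasMean f m) (hB : ∀ t, f t ≤ B) : m ≤ B :=
  h.mono hf continuous_const (hasMean_const B) hB

theorem HasMean.nonneg {f : ℝ → ℝ} {m : ℝ} (hf : Continuous f)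
    (h : HasMean f m) (hB : ∀ t, 0 ≤ f t) : 0 ≤ m :=
  (hasMean_const 0).mono continuous_const hf h hB

theorem tendsto_div_two_mul_atTop (C : ℝ) : Tendsto (fun T : ℝ => (1 / (2 * T)) * C) atTop (𝓝 0) := by
  have : Tendsto (fun T : ℝ => C / 2 / T) atTop (𝓝 0) := tendsto_const_nhds.div_atTop tendsto_id
  refine this.congr' ?_
  filter_upwards [eventually_gt_atTop 0] with T hT
  field_simp

/-- The integrals over [-T, T] and its translate differ only on two intervals of length |τ|, a
bounded amount that the factor 1/(2T) removes. -/
theorem HasMean.translate {f : ℝ → E} {m : E} {B : ℝ} (hf : Continuous f)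
    (h : HasMean f m) (hB : ∀ t, ‖f t‖ ≤ B) (τ : ℝ) : HasMean (fun t => f (t + τ)) m := by
  have hii := fun a b => hf.intervalIntegrable (μ := volume) a b
  have h0 : Tendsto (fun T : ℝ => (1 / (2 * T)) • ((∫ t in (-T)..T, f (t + τ)) -
      ∫ t in (-T)..T, f t)) atTop (𝓝 0) := by
    refine squeeze_zero_norm' ?_ (tendsto_div_two_mul_atTop (2 * (B * |τ|)))
    filter_upwards [eventually_gt_atTop 0] with T hT
    rw [norm_smul, Real.norm_of_nonneg (by positivity)]
    gcongr
    rw [intervalIntegral.integral_comp_add_right]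
    have e : (∫ t in (-T + τ)..(T + τ), f t) - ∫ t in (-T)..T, f t =
        (∫ t in T..(T + τ), f t) - ∫ t in (-T)..(-T + τ), f t := by
      rw [← intervalIntegral.integral_add_adjacent_intervals (hii (-T + τ) (-T)) (hii (-T) (T + τ)),
        ← intervalIntegral.integral_add_adjacent_intervals (hii (-T) T) (hii T (T + τ)),
        intervalIntegral.integral_symm (-T) (-T + τ)]
      abel
    rw [e]
    have h1 := intervalIntegral.norm_integral_le_of_norm_le_const (a := T) (b := T + τ)
      fun t _ => hB t
    have h2 := intervalIntegral.norm_integral_le_of_norm_le_const (a := -T) (b := -T + τ)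
      fun t _ => hB t
    rw [add_sub_cancel_left] at h1 h2
    linarith [norm_sub_le (∫ t in T..(T + τ), f t) (∫ t in (-T)..(-T + τ), f t)]
  have := Tendsto.add h h0
  rw [add_zero] at this
  refine this.congr fun T => ?_
  rw [← smul_add]; congr 1; abel

end Mean

theorem hasMean_exp (x : ℝ) :
    HasMean (fun t : ℝ => Complex.exp (Complex.I * x * t)) (if x = 0 then 1 else 0) := by
  split_ifs with h
  · simpa [h] using hasMean_const (1 : ℂ)
  · have hx : Complex.I * (x : ℂ) ≠ 0 := mul_ne_zero Complex.I_ne_zero (by exact_mod_cast h)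
    refine squeeze_zero_norm' ?_ (tendsto_div_two_mul_atTop (2 / |x|))
    filter_upwards [eventually_gt_atTop 0] with T hT
    rw [norm_smul, Real.norm_of_nonneg (by positivity)]
    gcongr
    rw [integral_exp_mul_complex hx, norm_div]
    have h1 : ∀ t : ℝ, ‖Complex.exp (Complex.I * x * t)‖ = 1 := fun t => by
      rw [show Complex.I * x * t = ((x * t : ℝ) : ℂ) * Complex.I by push_cast; ring]
      exact Complex.norm_exp_ofReal_mul_I _
    have h2 : ‖Complex.I * (x : ℂ)‖ = |x| := by simp
    rw [h2]
    gcongr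
    calc _ ≤ _ := norm_sub_le _ _
      _ = 2 := by rw [h1, h1]; norm_num

/-! ### Besicovitch p-norms of functions on the line -/

section PMean

/-- The Besicovitch `p`-norm of a function on the real line. -/
noncomputable def besicovitchFun (p : ℝ) (F : ℝ → ℂ) : ℝ :=
  limUnder atTop fun T : ℝ => ((1 / (2 * T)) * ∫ t in (-T)..T, ‖F t‖ ^ p) ^ (1 / p)

/-- `F` is continuous and `|F|ᵖ` has a mean value. -/
def HasPMean (p : ℝ) (F : ℝ → ℂ) : Prop :=
  Continuous F ∧ ∃ m, HasMean (fun t => ‖F t‖ ^ p) m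

theorem continuous_norm_rpow {p : ℝ} (hp : 0 < p) {F : ℝ → ℂ} (hF : Continuous F) :
    Continuous fun t => ‖F t‖ ^ p :=
  hF.norm.rpow_const fun _ => Or.inr hp.le

theorem besicovitchFun_eq {p : ℝ} (hp : 0 < p) {F : ℝ → ℂ} {m : ℝ}
    (h : HasMean (fun t => ‖F t‖ ^ p) m) :
    besicovitchFun p F = m ^ (1 / p) ∧ Tendsto (fun T : ℝ =>
      ((1 / (2 * T)) * ∫ t in (-T)..T, ‖F t‖ ^ p) ^ (1 / p)) atTop (𝓝 (m ^ (1 / p))) := by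
  have : Tendsto (fun T : ℝ => ((1 / (2 * T)) * ∫ t in (-T)..T, ‖F t‖ ^ p) ^ (1 / p)) atTop
      (𝓝 (m ^ (1 / p))) :=
    Tendsto.rpow_const h (Or.inr (by positivity))
  exact ⟨this.limUnder_eq, this⟩

theorem HasPMean.hasMean {p : ℝ} (hp : 0 < p) {F : ℝ → ℂ} (h : HasPMean p F) :
    HasMean (fun t => ‖F t‖ ^ p) (besicovitchFun p F ^ p) := by
  obtain ⟨hF, m, hm⟩ := h
  have hm0 : 0 ≤ m := hm.nonneg (continuous_norm_rpow hp hF) fun t => by positivity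
  rwa [(besicovitchFun_eq hp hm).1, ← Real.rpow_mul hm0, one_div_mul_cancel hp.ne', Real.rpow_one]

theorem HasPMean.nonneg {p : ℝ} (hp : 0 < p) {F : ℝ → ℂ} (h : HasPMean p F) :
    0 ≤ besicovitchFun p F := by
  obtain ⟨hF, m, hm⟩ := h
  have hm0 : 0 ≤ m := hm.nonneg (continuous_norm_rpow hp hF) fun t => by positivity
  rw [(besicovitchFun_eq hp hm).1]
  positivity

theorem HasPMean.le_of_hasMean_le {p : ℝ} (hp : 0 < p) {F : ℝ → ℂ} (h : HasPMean p F) {m B : ℝ}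
    (hm : HasMean (fun t => ‖F t‖ ^ p) m) (hB : 0 ≤ B) (hmB : m ≤ B ^ p) :
    besicovitchFun p F ≤ B := by
  have := (h.hasMean hp).unique hm
  exact (Real.rpow_le_rpow_iff (h.nonneg hp) hB hp).1 (this.trans_le hmB)

theorem HasPMean.le_of_bound {p : ℝ} (hp : 0 < p) {F : ℝ → ℂ} (h : HasPMean p F) {B : ℝ}
    (hB : ∀ t, ‖F t‖ ≤ B) : besicovitchFun p F ≤ B := by
  have hB0 : 0 ≤ B := (norm_nonneg _).trans (hB 0)
  refine h.le_of_hasMean_le hp (h.hasMean hp) hB0 ?_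
  exact (h.hasMean hp).le_const (continuous_norm_rpow hp h.1) fun t => by
    have := hB t; gcongr

/-- Minkowski's inequality for the Besicovitch norm. -/
theorem besicovitchFun_add_le {p : ℝ} (hp : 1 ≤ p) {F G H : ℝ → ℂ} (hF : HasPMean p F)
    (hG : HasPMean p G) (hH : HasPMean p H) (hle : ∀ t, ‖H t‖ ≤ ‖F t‖ + ‖G t‖) :
    besicovitchFun p H ≤ besicovitchFun p F + besicovitchFun p G := by
  have hp0 : 0 < p := by linarith
  refine le_of_forall_pos_le_add fun ε hε => ?_
  -- The ε keeps the normalisers A and B positive. Convexity of xᵖ at F/A and G/B with weights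
  -- A/(A+B) and B/(A+B) is then a pointwise inequality, and its mean is Minkowski's inequality.
  set A := besicovitchFun p F + ε / 2 with hA
  set B := besicovitchFun p G + ε / 2 with hB
  have hF0 := hF.nonneg hp0
  have hG0 := hG.nonneg hp0
  have hA0 : 0 < A := by linarith
  have hB0 : 0 < B := by linarith
  rw [show besicovitchFun p F + besicovitchFun p G + ε = A + B by rw [hA, hB]; ring]
  refine hH.le_of_hasMean_le hp0 (hH.hasMean hp0) (by linarith) ?_
  have hF1 := (hF.hasMean hp0).const_mul_real ((A + B) ^ p * (A / (A + B) * (A ^ p)⁻¹))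
  have hG1 := (hG.hasMean hp0).const_mul_real ((A + B) ^ p * (B / (A + B) * (B ^ p)⁻¹))
  have hcF := continuous_norm_rpow hp0 hF.1
  have hcG := continuous_norm_rpow hp0 hG.1
  refine ((hH.hasMean hp0).mono (continuous_norm_rpow hp0 hH.1) (by fun_prop)
    (hF1.add (by fun_prop) (by fun_prop) hG1) fun t => ?_).trans ?_
  · calc ‖H t‖ ^ p ≤ (‖F t‖ + ‖G t‖) ^ p := by have := hle t; gcongr
      _ = (A + B) ^ p * (A / (A + B) * (‖F t‖ / A) + B / (A + B) * (‖G t‖ / B)) ^ p := by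
        rw [← Real.mul_rpow (by positivity) (by positivity)]
        congr 1; field_simp
      _ ≤ (A + B) ^ p * (A / (A + B) * (‖F t‖ / A) ^ p + B / (A + B) * (‖G t‖ / B) ^ p) := by
        gcongr
        exact (convexOn_rpow hp).2 (x := ‖F t‖ / A) (by simp; positivity) (y := ‖G t‖ / B)
          (by simp; positivity) (by positivity) (by positivity) (by field_simp)
      _ = _ := by
        rw [Real.div_rpow (by positivity) hA0.le, Real.div_rpow (by positivity) hB0.le]
        ring
  · have h1 : besicovitchFun p F ^ p ≤ A ^ p := by gcongr; linarith
    have h2 : besicovitchFun p G ^ p ≤ B ^ p := by gcongr; linarith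
    calc _ ≤ (A + B) ^ p * (A / (A + B) * (A ^ p)⁻¹) * A ^ p +
          (A + B) ^ p * (B / (A + B) * (B ^ p)⁻¹) * B ^ p := by gcongr
      _ = _ := by field_simp

/-- A continuous bounded function all of whose even powers have means has a `p`-mean. -/
theorem hasPMean_of_even_powers {p : ℝ} (hp : 0 < p) {F : ℝ → ℂ} (hF : Continuous F) {B : ℝ}
    (hB : ∀ t, ‖F t‖ ≤ B) (h : ∀ k : ℕ, ∃ m, HasMean (fun t => (‖F t‖ ^ 2) ^ k) m) :
    HasPMean p F := by
  refine ⟨hF, exists_hasMean_of_approx (continuous_norm_rpow hp hF) fun ε hε => ?_⟩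
  -- Weierstrass: ‖F‖ᵖ is the p/2-th power of ‖F‖², hence uniformly close to a polynomial in ‖F‖²,
  -- which has a mean by hypothesis.
  obtain ⟨q, hq⟩ := exists_polynomial_near_of_continuousOn 0 (B ^ 2) (fun x => x ^ (p / 2))
    (continuousOn_id.rpow_const fun x _ => Or.inr (by positivity)) ε hε
  choose m hm using h
  refine ⟨fun t => q.eval (‖F t‖ ^ 2), ∑ i ∈ Finset.range (q.natDegree + 1), q.coeff i * m i,
    by fun_prop, ?_, fun t => ?_⟩
  · simp only [Polynomial.eval_eq_sum_range]
    exact hasMean_sum _ (f := fun i t => q.coeff i * (‖F t‖ ^ 2) ^ i) (fun i => by fun_prop)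
      fun i => (hm i).const_mul_real _
  · have := hq (‖F t‖ ^ 2) ⟨by positivity, by have := hB t; gcongr⟩
    have e : (‖F t‖ ^ 2) ^ (p / 2) = ‖F t‖ ^ p := by
      rw [← Real.rpow_natCast, ← Real.rpow_mul (norm_nonneg _)]
      congr 1; push_cast; ring
    simp only [e] at this
    rw [Real.norm_eq_abs, abs_sub_comm]
    exact this.le

theorem HasPMean.of_approx {p : ℝ} (hp : 0 < p) {F : ℝ → ℂ} (hF : Continuous F) {B : ℝ}
    (hB : ∀ t, ‖F t‖ ≤ B) (h : ∀ ε > 0, ∃ G, HasPMean p G ∧ ∀ t, ‖F t - G t‖ ≤ ε) :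
    HasPMean p F := by
  refine ⟨hF, exists_hasMean_of_approx (continuous_norm_rpow hp hF) fun ε hε => ?_⟩
  have hu : UniformContinuousOn (fun x : ℝ => x ^ p) (Icc 0 (B + 1)) :=
    isCompact_Icc.uniformContinuousOn_of_continuous
      (continuousOn_id.rpow_const fun x _ => Or.inr hp.le)
  obtain ⟨δ, hδ, hu⟩ := Metric.uniformContinuousOn_iff.1 hu ε hε
  -- The 1 keeps ‖G‖ in [0, B + 1], where xᵖ is uniformly continuous; δ / 2 makes the distance
  -- strictly less than δ.
  obtain ⟨G, hG, hFG⟩ := h (min 1 (δ / 2)) (by positivity)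
  refine ⟨_, _, continuous_norm_rpow hp hG.1, hG.hasMean hp, fun t => ?_⟩
  have h1 : |‖F t‖ - ‖G t‖| ≤ min 1 (δ / 2) := (abs_norm_sub_norm_le _ _).trans (hFG t)
  have h2 := hB t
  have h3 := abs_le.1 (h1.trans (min_le_left _ _))
  have := hu ‖F t‖ ⟨norm_nonneg _, by linarith⟩ ‖G t‖ ⟨norm_nonneg _, by linarith⟩
    (by rw [Real.dist_eq]; linarith [h1.trans (min_le_right _ _)])
  rw [dist_eq_norm] at this
  exact this.le

end PMean

/-! ### Fourier analysis of Dirichlet polynomials -/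

section DirichletPolynomials

namespace DirichletPoly

theorem natCast_cpow_I (n : ℕ+) (t : ℝ) :
    ((n : ℕ) : ℂ) ^ (-(Complex.I * t)) =
      Complex.exp (Complex.I * ((-Real.log (n : ℕ) : ℝ) : ℂ) * t) := by
  rw [Complex.cpow_def_of_ne_zero (by exact_mod_cast n.pos.ne'), ← Complex.natCast_log]
  congr 1; push_cast; ring

theorem norm_natCast_cpow (n : ℕ+) (s : ℂ) :
    ‖((n : ℕ) : ℂ) ^ (-s)‖ = ((n : ℕ) : ℝ) ^ (-s.re) := by
  rw [Complex.norm_natCast_cpow_of_pos n.pos, Complex.neg_re]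

theorem norm_natCast_cpow_le_one (n : ℕ+) {s : ℂ} (hs : 0 ≤ s.re) :
    ‖((n : ℕ) : ℂ) ^ (-s)‖ ≤ 1 := by
  rw [norm_natCast_cpow]
  exact Real.rpow_le_one_of_one_le_of_nonpos (by exact_mod_cast n.pos) (by linarith)

theorem natCast_cpow_add (n : ℕ+) (s z : ℂ) :
    ((n : ℕ) : ℂ) ^ (-(s + z)) = ((n : ℕ) : ℂ) ^ (-s) * ((n : ℕ) : ℂ) ^ (-z) := by
  rw [neg_add, Complex.cpow_add _ _ (by exact_mod_cast n.pos.ne')]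

theorem eval_add (P Q : DirichletPoly) (s : ℂ) :
    DirichletPoly.eval (P + Q) s = DirichletPoly.eval P s + DirichletPoly.eval Q s :=
  Finsupp.sum_add_index' (by simp) (by intros; ring)

theorem eval_sub (P Q : DirichletPoly) (s : ℂ) :
    DirichletPoly.eval (P - Q) s = DirichletPoly.eval P s - DirichletPoly.eval Q s :=
  Finsupp.sum_sub_index (by intros; ring)

theorem eval_single (n : ℕ+) (a : ℂ) (s : ℂ) :
    DirichletPoly.eval (Finsupp.single n a) s = a * ((n : ℕ) : ℂ) ^ (-s) :=
  Finsupp.sum_single_index (by simp)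

theorem eval_finsetSum {ι : Type*} (S : Finset ι) (Q : ι → DirichletPoly) (s : ℂ) :
    DirichletPoly.eval (∑ i ∈ S, Q i) s = ∑ i ∈ S, DirichletPoly.eval (Q i) s := by
  classical
  induction S using Finset.induction_on with
  | empty => simp [DirichletPoly.eval]
  | insert i S hi ih => rw [Finset.sum_insert hi, Finset.sum_insert hi, eval_add, ih]

theorem differentiable_eval (P : DirichletPoly) : Differentiable ℂ (DirichletPoly.eval P) := by
  unfold DirichletPoly.eval Finsupp.sum
  refine Differentiable.fun_sum fun n _ => Differentiable.const_mul ?_ _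
  intro s
  exact (differentiableAt_id.neg).const_cpow (Or.inl (by exact_mod_cast n.pos.ne'))

theorem continuous_eval (P : DirichletPoly) : Continuous (DirichletPoly.eval P) :=
  (differentiable_eval P).continuous

theorem continuous_eval_line (P : DirichletPoly) (z : ℂ) :
    Continuous fun t : ℝ => DirichletPoly.eval P (z + Complex.I * t) :=
  (continuous_eval P).comp (by fun_prop)

theorem continuous_eval_I (P : DirichletPoly) :
    Continuous fun t : ℝ => DirichletPoly.eval P (Complex.I * t) :=
  (continuous_eval P).comp (by fun_prop)

theorem norm_eval_le (P : DirichletPoly) {s : ℂ} (hs : 0 ≤ s.re) :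
    ‖DirichletPoly.eval P s‖ ≤ P.sum fun _ a => ‖a‖ := by
  refine (norm_sum_le _ _).trans (Finset.sum_le_sum fun n _ => ?_)
  rw [norm_mul]
  exact mul_le_of_le_one_right (norm_nonneg _) (norm_natCast_cpow_le_one n hs)

theorem exists_mul (P Q : DirichletPoly) : ∃ R : DirichletPoly, ∀ s,
    DirichletPoly.eval R s = DirichletPoly.eval P s * DirichletPoly.eval Q s := by
  induction P using Finsupp.induction_linear with
  | zero => exact ⟨0, fun s => by simp [DirichletPoly.eval]⟩
  | add P P' h h' =>
    obtain ⟨R, hR⟩ := h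
    obtain ⟨R', hR'⟩ := h'
    exact ⟨R + R', fun s => by rw [eval_add, eval_add, hR, hR', add_mul]⟩
  | single n a =>
    induction Q using Finsupp.induction_linear with
    | zero => exact ⟨0, fun s => by simp [DirichletPoly.eval]⟩
    | add P P' h h' =>
      obtain ⟨R, hR⟩ := h
      obtain ⟨R', hR'⟩ := h'
      exact ⟨R + R', fun s => by rw [eval_add, eval_add, hR, hR', mul_add]⟩
    | single m b =>
      refine ⟨Finsupp.single (n * m) (a * b), fun s => ?_⟩
      rw [eval_single, eval_single, eval_single, PNat.mul_coe, Nat.cast_mul,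
        Complex.natCast_mul_natCast_cpow]
      ring

theorem exists_pow (P : DirichletPoly) (k : ℕ) : ∃ R : DirichletPoly, ∀ s,
    DirichletPoly.eval R s = DirichletPoly.eval P s ^ k := by
  induction k with
  | zero => exact ⟨Finsupp.single 1 1, fun s => by simp [eval_single]⟩
  | succ k ih =>
    obtain ⟨R, hR⟩ := ih
    obtain ⟨R', hR'⟩ := exists_mul R P
    exact ⟨R', fun s => by rw [hR', hR, pow_succ]⟩

/-- The Dirichlet polynomial `P(s + z)`. -/
noncomputable def shift (z : ℂ) (P : DirichletPoly) : DirichletPoly :=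
  Finsupp.onFinset P.support (fun n => P n * ((n : ℕ) : ℂ) ^ (-z)) fun n hn => by
    rw [Finsupp.mem_support_iff]; exact left_ne_zero_of_mul hn

theorem shift_apply (z : ℂ) (P : DirichletPoly) (n : ℕ+) :
    shift z P n = P n * ((n : ℕ) : ℂ) ^ (-z) := rfl

theorem eval_shift (z : ℂ) (P : DirichletPoly) (s : ℂ) :
    DirichletPoly.eval (shift z P) s = DirichletPoly.eval P (s + z) := by
  unfold DirichletPoly.eval shift
  rw [Finsupp.onFinset_sum _ (by simp), Finsupp.sum]
  refine Finset.sum_congr rfl fun n _ => ?_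
  rw [natCast_cpow_add]; ring

/-- The product is an exponential of frequency log m - log n, which vanishes only for n = m. -/
theorem hasMean_character (n m : ℕ+) : HasMean (fun t : ℝ =>
    ((n : ℕ) : ℂ) ^ (-(Complex.I * t)) * ((m : ℕ) : ℂ) ^ (Complex.I * t))
    (if n = m then 1 else 0) := by
  have hm : ∀ t : ℝ, ((m : ℕ) : ℂ) ^ (Complex.I * t) =
      Complex.exp (Complex.I * ((Real.log (m : ℕ) : ℝ) : ℂ) * t) := fun t => by
    have := natCast_cpow_I m (-t)
    push_cast at this ⊢
    rw [show -(Complex.I * -(t : ℂ)) = Complex.I * t by ring] at this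
    rw [this]; congr 1; ring
  have := hasMean_exp (Real.log (m : ℕ) - Real.log (n : ℕ))
  have hiff : Real.log (m : ℕ) - Real.log (n : ℕ) = 0 ↔ n = m := by
    rw [sub_eq_zero]
    constructor
    · intro h
      have := Real.log_injOn_pos (by simp : ((m : ℕ) : ℝ) ∈ Ioi 0)
        (by simp : ((n : ℕ) : ℝ) ∈ Ioi 0) h
      exact PNat.eq (by exact_mod_cast this.symm)
    · rintro rfl; rfl
  simp only [hiff] at this
  convert this using 2 with t
  rw [natCast_cpow_I, hm, ← Complex.exp_add]
  congr 1; push_cast; ring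

theorem continuous_natCast_cpow_I (m : ℕ+) :
    Continuous fun t : ℝ => ((m : ℕ) : ℂ) ^ (Complex.I * t) :=
  (Continuous.const_cpow (by fun_prop) (Or.inl (by exact_mod_cast m.pos.ne')))

theorem norm_natCast_cpow_I (m : ℕ+) (t : ℝ) : ‖((m : ℕ) : ℂ) ^ (Complex.I * t)‖ = 1 := by
  rw [Complex.norm_natCast_cpow_of_pos m.pos]; simp

theorem conj_natCast_cpow_I (m : ℕ+) (t : ℝ) :
    (starRingEnd ℂ) (((m : ℕ) : ℂ) ^ (-(Complex.I * t))) = ((m : ℕ) : ℂ) ^ (Complex.I * t) := by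
  rw [Complex.cpow_neg, ← Complex.inv_eq_conj (by rw [norm_inv, norm_natCast_cpow_I m t, inv_one]),
    inv_inv]

/-- The coefficients of a Dirichlet polynomial are its Fourier coefficients. -/
theorem hasMean_eval_mul (P : DirichletPoly) (m : ℕ+) : HasMean (fun t : ℝ =>
    DirichletPoly.eval P (Complex.I * t) * ((m : ℕ) : ℂ) ^ (Complex.I * t)) (P m) := by
  have h := hasMean_sum P.support (f := fun n (t : ℝ) => P n *
    (((n : ℕ) : ℂ) ^ (-(Complex.I * t)) * ((m : ℕ) : ℂ) ^ (Complex.I * t)))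
    (fun n => ?_) fun n => (hasMean_character n m).const_mul (P n)
  · convert h using 2 with t
    · unfold DirichletPoly.eval Finsupp.sum
      rw [Finset.sum_mul]
      exact Finset.sum_congr rfl fun n _ => by ring
    · simp only [mul_ite, mul_one, mul_zero]
      rw [Finset.sum_ite_eq']
      split_ifs with h
      · rfl
      · simpa using h
  · have := continuous_natCast_cpow_I m
    refine continuous_const.mul (Continuous.mul ?_ this)
    exact (Continuous.const_cpow (by fun_prop) (Or.inl (by exact_mod_cast n.pos.ne')))

theorem hasMean_eval (P : DirichletPoly) :
    HasMean (fun t : ℝ => DirichletPoly.eval P (Complex.I * t)) (P 1) := by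
  simpa using hasMean_eval_mul P 1

/-- Parseval's formula for Dirichlet polynomials. -/
theorem hasMean_norm_sq (P : DirichletPoly) :
    HasMean (fun t : ℝ => ‖DirichletPoly.eval P (Complex.I * t)‖ ^ 2) (P.sum fun _ a => ‖a‖ ^ 2) := by
  have hc : ∀ m : ℕ+, Continuous fun t : ℝ => (starRingEnd ℂ) (P m) *
      (DirichletPoly.eval P (Complex.I * t) * ((m : ℕ) : ℂ) ^ (Complex.I * t)) := fun m =>
    continuous_const.mul ((continuous_eval_I P).mul (continuous_natCast_cpow_I m))
  -- Only the conjugate factor of |P|² = P · conj P is expanded, so each term has as its mean a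
  -- Fourier coefficient of P times its conjugate.
  have h := hasMean_sum P.support (f := fun m (t : ℝ) => (starRingEnd ℂ) (P m) *
    (DirichletPoly.eval P (Complex.I * t) * ((m : ℕ) : ℂ) ^ (Complex.I * t))) hc
    fun m => (hasMean_eval_mul P m).const_mul _
  have := h.clm (continuous_finsetSum _ fun m _ => hc m) Complex.reCLM
  convert this using 2 with t
  · have e : ∑ m ∈ P.support, (starRingEnd ℂ) (P m) *
        (DirichletPoly.eval P (Complex.I * t) * ((m : ℕ) : ℂ) ^ (Complex.I * t)) =
        DirichletPoly.eval P (Complex.I * t) *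
          (starRingEnd ℂ) (DirichletPoly.eval P (Complex.I * t)) := by
      conv_rhs => rw [DirichletPoly.eval, Finsupp.sum, map_sum, Finset.mul_sum]
      refine Finset.sum_congr rfl fun m _ => ?_
      rw [map_mul]
      rw [conj_natCast_cpow_I]
      unfold DirichletPoly.eval Finsupp.sum
      ring
    rw [e, Complex.mul_conj]
    simp [Complex.normSq_eq_norm_sq]
    norm_cast
  · simp only [map_sum, Finsupp.sum]
    refine Finset.sum_congr rfl fun m _ => ?_
    rw [mul_comm, Complex.mul_conj]
    simp [Complex.normSq_eq_norm_sq]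
    norm_cast

/-- |P|²ᵏ is |Pᵏ|², and Pᵏ is again a Dirichlet polynomial, so Parseval supplies all even moments.
-/
theorem hasPMean {p : ℝ} (hp : 0 < p) (P : DirichletPoly) :
    HasPMean p fun t : ℝ => DirichletPoly.eval P (Complex.I * t) := by
  refine hasPMean_of_even_powers hp (continuous_eval_I P)
    (fun t => norm_eval_le P (by simp)) fun k => ?_
  obtain ⟨R, hR⟩ := exists_pow P k
  refine ⟨_, (hasMean_norm_sq R).congr fun T => ?_⟩
  simp only [hR, norm_pow, ← pow_mul, mul_comm]

end DirichletPoly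

end DirichletPolynomials

/-! ### Uniform limits of Dirichlet polynomials -/

/-- `g` is, on the closed half-plane `0 ≤ Re s`, a uniform limit of Dirichlet polynomials. -/
def IsDirichletLimit (g : ℂ → ℂ) : Prop :=
  ∀ ε > 0, ∃ Q : DirichletPoly, ∀ s : ℂ, 0 ≤ s.re → ‖g s - DirichletPoly.eval Q s‖ ≤ ε

theorem DirichletPoly.isDirichletLimit (P : DirichletPoly) :
    IsDirichletLimit (DirichletPoly.eval P) := fun ε hε => ⟨P, fun s _ => by simpa using hε.le⟩

theorem DirichletPoly.sum_norm_nonneg (P : DirichletPoly) : 0 ≤ P.sum fun _ a => ‖a‖ :=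
  Finset.sum_nonneg fun _ _ => norm_nonneg _

theorem DirichletPoly.tendsto_eval_atTop (P : DirichletPoly) :
    Tendsto (fun σ : ℝ => DirichletPoly.eval P σ) atTop (𝓝 (P 1)) := by
  have h : ∀ n : ℕ+, Tendsto (fun σ : ℝ => ((n : ℕ) : ℂ) ^ (-(σ : ℂ))) atTop
      (𝓝 (if n = 1 then 1 else 0)) := by
    intro n
    split_ifs with hn
    · simp [hn]
    · have h1 : (1 : ℝ) < (n : ℕ) := by
        exact_mod_cast lt_of_le_of_ne n.pos (fun h => hn (PNat.eq h.symm))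
      rw [tendsto_zero_iff_norm_tendsto_zero]
      simp only [DirichletPoly.norm_natCast_cpow, Complex.ofReal_re]
      exact (tendsto_rpow_atBot_of_base_gt_one _ h1).comp tendsto_neg_atTop_atBot
  have e : ∑ n ∈ P.support, P n * (if n = 1 then (1 : ℂ) else 0) = P 1 := by
    simp only [mul_ite, mul_one, mul_zero]
    rw [Finset.sum_ite_eq']
    split_ifs with h
    · rfl
    · exact (by simpa using h : P 1 = 0).symm
  rw [← e]
  exact tendsto_finsetSum P.support fun n _ => (h n).const_mul (P n)

/-- Parseval gives `‖Q - Q(· + κ)‖₂² ≤ ‖Q‖₂² - ‖Q(· + κ)‖₂²`. -/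
theorem DirichletPoly.sum_sq_sub_shift_le (P : DirichletPoly) {κ : ℝ} (hκ : 0 ≤ κ) :
    ((P - DirichletPoly.shift κ P).sum fun _ a => ‖a‖ ^ 2) ≤
      (P.sum fun _ a => ‖a‖ ^ 2) - ((DirichletPoly.shift κ P).sum fun _ a => ‖a‖ ^ 2) := by
  have hs : (DirichletPoly.shift κ P).support ⊆ P.support := Finsupp.support_onFinset_subset
  rw [Finsupp.sum_of_support_subset (s := P.support) _ (Finsupp.support_sub.trans
    (Finset.union_subset le_rfl hs)) _ (by simp), Finsupp.sum_of_support_subset _ hs _ (by simp),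
    Finsupp.sum, ← Finset.sum_sub_distrib]
  refine Finset.sum_le_sum fun n _ => ?_
  rw [Finsupp.sub_apply, DirichletPoly.shift_apply]
  have hx : ((n : ℕ) : ℂ) ^ (-(κ : ℂ)) = ((((n : ℕ) : ℝ) ^ (-κ) : ℝ) : ℂ) := by
    rw [Complex.ofReal_cpow (by positivity)]; push_cast; rfl
  have h1 : ((n : ℕ) : ℝ) ^ (-κ) ≤ 1 :=
    Real.rpow_le_one_of_one_le_of_nonpos (by exact_mod_cast n.pos) (by linarith)
  have h0 : 0 ≤ ((n : ℕ) : ℝ) ^ (-κ) := by positivity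
  rw [hx]
  set x := ((n : ℕ) : ℝ) ^ (-κ)
  have e : P n - P n * (x : ℂ) = P n * ((1 - x : ℝ) : ℂ) := by push_cast; ring
  rw [e, norm_mul, norm_mul, Complex.norm_real, Complex.norm_real, Real.norm_of_nonneg h0,
    Real.norm_of_nonneg (by linarith)]
  -- For 0 ≤ x ≤ 1 one has (1 - x²) - (1 - x)² = 2x(1 - x) ≥ 0.
  nlinarith [mul_nonneg (sq_nonneg ‖P n‖) (mul_nonneg h0 (sub_nonneg.2 h1))]

namespace IsDirichletLimit

theorem of_approx {g : ℂ → ℂ} (h : ∀ ε > 0, ∃ f, IsDirichletLimit f ∧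
    ∀ s : ℂ, 0 ≤ s.re → ‖g s - f s‖ ≤ ε) : IsDirichletLimit g := by
  intro ε hε
  obtain ⟨f, hf, hgf⟩ := h (ε / 2) (by linarith)
  obtain ⟨Q, hQ⟩ := hf (ε / 2) (by linarith)
  refine ⟨Q, fun s hs => ?_⟩
  linarith [norm_sub_le_norm_sub_add_norm_sub (g s) (f s) (DirichletPoly.eval Q s), hgf s hs,
    hQ s hs]

theorem const (c : ℂ) : IsDirichletLimit fun _ => c := fun ε hε =>
  ⟨Finsupp.single 1 c, fun s _ => by simp [DirichletPoly.eval_single, hε.le]⟩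

theorem add {f g : ℂ → ℂ} (hf : IsDirichletLimit f) (hg : IsDirichletLimit g) :
    IsDirichletLimit fun s => f s + g s := fun ε hε => by
  obtain ⟨Q, hQ⟩ := hf (ε / 2) (by linarith)
  obtain ⟨R, hR⟩ := hg (ε / 2) (by linarith)
  refine ⟨Q + R, fun s hs => ?_⟩
  rw [DirichletPoly.eval_add, add_sub_add_comm]
  linarith [norm_add_le (f s - DirichletPoly.eval Q s) (g s - DirichletPoly.eval R s), hQ s hs,
    hR s hs]

theorem sub {f g : ℂ → ℂ} (hf : IsDirichletLimit f) (hg : IsDirichletLimit g) :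
    IsDirichletLimit fun s => f s - g s := fun ε hε => by
  obtain ⟨Q, hQ⟩ := hf (ε / 2) (by linarith)
  obtain ⟨R, hR⟩ := hg (ε / 2) (by linarith)
  refine ⟨Q - R, fun s hs => ?_⟩
  rw [DirichletPoly.eval_sub, sub_sub_sub_comm]
  linarith [norm_sub_le (f s - DirichletPoly.eval Q s) (g s - DirichletPoly.eval R s), hQ s hs,
    hR s hs]

theorem exists_bound {g : ℂ → ℂ} (hg : IsDirichletLimit g) :
    ∃ B > 0, ∀ s : ℂ, 0 ≤ s.re → ‖g s‖ ≤ B := by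
  obtain ⟨Q, hQ⟩ := hg 1 one_pos
  have h0 := Q.sum_norm_nonneg
  refine ⟨1 + Q.sum fun _ a => ‖a‖, by linarith, fun s hs => ?_⟩
  have := norm_add_le (g s - DirichletPoly.eval Q s) (DirichletPoly.eval Q s)
  rw [sub_add_cancel] at this
  linarith [hQ s hs, Q.norm_eval_le hs]

theorem mul {f g : ℂ → ℂ} (hf : IsDirichletLimit f) (hg : IsDirichletLimit g) :
    IsDirichletLimit fun s => f s * g s := fun ε hε => by
  obtain ⟨B, hB, hgB⟩ := hg.exists_bound
  obtain ⟨Q, hQ⟩ := hf (ε / (2 * B)) (by positivity)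
  have h0 := Q.sum_norm_nonneg
  obtain ⟨R, hR⟩ := hg (ε / (2 * ((Q.sum fun _ a => ‖a‖) + 1))) (by positivity)
  obtain ⟨S, hS⟩ := DirichletPoly.exists_mul Q R
  refine ⟨S, fun s hs => ?_⟩
  rw [hS]
  have e : f s * g s - DirichletPoly.eval Q s * DirichletPoly.eval R s =
    (f s - DirichletPoly.eval Q s) * g s +
      DirichletPoly.eval Q s * (g s - DirichletPoly.eval R s) := by ring
  rw [e]
  calc _ ≤ ‖f s - DirichletPoly.eval Q s‖ * ‖g s‖ +
        ‖DirichletPoly.eval Q s‖ * ‖g s - DirichletPoly.eval R s‖ := by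
        rw [← norm_mul, ← norm_mul]; exact norm_add_le _ _
    _ ≤ ε / (2 * B) * B + ((Q.sum fun _ a => ‖a‖) + 1) *
        (ε / (2 * ((Q.sum fun _ a => ‖a‖) + 1))) := by
      gcongr
      · exact hQ s hs
      · exact hgB s hs
      · linarith [Q.norm_eval_le hs]
      · exact hR s hs
    _ = ε := by field_simp; norm_num

theorem pow {g : ℂ → ℂ} (hg : IsDirichletLimit g) (k : ℕ) : IsDirichletLimit fun s => g s ^ k := by
  induction k with
  | zero => simpa using const 1
  | succ k ih => simpa only [pow_succ] using ih.mul hg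

theorem finsetSum {ι : Type*} (S : Finset ι) {g : ι → ℂ → ℂ} (hg : ∀ i, IsDirichletLimit (g i)) :
    IsDirichletLimit fun s => ∑ i ∈ S, g i s := by
  classical
  induction S using Finset.induction_on with
  | empty => simpa using const 0
  | insert i S hi ih => simpa only [Finset.sum_insert hi] using (hg i).add ih

/-- Composition with a function that is holomorphic on a larger disc. -/
theorem comp {g : ℂ → ℂ} (hg : IsDirichletLimit g) {F : ℂ → ℂ} {c : ℂ} {r R : ℝ}
    (hR : 0 < R) (hrR : r < R) (hF : DifferentiableOn ℂ F (Metric.closedBall c R))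
    (hgr : ∀ s : ℂ, 0 ≤ s.re → ‖g s - c‖ ≤ r) : IsDirichletLimit fun s => F (g s) := by
  lift R to NNReal using hR.le
  have hps := hF.hasFPowerSeriesOnBall (by exact_mod_cast hR)
  have hr0 : 0 ≤ r := (norm_nonneg _).trans (hgr 0 (by simp))
  obtain ⟨r', hr', hr'R⟩ := exists_between hrR
  lift r' to NNReal using hr0.trans hr'.le
  have hu := hps.tendstoUniformlyOn' (r' := r') (by exact_mod_cast hr'R)
  rw [Metric.tendstoUniformlyOn_iff] at hu
  refine of_approx fun ε hε => ?_
  obtain ⟨n, hn⟩ := (hu ε hε).exists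
  refine ⟨fun s => (cauchyPowerSeries F c R).partialSum n (g s - c), ?_, fun s hs => ?_⟩
  · simp only [FormalMultilinearSeries.partialSum, FormalMultilinearSeries.apply_eq_pow_smul_coeff,
      smul_eq_mul]
    exact finsetSum _ fun k => ((hg.sub (const c)).pow k).mul (const _)
  · have := hn (g s) (by
      rw [Metric.mem_ball, dist_eq_norm]; exact (hgr s hs).trans_lt hr')
    rw [dist_eq_norm] at this
    exact this.le

theorem shift {g : ℂ → ℂ} (hg : IsDirichletLimit g) {z : ℂ} (hz : 0 ≤ z.re) :
    IsDirichletLimit fun s => g (s + z) := fun ε hε => by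
  obtain ⟨Q, hQ⟩ := hg ε hε
  refine ⟨DirichletPoly.shift z Q, fun s hs => ?_⟩
  rw [DirichletPoly.eval_shift]
  exact hQ _ (by rw [Complex.add_re]; linarith)

theorem continuous_line {g : ℂ → ℂ} (hg : IsDirichletLimit g) :
    Continuous fun t : ℝ => g (Complex.I * t) := by
  refine continuous_of_uniform_approx_of_continuous fun u hu => ?_
  obtain ⟨ε, hε, hu⟩ := Metric.mem_uniformity_dist.1 hu
  obtain ⟨Q, hQ⟩ := hg (ε / 2) (by linarith)
  refine ⟨_, Q.continuous_eval_I, fun t => hu ?_⟩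
  rw [dist_eq_norm]
  linarith [hQ (Complex.I * t) (by simp)]

theorem hasPMean {p : ℝ} (hp : 0 < p) {g : ℂ → ℂ} (hg : IsDirichletLimit g) :
    HasPMean p fun t : ℝ => g (Complex.I * t) := by
  obtain ⟨B, -, hB⟩ := hg.exists_bound
  refine HasPMean.of_approx hp hg.continuous_line (fun t => hB _ (by simp)) fun ε hε => ?_
  obtain ⟨Q, hQ⟩ := hg ε hε
  exact ⟨_, Q.hasPMean hp, fun t => hQ _ (by simp)⟩

/-- The mean value along the imaginary axis is the value at `+∞`. -/
theorem exists_mean {g : ℂ → ℂ} (hg : IsDirichletLimit g) :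
    ∃ m, HasMean (fun t : ℝ => g (Complex.I * t)) m ∧
      Tendsto (fun σ : ℝ => g σ) atTop (𝓝 m) := by
  obtain ⟨m, hm⟩ : ∃ m, HasMean (fun t : ℝ => g (Complex.I * t)) m :=
    exists_hasMean_of_approx hg.continuous_line fun ε hε => by
      obtain ⟨Q, hQ⟩ := hg ε hε
      exact ⟨_, _, Q.continuous_eval_I, Q.hasMean_eval, fun t => hQ _ (by simp)⟩
  refine ⟨m, hm, Metric.tendsto_nhds.2 fun ε hε => ?_⟩
  obtain ⟨Q, hQ⟩ := hg (ε / 4) (by linarith)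
  have h1 : ‖m - Q 1‖ ≤ ε / 4 :=
    (hm.sub hg.continuous_line Q.continuous_eval_I Q.hasMean_eval).norm_le continuous_const
      (hasMean_const _) fun t => hQ _ (by simp)
  filter_upwards [eventually_ge_atTop 0,
    Metric.tendsto_nhds.1 Q.tendsto_eval_atTop (ε / 4) (by linarith)] with σ hσ hσ'
  have h2 := hQ σ (by simpa using hσ)
  rw [← dist_eq_norm] at h1 h2
  rw [dist_comm] at h1
  linarith [dist_triangle4 (g σ) (DirichletPoly.eval Q σ) (Q 1) m]

theorem hasMean_of_tendsto {g : ℂ → ℂ} (hg : IsDirichletLimit g) {m : ℂ}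
    (h : Tendsto (fun σ : ℝ => g σ) atTop (𝓝 m)) :
    HasMean (fun t : ℝ => g (Complex.I * t)) m := by
  obtain ⟨m', h1, h2⟩ := hg.exists_mean
  rwa [tendsto_nhds_unique h h2]

/-- Since |n⁻ˢ| ≤ 1 on the closed half-plane, for a polynomial the claim reduces to n^(-κ) → 1 for
finitely many n; uniform limits inherit it. -/
theorem exists_norm_shift_sub_le {g : ℂ → ℂ} (hg : IsDirichletLimit g) {ε : ℝ} (hε : 0 < ε) :
    ∃ δ > 0, ∀ κ : ℝ, 0 ≤ κ → κ ≤ δ → ∀ s : ℂ, 0 ≤ s.re → ‖g (s + κ) - g s‖ ≤ ε := by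
  obtain ⟨Q, hQ⟩ := hg (ε / 3) (by linarith)
  have hc : Tendsto (fun κ : ℝ => ∑ n ∈ Q.support, ‖Q n‖ *
      ‖((n : ℕ) : ℂ) ^ (-(κ : ℂ)) - 1‖) (𝓝 0) (𝓝 0) := by
    have : Continuous (fun κ : ℝ => ∑ n ∈ Q.support, ‖Q n‖ *
      ‖((n : ℕ) : ℂ) ^ (-(κ : ℂ)) - 1‖) := by
      refine continuous_finsetSum _ fun n _ => continuous_const.mul (Continuous.norm ?_)
      exact (Continuous.const_cpow (by fun_prop) (Or.inl (by exact_mod_cast n.pos.ne'))).sub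
        continuous_const
    simpa using this.tendsto 0
  obtain ⟨δ, hδ, hc⟩ := Metric.eventually_nhds_iff.1
    (hc.eventually (gt_mem_nhds (show 0 < ε / 3 by linarith)))
  refine ⟨δ / 2, by linarith, fun κ hκ0 hκ s hs => ?_⟩
  have h1 := hQ s hs
  have h2 := hQ (s + κ) (by simp; linarith)
  have h3 : ‖DirichletPoly.eval Q (s + κ) - DirichletPoly.eval Q s‖ ≤ ε / 3 := by
    refine le_trans ?_ (hc (y := κ) (by rw [dist_zero_right, Real.norm_of_nonneg hκ0]; linarith)).le
    unfold DirichletPoly.eval Finsupp.sum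
    rw [← Finset.sum_sub_distrib]
    refine (norm_sum_le _ _).trans (Finset.sum_le_sum fun n _ => ?_)
    dsimp only
    rw [DirichletPoly.natCast_cpow_add, ← mul_sub, norm_mul]
    gcongr
    rw [show ∀ a b : ℂ, a * b - a = a * (b - 1) by intros; ring, norm_mul]
    exact mul_le_of_le_one_left (norm_nonneg _) (DirichletPoly.norm_natCast_cpow_le_one n hs)
  rw [← dist_eq_norm] at *
  rw [dist_comm] at h1
  linarith [dist_triangle4 (g (s + κ)) (DirichletPoly.eval Q (s + κ)) (DirichletPoly.eval Q s)
    (g s)]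

theorem exists_seq {g : ℂ → ℂ} (hg : IsDirichletLimit g) :
    ∃ Q : ℕ → DirichletPoly, ∀ k (s : ℂ), 0 ≤ s.re →
      ‖g s - DirichletPoly.eval (Q k) s‖ ≤ 1 / ((k : ℝ) + 1) := by
  choose Q hQ using fun k : ℕ => hg (1 / ((k : ℝ) + 1)) (by positivity)
  exact ⟨Q, hQ⟩

end IsDirichletLimit

theorem HasPMean.abs_sub_le {p : ℝ} (hp : 1 ≤ p) {F G : ℝ → ℂ} (hF : HasPMean p F)
    (hG : HasPMean p G) (hFG : HasPMean p fun t => F t - G t) :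
    |besicovitchFun p F - besicovitchFun p G| ≤ besicovitchFun p fun t => F t - G t := by
  have h1 := besicovitchFun_add_le hp hG hFG hF fun t => by
    simpa using norm_add_le (G t) (F t - G t)
  have h2 := besicovitchFun_add_le hp hF hFG hG fun t => by
    simpa using norm_sub_le (F t) (F t - G t)
  rw [abs_le]; constructor <;> linarith

theorem besicovitchFun_tendsto_of_approx {p : ℝ} (hp : 1 ≤ p) {F : ℝ → ℂ} {G : ℕ → ℝ → ℂ}
    (hF : HasPMean p F)
    (hG : ∀ k, HasPMean p (G k)) (hFG : ∀ k, HasPMean p fun t => F t - G k t) {ε : ℕ → ℝ}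
    (hε : Tendsto ε atTop (𝓝 0)) (h : ∀ k t, ‖F t - G k t‖ ≤ ε k) :
    Tendsto (fun k => besicovitchFun p (G k)) atTop (𝓝 (besicovitchFun p F)) := by
  rw [tendsto_iff_dist_tendsto_zero]
  refine squeeze_zero (fun _ => dist_nonneg) (fun k => ?_) hε
  rw [dist_comm, Real.dist_eq]
  exact (hF.abs_sub_le hp (hG k) (hFG k)).trans ((hFG k).le_of_bound (by linarith) (h k))

theorem DirichletPoly.besicovitchFun_two_sq (P : DirichletPoly) :
    besicovitchFun 2 (fun t : ℝ => DirichletPoly.eval P (Complex.I * t)) ^ 2 =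
      P.sum fun _ a => ‖a‖ ^ 2 := by
  have := (P.hasPMean two_pos).hasMean two_pos
  simp only [Real.rpow_two] at this
  exact this.unique P.hasMean_norm_sq

/-- The coefficient inequality `DirichletPoly.sum_sq_sub_shift_le` passes to uniform limits. It
shows that 2-norms on vertical lines decrease to the right, and that a small decrease forces a small
displacement. -/
theorem IsDirichletLimit.besicovitchFun_two_sub_shift_le {g : ℂ → ℂ} (hg : IsDirichletLimit g)
    {κ : ℝ} (hκ : 0 ≤ κ) :
    besicovitchFun 2 (fun t : ℝ => g (Complex.I * t) - g (Complex.I * t + κ)) ^ 2 ≤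
      besicovitchFun 2 (fun t : ℝ => g (Complex.I * t)) ^ 2 -
        besicovitchFun 2 (fun t : ℝ => g (Complex.I * t + κ)) ^ 2 := by
  obtain ⟨Q, hQ⟩ := hg.exists_seq
  have hgκ := hg.shift (z := κ) (by simpa using hκ)
  have hlim := tendsto_one_div_add_atTop_nhds_zero_nat (𝕜 := ℝ)
  have hre : ∀ t : ℝ, 0 ≤ (Complex.I * t).re := fun t => by simp
  have hreκ : ∀ t : ℝ, 0 ≤ (Complex.I * t + κ).re := fun t => by simp [hκ]
  have hQκ := fun k => (Q k).isDirichletLimit.shift (z := κ) (by simpa using hκ)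
  have h1 := besicovitchFun_tendsto_of_approx one_le_two (hg.hasPMean two_pos)
    (fun k => (Q k).hasPMean two_pos)
    (fun k => (hg.sub (Q k).isDirichletLimit).hasPMean two_pos) hlim (fun k t => hQ k _ (hre t))
  have h2 := besicovitchFun_tendsto_of_approx one_le_two (hgκ.hasPMean two_pos)
    (fun k => (hQκ k).hasPMean two_pos)
    (fun k => (hgκ.sub (hQκ k)).hasPMean two_pos) hlim
    (fun k t => hQ k _ (hreκ t))
  have h3 := besicovitchFun_tendsto_of_approx one_le_two ((hg.sub hgκ).hasPMean two_pos)
    (fun k => ((Q k).isDirichletLimit.sub (hQκ k)).hasPMean two_pos)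
    (fun k => ((hg.sub hgκ).sub ((Q k).isDirichletLimit.sub (hQκ k))).hasPMean two_pos)
    (ε := fun k : ℕ => 2 * (1 / ((k : ℝ) + 1))) (by simpa using hlim.const_mul 2) (fun k t => by
      rw [sub_sub_sub_comm, two_mul]
      exact (norm_sub_le _ _).trans (add_le_add (hQ k _ (hre t)) (hQ k _ (hreκ t))))
  refine le_of_tendsto_of_tendsto' (h3.pow 2) ((h1.pow 2).sub (h2.pow 2)) fun k => ?_
  simp only [← DirichletPoly.eval_shift, ← DirichletPoly.eval_sub]
  rw [DirichletPoly.besicovitchFun_two_sq, DirichletPoly.besicovitchFun_two_sq,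
    DirichletPoly.besicovitchFun_two_sq]
  exact (Q k).sum_sq_sub_shift_le hκ

/-! ### The Poisson kernel as a Cauchy distribution -/

section StdCauchy

/-- The standard Cauchy distribution on the real line. -/
noncomputable def stdCauchy : Measure ℝ :=
  volume.withDensity fun y => ENNReal.ofReal (Real.pi⁻¹ * (1 + y ^ 2)⁻¹)

theorem stdCauchy_density_nonneg (y : ℝ) : 0 ≤ Real.pi⁻¹ * (1 + y ^ 2)⁻¹ := by
  have := Real.pi_pos; positivity

theorem measurable_stdCauchy_density :
    Measurable fun y : ℝ => ENNReal.ofReal (Real.pi⁻¹ * (1 + y ^ 2)⁻¹) := by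
  fun_prop

instance : IsProbabilityMeasure stdCauchy := by
  constructor
  rw [stdCauchy, withDensity_apply _ MeasurableSet.univ, Measure.restrict_univ,
    ← ofReal_integral_eq_lintegral_ofReal (integrable_inv_one_add_sq.const_mul _)
      (Eventually.of_forall stdCauchy_density_nonneg), integral_const_mul,
    integral_univ_inv_one_add_sq, inv_mul_cancel₀ Real.pi_ne_zero, ENNReal.ofReal_one]

theorem integral_stdCauchy {E : Type*} [NormedAddCommGroup E] [NormedSpace ℝ E] (f : ℝ → E) :
    ∫ y, f y ∂stdCauchy = ∫ y, (Real.pi⁻¹ * (1 + y ^ 2)⁻¹) • f y := by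
  rw [stdCauchy, integral_withDensity_eq_integral_toReal_smul measurable_stdCauchy_density
    (Eventually.of_forall fun _ => ENNReal.ofReal_lt_top)]
  simp only [ENNReal.toReal_ofReal (stdCauchy_density_nonneg _)]

-- The Cauchy density is the Fourier transform of exp(-2π|y|), so Fourier inversion gives its
-- characteristic function.
open FourierTransform in
theorem integral_exp_stdCauchy {x : ℝ} (hx : 0 ≤ x) :
    ∫ y, Complex.exp (-(Complex.I * x * y)) ∂stdCauchy = Complex.exp (-x) := by
  have hpi := Real.pi_pos
  set g : ℝ → ℂ := fun y => Complex.exp ((-(2 * Real.pi * |y|) : ℝ) : ℂ) with hg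
  have hgc : Continuous g := by fun_prop
  have e1 : ∀ ξ : ℝ, ∀ y ∈ Ioi (0 : ℝ), Complex.exp (↑(-2 * Real.pi * y * ξ) * Complex.I) • g y =
      Complex.exp (-(2 * Real.pi * (1 + Complex.I * ξ)) * y) := fun ξ y hy => by
    rw [hg, smul_eq_mul, ← Complex.exp_add, abs_of_pos hy]
    congr 1; push_cast; ring
  have e2 : ∀ ξ : ℝ, ∀ y ∈ Iic (0 : ℝ), Complex.exp (↑(-2 * Real.pi * y * ξ) * Complex.I) • g y =
      Complex.exp ((2 * Real.pi * (1 - Complex.I * ξ)) * y) := fun ξ y hy => by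
    rw [hg, smul_eq_mul, ← Complex.exp_add, abs_of_nonpos hy]
    congr 1; push_cast; ring
  have r1 : ∀ ξ : ℝ, (-(2 * Real.pi * (1 + Complex.I * ξ)) : ℂ).re < 0 := fun ξ => by
    simp; positivity
  have r2 : ∀ ξ : ℝ, 0 < (2 * Real.pi * (1 - Complex.I * ξ) : ℂ).re := fun ξ => by
    simp; positivity
  have i1 : ∀ ξ : ℝ, IntegrableOn (fun y : ℝ => Complex.exp (↑(-2 * Real.pi * y * ξ) * Complex.I) •
      g y) (Ioi 0) := fun ξ =>
    (integrableOn_exp_mul_complex_Ioi (r1 ξ) 0).congr_fun (fun y hy => (e1 ξ y hy).symm)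
      measurableSet_Ioi
  have i2 : ∀ ξ : ℝ, IntegrableOn (fun y : ℝ => Complex.exp (↑(-2 * Real.pi * y * ξ) * Complex.I) •
      g y) (Iic 0) := fun ξ =>
    (integrableOn_exp_mul_complex_Iic (r2 ξ) 0).congr_fun (fun y hy => (e2 ξ y hy).symm)
      measurableSet_Iic
  have hF : 𝓕 g = fun ξ : ℝ => (((Real.pi⁻¹ * (1 + ξ ^ 2)⁻¹ : ℝ)) : ℂ) := by
    ext ξ
    rw [Real.fourier_real_eq_integral_exp_smul, ← intervalIntegral.integral_Iic_add_Ioi (i2 ξ) (i1 ξ),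
      setIntegral_congr_fun measurableSet_Ioi (e1 ξ), setIntegral_congr_fun measurableSet_Iic (e2 ξ),
      integral_exp_mul_complex_Ioi (r1 ξ), integral_exp_mul_complex_Iic (r2 ξ)]
    have h1 : (1 + Complex.I * ξ : ℂ) ≠ 0 := fun h => by simpa using congrArg Complex.re h
    have h2 : (1 - Complex.I * ξ : ℂ) ≠ 0 := fun h => by simpa using congrArg Complex.re h
    have h3 : (1 + (ξ : ℂ) ^ 2) = (1 + Complex.I * ξ) * (1 - Complex.I * ξ) := by
      ring_nf; rw [Complex.I_sq]; ring
    have hpi' : (Real.pi : ℂ) ≠ 0 := by exact_mod_cast hpi.ne'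
    push_cast
    rw [h3]
    simp only [mul_zero, Complex.exp_zero]
    field_simp
    ring
  have hgi : Integrable g := by
    have h1 := i1 0
    have h2 := i2 0
    simp only [mul_zero, Complex.ofReal_zero, zero_mul, Complex.exp_zero, one_smul] at h1 h2
    rw [← integrableOn_univ, ← Iic_union_Ioi (a := (0 : ℝ))]
    exact h2.union h1
  have hinv := hgc.fourierInv_fourier_eq hgi (by
    rw [hF]; exact (integrable_inv_one_add_sq.const_mul _).ofReal)
  -- This point turns the kernel exp(2πi y ξ) of the inverse transform into exp(-ixy).
  have := congrFun hinv (-x / (2 * Real.pi))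
  rw [Real.fourierInv_eq', hF] at this
  rw [integral_stdCauchy]
  convert this using 1
  · refine integral_congr_ae (Eventually.of_forall fun y => ?_)
    simp only [Complex.real_smul, smul_eq_mul]
    rw [mul_comm]
    congr 2
    simp only [RCLike.inner_apply, conj_trivial]
    push_cast
    have hpi' : (Real.pi : ℂ) ≠ 0 := by exact_mod_cast hpi.ne'
    field_simp
  · rw [hg]
    simp only
    rw [abs_div, abs_neg, abs_of_nonneg hx, abs_of_pos (by positivity)]
    congr 1
    rw [mul_div_cancel₀ _ (by positivity)]
    push_cast; rfl

theorem DirichletPoly.integrable_line (P : DirichletPoly) {z : ℂ} (hz : 0 ≤ z.re) (a : ℝ) :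
    Integrable (fun y : ℝ => DirichletPoly.eval P (z + Complex.I * (a * y))) stdCauchy := by
  refine Integrable.of_bound (C := P.sum fun _ a => ‖a‖) ?_ (Eventually.of_forall fun y => ?_)
  · exact (P.continuous_eval.comp (by fun_prop)).aestronglyMeasurable
  · exact P.norm_eval_le (by simpa using hz)

/-- The Poisson formula for Dirichlet polynomials. -/
theorem DirichletPoly.eval_add_eq_integral (P : DirichletPoly) (z : ℂ) {a : ℝ} (ha : 0 ≤ a) :
    DirichletPoly.eval P (z + a) =
      ∫ y, DirichletPoly.eval P (z + Complex.I * (a * y)) ∂stdCauchy := by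
  have key : ∀ n : ℕ+, ∀ y : ℝ, ((n : ℕ) : ℂ) ^ (-(z + Complex.I * (a * y))) =
      ((n : ℕ) : ℂ) ^ (-z) *
        Complex.exp (-(Complex.I * ((a * Real.log (n : ℕ) : ℝ) : ℂ) * y)) := fun n y => by
    rw [DirichletPoly.natCast_cpow_add]
    congr 1
    have := DirichletPoly.natCast_cpow_I n (a * y)
    push_cast at this
    rw [this]; congr 1; push_cast; ring
  unfold DirichletPoly.eval Finsupp.sum
  simp only [key]
  rw [integral_finsetSum]
  · refine Finset.sum_congr rfl fun n _ => ?_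
    rw [integral_const_mul, integral_const_mul, integral_exp_stdCauchy
      (mul_nonneg ha (Real.log_natCast_nonneg _)), DirichletPoly.natCast_cpow_add]
    congr 2
    rw [Complex.cpow_def_of_ne_zero (by exact_mod_cast n.pos.ne'), ← Complex.natCast_log]
    congr 1; push_cast; ring
  · intro n _
    refine Integrable.const_mul (Integrable.const_mul ?_ _) _
    refine Integrable.of_bound (C := 1) (by fun_prop) (Eventually.of_forall fun y => ?_)
    rw [show -(Complex.I * ((a * Real.log (n : ℕ) : ℝ) : ℂ) * y) =
      ((-(a * Real.log (n : ℕ) * y) : ℝ) : ℂ) * Complex.I by push_cast; ring,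
      Complex.norm_exp_ofReal_mul_I]

/-- Jensen's inequality for xᵖ, applied to the Poisson formula. -/
theorem DirichletPoly.norm_eval_rpow_le {p : ℝ} (hp : 1 ≤ p) (P : DirichletPoly) {z : ℂ}
    (hz : 0 ≤ z.re) {a : ℝ} (ha : 0 ≤ a) :
    ‖DirichletPoly.eval P (z + a)‖ ^ p ≤
      ∫ y, ‖DirichletPoly.eval P (z + Complex.I * (a * y))‖ ^ p ∂stdCauchy := by
  have hint := P.integrable_line hz a
  rw [P.eval_add_eq_integral z ha]
  refine (Real.rpow_le_rpow (norm_nonneg _) (norm_integral_le_integral_norm _)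
    (by linarith)).trans ?_
  refine (convexOn_rpow hp).map_integral_le (μ := stdCauchy)
    (f := fun y : ℝ => ‖DirichletPoly.eval P (z + Complex.I * (a * y))‖)
    (continuousOn_id.rpow_const fun x _ => Or.inr (by linarith)) isClosed_Ici
    (Eventually.of_forall fun y => norm_nonneg _) hint.norm ?_
  refine Integrable.of_bound (C := (P.sum fun _ a => ‖a‖) ^ p) ?_ (Eventually.of_forall fun y => ?_)
  · refine (Continuous.rpow_const (Continuous.norm ?_) fun _ =>
      Or.inr (by linarith)).aestronglyMeasurable
    exact P.continuous_eval.comp (by fun_prop)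
  · rw [Function.comp, Real.norm_of_nonneg (by positivity)]
    have := P.norm_eval_le (s := z + Complex.I * (a * y)) (by simpa using hz)
    gcongr

end StdCauchy

/-! ### Means of Poisson integrals -/

theorem continuous_integral_of_bound {ν : Measure ℝ} [IsFiniteMeasure ν] {K : ℝ → ℝ → ℝ}
    (hK : Continuous fun x : ℝ × ℝ => K x.1 x.2) {B : ℝ} (hB : ∀ t y, ‖K t y‖ ≤ B) :
    Continuous fun t => ∫ y, K t y ∂ν :=
  continuous_of_dominated (bound := fun _ => B)
    (fun t => (by fun_prop : Continuous fun y => K t y).aestronglyMeasurable)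
    (fun t => Eventually.of_forall (hB t)) (integrable_const _)
    (Eventually.of_forall fun y => by fun_prop)

/-- The mean of an integral depending on a parameter. -/
theorem hasMean_integral {ν : Measure ℝ} [IsFiniteMeasure ν] {K : ℝ → ℝ → ℝ}
    (hK : Continuous fun x : ℝ × ℝ => K x.1 x.2) {B : ℝ} (hB : ∀ t y, ‖K t y‖ ≤ B) {m : ℝ → ℝ}
    (hm : ∀ y, HasMean (fun t => K t y) (m y)) :
    HasMean (fun t => ∫ y, K t y ∂ν) (∫ y, m y ∂ν) := by
  have h : Tendsto (fun T : ℝ => ∫ y, (1 / (2 * T)) • (∫ t in (-T)..T, K t y) ∂ν) atTop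
      (𝓝 (∫ y, m y ∂ν)) := by
    refine tendsto_integral_filter_of_dominated_convergence (fun _ => B) ?_ ?_
      (integrable_const _) (Eventually.of_forall hm)
    · refine Eventually.of_forall fun T => Continuous.aestronglyMeasurable ?_
      refine Continuous.const_smul ?_ (1 / (2 * T))
      exact intervalIntegral.continuous_parametric_intervalIntegral_of_continuous'
        (f := fun y t => K t y) (by exact hK.comp continuous_swap) _ _
    · filter_upwards [eventually_gt_atTop 0] with T hT
      exact Eventually.of_forall fun y => norm_average_le hT fun t => hB t y
  refine h.congr' ?_
  filter_upwards [eventually_gt_atTop 0] with T hT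
  rw [integral_smul]
  congr 1
  rw [intervalIntegral.integral_of_le (by linarith)]
  simp only [intervalIntegral.integral_of_le (show -T ≤ T by linarith)]
  refine integral_integral_swap (f := fun y t => K t y) ?_
  refine Integrable.of_bound (C := B) ?_ (Eventually.of_forall fun x => hB _ _)
  exact (hK.comp continuous_swap).aestronglyMeasurable

/-- P(s + a) is a Poisson average of vertical translates of P, and the p-th power means of these all
agree. -/
theorem DirichletPoly.besicovitchNorm_shift_le {p : ℝ} (hp : 1 ≤ p) (P : DirichletPoly) {a : ℝ}
    (ha : 0 ≤ a) : besicovitchNorm p (DirichletPoly.shift a P) ≤ besicovitchNorm p P := by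
  have hp0 : 0 < p := by linarith
  have hP := (P.hasPMean hp0).hasMean hp0
  have hPs := (DirichletPoly.shift a P).hasPMean hp0
  refine hPs.le_of_hasMean_le hp0 (hPs.hasMean hp0) ((P.hasPMean hp0).nonneg hp0) ?_
  set K : ℝ → ℝ → ℝ := fun t y => ‖DirichletPoly.eval P (Complex.I * ((t + a * y : ℝ) : ℂ))‖ ^ p
  have hb : ∀ t : ℝ, ‖‖DirichletPoly.eval P (Complex.I * t)‖ ^ p‖ ≤
      (P.sum fun _ a => ‖a‖) ^ p := fun t => by
    rw [Real.norm_of_nonneg (by positivity)]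
    have := P.norm_eval_le (s := Complex.I * t) (by simp)
    gcongr
  have hKc : Continuous fun x : ℝ × ℝ => K x.1 x.2 := by
    refine Continuous.rpow_const (Continuous.norm ?_) fun _ => Or.inr hp0.le
    exact P.continuous_eval.comp (by fun_prop)
  have hKm := hasMean_integral (ν := stdCauchy) hKc (B := (P.sum fun _ a => ‖a‖) ^ p)
    (fun t y => hb _)
    (fun y => hP.translate (continuous_norm_rpow hp0 P.continuous_eval_I) hb (a * y))
  rw [integral_const, probReal_univ, one_smul] at hKm
  refine (hPs.hasMean hp0).mono (continuous_norm_rpow hp0 hPs.1)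
    (continuous_integral_of_bound hKc fun t y => hb _) hKm fun t => ?_
  rw [DirichletPoly.eval_shift]
  refine (P.norm_eval_rpow_le hp (by simp) ha).trans_eq ?_
  refine integral_congr_ae (Eventually.of_forall fun y => ?_)
  simp only [K]
  congr 3; push_cast; ring

theorem summable_inv_one_add_int_sq : Summable fun n : ℤ => (1 + (n : ℝ) ^ 2)⁻¹ := by
  refine Summable.of_nonneg_of_le (fun n => by positivity) (fun n => ?_)
    ((Real.summable_one_div_int_pow.2 one_lt_two).add (hasSum_ite_eq (0 : ℤ) (1 : ℝ)).summable)
  split_ifs with h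
  · simp [h]
  · have h1 : (n : ℝ) ≠ 0 := by exact_mod_cast h
    have : 0 < (n : ℝ) ^ 2 := by positivity
    rw [add_zero, one_div]
    gcongr
    linarith

/-- Uniform bounds on the integrals over intervals of length one bound the integral against the
Cauchy distribution. -/
theorem exists_integral_stdCauchy_le : ∃ S > 0, ∀ (f : ℝ → ℝ) (A B : ℝ), Continuous f →
    (∀ y, 0 ≤ f y) → (∀ y, f y ≤ B) → (∀ τ, ∫ y in τ..(τ + 1), f y ≤ A) →
    ∫ y, f y ∂stdCauchy ≤ S * A := by
  have hpi := Real.pi_pos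
  have hs := summable_inv_one_add_int_sq
  -- The 3 comes from 1 + n² ≤ 3(1 + y²) for y in (n, n + 1], which makes the Cauchy density
  -- comparable with its value at n.
  refine ⟨Real.pi⁻¹ * 3 * ∑' n : ℤ, (1 + (n : ℝ) ^ 2)⁻¹, ?_, fun f A B hf h0 hB hA => ?_⟩
  · have : 0 < ∑' n : ℤ, (1 + (n : ℝ) ^ 2)⁻¹ :=
      hs.tsum_pos (fun n => by positivity) 0 (by positivity)
    positivity
  rw [integral_stdCauchy]
  simp only [smul_eq_mul]
  have hint : Integrable fun y : ℝ => Real.pi⁻¹ * (1 + y ^ 2)⁻¹ * f y := by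
    refine (integrable_inv_one_add_sq.const_mul _).mul_bdd (c := B) hf.aestronglyMeasurable
      (Eventually.of_forall fun y => ?_)
    rw [Real.norm_of_nonneg (h0 y)]; exact hB y
  have hsum := hasSum_integral_iUnion (μ := volume) (s := fun n : ℤ => Ioc (n : ℝ) (n + 1))
    (f := fun y : ℝ => Real.pi⁻¹ * (1 + y ^ 2)⁻¹ * f y) (fun _ => measurableSet_Ioc)
    (pairwise_disjoint_Ioc_intCast ℝ) hint.integrableOn
  rw [iUnion_Ioc_intCast, setIntegral_univ] at hsum
  rw [← hsum.tsum_eq, mul_assoc, mul_assoc, ← tsum_mul_right, ← tsum_mul_left, ← tsum_mul_left]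
  refine hsum.summable.tsum_le_tsum (fun n => ?_)
    (((hs.mul_right A).mul_left 3).mul_left Real.pi⁻¹)
  have h1 : ∀ y ∈ Ioc (n : ℝ) (n + 1), Real.pi⁻¹ * (1 + y ^ 2)⁻¹ * f y ≤
      Real.pi⁻¹ * (3 * (1 + (n : ℝ) ^ 2)⁻¹) * f y := fun y hy => by
    have := h0 y
    gcongr
    rw [← div_eq_mul_inv, le_div_iff₀ (by positivity), inv_mul_le_iff₀ (by positivity)]
    nlinarith [sq_nonneg (y + (y - n)), mul_nonneg (sub_nonneg.2 hy.1.le)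
      (sub_nonneg.2 (sub_le_iff_le_add'.2 hy.2))]
  refine (setIntegral_mono_on hint.integrableOn ?_ measurableSet_Ioc h1).trans ?_
  · exact (hf.integrableOn_Icc.mono_set Ioc_subset_Icc_self).const_mul _
  · rw [integral_const_mul, ← intervalIntegral.integral_of_le (by linarith)]
    have := hA n
    calc _ ≤ Real.pi⁻¹ * (3 * (1 + (n : ℝ) ^ 2)⁻¹) * A := by gcongr
      _ = _ := by ring

/-- A substitution moves the point (a, b) out of f and into the kernel: the new factor is the ratio
of its Poisson kernel to the Cauchy density. Means in t can then be taken at fixed y. -/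
theorem integral_stdCauchy_comp {a : ℝ} (ha : 0 < a) (b : ℝ) (f : ℝ → ℝ) :
    ∫ y, f (b + a * y) ∂stdCauchy =
      ∫ y, f y * ((1 + y ^ 2) * (a / (a ^ 2 + (y - b) ^ 2))) ∂stdCauchy := by
  rw [integral_stdCauchy, integral_stdCauchy]
  set G : ℝ → ℝ := fun y => Real.pi⁻¹ * (a / (a ^ 2 + (y - b) ^ 2)) * f y with hG
  have hpi := Real.pi_pos
  have h1 : ∀ y, (Real.pi⁻¹ * (1 + y ^ 2)⁻¹) • f (b + a * y) = a * G (b + a * y) := fun y => by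
    rw [hG, smul_eq_mul]
    have h2 : a ^ 2 + (b + a * y - b) ^ 2 = a ^ 2 * (1 + y ^ 2) := by ring
    simp only [h2]
    field_simp
  have h2 : ∀ y, (Real.pi⁻¹ * (1 + y ^ 2)⁻¹) • (f y * ((1 + y ^ 2) * (a / (a ^ 2 + (y - b) ^ 2)))) =
      G y := fun y => by
    rw [hG, smul_eq_mul]
    have h3 : (1 + y ^ 2) ≠ 0 := by positivity
    field_simp
  simp only [h1, h2]
  rw [integral_const_mul, Measure.integral_comp_mul_left (fun y => G (b + y)),
    integral_add_left_eq_self, smul_eq_mul, abs_of_pos (by positivity), ← mul_assoc,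
    mul_inv_cancel₀ ha.ne', one_mul]

/-- The part of the disc |u| ≤ B with Re u ≥ η lies in a disc about a large real R that stays away
from 0: |u - R|² ≤ B² - 2Rη + R², which is R² - B² for R = B²/η. There 1/z is holomorphic on a
larger disc, and `IsDirichletLimit.comp` applies. -/
theorem IsDirichletLimit.inv {u : ℂ → ℂ} (hu : IsDirichletLimit u) {η : ℝ} (hη : 0 < η)
    (h : ∀ s : ℂ, 0 ≤ s.re → η ≤ (u s).re) : IsDirichletLimit fun s => (u s)⁻¹ := by
  obtain ⟨B, hB, huB⟩ := hu.exists_bound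
  set R := B ^ 2 / η with hR
  have hR0 : 0 < R := by positivity
  set r := √(R ^ 2 - B ^ 2)
  have hr : r < R := by
    rw [Real.sqrt_lt' hR0]; nlinarith
  refine hu.comp (F := fun z => z⁻¹) (c := R) (r := r) (R := (r + R) / 2)
    (by have : 0 ≤ r := Real.sqrt_nonneg _; linarith) (by linarith) ?_ fun s hs => ?_
  · intro z hz
    refine (differentiableAt_inv ?_).differentiableWithinAt
    rintro rfl
    rw [Metric.mem_closedBall, dist_eq_norm, zero_sub, norm_neg, Complex.norm_real,
      Real.norm_of_nonneg hR0.le] at hz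
    linarith
  · refine Real.le_sqrt_of_sq_le ?_
    rw [← Complex.normSq_eq_norm_sq]
    have h1 := huB s hs
    have h2 : Complex.normSq (u s) ≤ B ^ 2 := by
      rw [Complex.normSq_eq_norm_sq]; gcongr
    rw [Complex.normSq_apply] at *
    simp only [Complex.sub_re, Complex.ofReal_re, Complex.sub_im, Complex.ofReal_im, sub_zero]
    have h3 : R * η = B ^ 2 := by rw [hR]; field_simp
    nlinarith [mul_le_mul_of_nonneg_left (h s hs) hR0.le]

theorem IsDirichletLimit.eval_comp {w : ℂ → ℂ} (hw : IsDirichletLimit w) (P : DirichletPoly) :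
    IsDirichletLimit fun s => DirichletPoly.eval P (w s) := by
  obtain ⟨B, hB, hwB⟩ := hw.exists_bound
  exact hw.comp (c := 0) (r := B) (R := B + 1) (by linarith) (by linarith)
    P.differentiable_eval.differentiableOn (by simpa using hwB)

/-- It bounds, uniformly in y, the ratio of a Poisson kernel to the Cauchy density at points not too
close to the boundary; it rests on y² ≤ 2(y - b)² + 2b². -/
theorem one_add_sq_le {a y b η β : ℝ} (hη : 0 < η) (ha : η ≤ a) (hb : b ^ 2 ≤ β) :
    1 + y ^ 2 ≤ ((1 + 2 * β) / η ^ 2 + 2) * (a ^ 2 + (y - b) ^ 2) := by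
  have h1 : η ^ 2 ≤ a ^ 2 + (y - b) ^ 2 := by nlinarith [sq_nonneg (y - b)]
  have h2 : 1 + 2 * β ≤ (1 + 2 * β) / η ^ 2 * (a ^ 2 + (y - b) ^ 2) := by
    rw [div_mul_eq_mul_div, le_div_iff₀ (by positivity)]
    have : 0 ≤ β := (sq_nonneg b).trans hb
    gcongr
  nlinarith [sq_nonneg (y - 2 * b), sq_nonneg a]

/-- The Poisson kernel is the real part of a function holomorphic in w; this is why its mean can be
read off at +∞. -/
theorem inv_sub_re (w : ℂ) (y : ℝ) : ((w - 1 / 2 - Complex.I * y)⁻¹).re =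
    (w.re - 1 / 2) / ((w.re - 1 / 2) ^ 2 + (y - w.im) ^ 2) := by
  rw [Complex.inv_re, Complex.normSq_apply]
  simp
  congr 1; ring

/-- The harmonic majorant of `|P|ᵖ` composed with `w` has as its mean its value at `w(+∞)`. -/
theorem IsDirichletLimit.mean_eval_comp_le {p : ℝ} (hp : 1 ≤ p) {w : ℂ → ℂ}
    (hw : IsDirichletLimit w) {η : ℝ} (hη : 0 < η) (h : ∀ s : ℂ, 0 ≤ s.re → 1 / 2 + η ≤ (w s).re)
    {m : ℂ} (hm : Tendsto (fun σ : ℝ => w σ) atTop (𝓝 m)) (P : DirichletPoly) :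
    besicovitchFun p (fun t : ℝ => DirichletPoly.eval P (w (Complex.I * t))) ^ p ≤
      ∫ y, ‖DirichletPoly.eval P (1 / 2 + Complex.I * y)‖ ^ p *
        ((1 + y ^ 2) * ((m.re - 1 / 2) / ((m.re - 1 / 2) ^ 2 + (y - m.im) ^ 2))) ∂stdCauchy := by
  have hp0 : 0 < p := by linarith
  obtain ⟨B, hB, hwB⟩ := hw.exists_bound
  have hmr : 1 / 2 + η ≤ m.re :=
    ge_of_tendsto ((Complex.continuous_re.tendsto m).comp hm) (by
      filter_upwards [eventually_ge_atTop 0] with σ hσ using h σ (by simpa using hσ))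
  set f : ℝ → ℝ := fun y => ‖DirichletPoly.eval P (1 / 2 + Complex.I * y)‖ ^ p with hf
  have hfc : Continuous f := continuous_norm_rpow hp0 (P.continuous_eval_line _)
  have hfB : ∀ y, f y ≤ (P.sum fun _ a => ‖a‖) ^ p := fun y => by
    have := P.norm_eval_le (s := 1 / 2 + Complex.I * y) (by simp)
    simp only [hf]
    gcongr
  have hf0 : ∀ y, 0 ≤ f y := fun y => by simp only [hf]; positivity
  -- At fixed y the kernel is the real part of a uniform limit of Dirichlet polynomials, so its mean
  -- in t is obtained by replacing w with m.
  have hPm : ∀ y : ℝ, HasMean (fun t : ℝ => f y * ((1 + y ^ 2) *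
      ((w (Complex.I * t) - 1 / 2 - Complex.I * y)⁻¹).re))
      (f y * ((1 + y ^ 2) * ((m - 1 / 2 - Complex.I * y)⁻¹).re)) := fun y => by
    have hu : IsDirichletLimit fun s => (w s - 1 / 2 - Complex.I * y)⁻¹ :=
      ((hw.sub (const _)).sub (const _)).inv hη fun s hs => by
        have := h s hs; simp at this ⊢; linarith
    have hne : m - 1 / 2 - Complex.I * y ≠ 0 := fun h0 => by
      have := congrArg Complex.re h0
      simp at this hmr
      linarith
    have := hu.hasMean_of_tendsto (((hm.sub_const _).sub_const _).inv₀ hne)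
    exact ((this.clm hu.continuous_line Complex.reCLM).const_mul_real _).const_mul_real _
  have hwr : ∀ t : ℝ, η ≤ (w (Complex.I * t)).re - 1 / 2 := fun t => by
    linarith [h (Complex.I * t) (by simp)]
  have hwb : ∀ t : ℝ, |(w (Complex.I * t)).re| ≤ B := fun t =>
    (Complex.abs_re_le_norm _).trans (hwB _ (by simp))
  have hwi : ∀ t : ℝ, (w (Complex.I * t)).im ^ 2 ≤ B ^ 2 := fun t =>
    sq_le_sq' (by linarith [(abs_le.1 ((Complex.abs_im_le_norm _).trans
      (hwB (Complex.I * t) (by simp)))).1]) (abs_le.1 ((Complex.abs_im_le_norm _).trans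
      (hwB (Complex.I * t) (by simp)))).2
  simp only [inv_sub_re] at hPm
  have hpos : ∀ t y : ℝ, 0 < ((w (Complex.I * t)).re - 1 / 2) ^ 2 +
      (y - (w (Complex.I * t)).im) ^ 2 := fun t y => by
    have := hwr t
    have h2 : 0 < (w (Complex.I * t)).re - 1 / 2 := by linarith
    positivity
  have hKc : Continuous fun x : ℝ × ℝ => f x.2 * ((1 + x.2 ^ 2) *
      (((w (Complex.I * x.1)).re - 1 / 2) / (((w (Complex.I * x.1)).re - 1 / 2) ^ 2 +
        (x.2 - (w (Complex.I * x.1)).im) ^ 2))) := by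
    have hwc : Continuous fun x : ℝ × ℝ => w (Complex.I * x.1) :=
      hw.continuous_line.comp continuous_fst
    have h1 : Continuous fun x : ℝ × ℝ => (w (Complex.I * x.1)).re :=
      Complex.continuous_re.comp hwc
    have h2 : Continuous fun x : ℝ × ℝ => (w (Complex.I * x.1)).im :=
      Complex.continuous_im.comp hwc
    refine (hfc.comp continuous_snd).mul ((by fun_prop : Continuous _).mul ?_)
    exact (h1.sub continuous_const).div (((h1.sub continuous_const).pow 2).add
      ((continuous_snd.sub h2).pow 2)) fun x => (hpos _ _).ne'
  have hKB : ∀ t y : ℝ, ‖f y * ((1 + y ^ 2) *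
      (((w (Complex.I * t)).re - 1 / 2) / (((w (Complex.I * t)).re - 1 / 2) ^ 2 +
        (y - (w (Complex.I * t)).im) ^ 2)))‖ ≤
      (P.sum fun _ a => ‖a‖) ^ p * (((1 + 2 * B ^ 2) / η ^ 2 + 2) * B) := fun t y => by
    have h1 := hwr t
    have h2 : 0 < (w (Complex.I * t)).re - 1 / 2 := by linarith
    have h3 := hpos t y
    have h4 := hf0 y
    have h5 := hfB y
    rw [Real.norm_of_nonneg (by positivity)]
    have h0 : 0 ≤ (P.sum fun _ a => ‖a‖) ^ p := Real.rpow_nonneg P.sum_norm_nonneg p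
    refine mul_le_mul h5 ?_ (by positivity) h0
    rw [← mul_div_assoc, div_le_iff₀ h3]
    have h6 := one_add_sq_le (y := y) hη h1 (hwi t)
    have h7 : (w (Complex.I * t)).re - 1 / 2 ≤ B := by linarith [(abs_le.1 (hwb t)).2]
    calc _ ≤ _ := mul_le_mul h6 h7 h2.le (by positivity)
      _ = _ := by ring
  have hmain := hasMean_integral (ν := stdCauchy) hKc hKB hPm
  have hPw := (hw.eval_comp P).hasPMean hp0
  refine (hPw.hasMean hp0).mono (continuous_norm_rpow hp0 hPw.1)
    (continuous_integral_of_bound hKc hKB) hmain fun t => ?_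
  have h1 := hwr t
  rw [← integral_stdCauchy_comp (by linarith : 0 < (w (Complex.I * t)).re - 1 / 2)]
  -- The point w(it) is split into its projection on the line Re s = 1/2 and a horizontal
  -- displacement, as the Poisson inequality requires.
  have e : w (Complex.I * t) = 1 / 2 + Complex.I * (w (Complex.I * t)).im +
      (((w (Complex.I * t)).re - 1 / 2 : ℝ) : ℂ) := by
    apply Complex.ext <;> simp
  have := P.norm_eval_rpow_le hp (z := 1 / 2 + Complex.I * (w (Complex.I * t)).im) (by simp)
    (by linarith : 0 ≤ (w (Complex.I * t)).re - 1 / 2)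
  rw [← e] at this
  refine this.trans_eq (integral_congr_ae (Eventually.of_forall fun y => ?_))
  simp only [hf]
  congr 3; push_cast; ring

/-! ### Norm bounds for P ∘ w from the local embedding -/

/-- Only the Poisson kernel at m + η survives the averaging. Its distance to the boundary line is
between a and a + 1, so the constant depends neither on w nor on η. -/
theorem LocalEmbedding.exists_bound_of_le_re {p : ℝ} (hp : 1 ≤ p) (hL : LocalEmbedding p) {m : ℂ}
    (hm : 1 / 2 < m.re) : ∃ C > 0, ∀ (w : ℂ → ℂ) (η : ℝ), IsDirichletLimit w → 0 < η → η ≤ 1 →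
      (∀ s : ℂ, 0 ≤ s.re → 1 / 2 + η ≤ (w s).re) →
      Tendsto (fun σ : ℝ => w σ) atTop (𝓝 (m + η)) → ∀ P : DirichletPoly,
      besicovitchFun p (fun t : ℝ => DirichletPoly.eval P (w (Complex.I * t))) ≤
        C * besicovitchNorm p P := by
  have hp0 : 0 < p := by linarith
  obtain ⟨C, hC⟩ := hL
  obtain ⟨S, hS, hSle⟩ := exists_integral_stdCauchy_le
  set a := m.re - 1 / 2 with ha
  have ha0 : 0 < a := by linarith
  set D := ((1 + 2 * m.im ^ 2) / a ^ 2 + 2) * (a + 1) with hD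
  have hD0 : 0 < D := by positivity
  refine ⟨(D * (S * (|C| + 1))) ^ (1 / p), by positivity, fun w η hw hη hη1 h hmt P => ?_⟩
  have hPn : 0 ≤ besicovitchNorm p P := (P.hasPMean hp0).nonneg hp0
  have hPw := (hw.eval_comp P).hasPMean hp0
  refine hPw.le_of_hasMean_le hp0 (hPw.hasMean hp0) (by positivity) ?_
  rw [Real.mul_rpow (by positivity) hPn, ← Real.rpow_mul (by positivity),
    one_div_mul_cancel hp0.ne', Real.rpow_one]
  refine (hw.mean_eval_comp_le hp hη h hmt P).trans ?_
  set f : ℝ → ℝ := fun y => ‖DirichletPoly.eval P (1 / 2 + Complex.I * y)‖ ^ p with hf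
  have hfc : Continuous f := continuous_norm_rpow hp0 (P.continuous_eval_line _)
  have hfB : ∀ y, f y ≤ (P.sum fun _ a => ‖a‖) ^ p := fun y => by
    have := P.norm_eval_le (s := 1 / 2 + Complex.I * y) (by simp)
    simp only [hf]
    gcongr
  have hf0 : ∀ y, 0 ≤ f y := fun y => by simp only [hf]; positivity
  have hle : ∫ y, f y ∂stdCauchy ≤ S * ((|C| + 1) * besicovitchNorm p P ^ p) :=
    hSle f _ _ hfc hf0 hfB fun τ => (hC P τ).trans (by
      gcongr
      linarith [le_abs_self C])
  have hfi : Integrable (fun y => f y * D) stdCauchy :=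
    (Integrable.of_bound (C := (P.sum fun _ a => ‖a‖) ^ p) hfc.aestronglyMeasurable
      (Eventually.of_forall fun y => by rw [Real.norm_of_nonneg (hf0 y)]; exact hfB y)).mul_const _
  have hre : (m + η).re - 1 / 2 = a + η := by simp [ha]; ring
  calc _ ≤ ∫ y, f y * D ∂stdCauchy := by
        refine integral_mono_of_nonneg (Eventually.of_forall fun y => ?_) hfi
          (Eventually.of_forall fun y => ?_)
        · simp only [hre]
          have := hf0 y
          simp only [Pi.zero_apply]
          exact mul_nonneg this (by positivity)
        · simp only [hre]
          refine mul_le_mul_of_nonneg_left ?_ (hf0 y)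
          have hpos : 0 < (a + η) ^ 2 + (y - (m + η : ℂ).im) ^ 2 := by positivity
          rw [← mul_div_assoc, div_le_iff₀ hpos]
          have h6 := one_add_sq_le (y := y) (b := (m + η : ℂ).im) (a := a + η) ha0
            (by linarith) le_rfl
          have him : (m + η : ℂ).im = m.im := by simp
          rw [him] at h6 hpos ⊢
          calc _ ≤ _ := mul_le_mul h6 (by linarith : a + η ≤ a + 1) (by linarith) (by positivity)
            _ = _ := by rw [hD]; ring
    _ = D * ∫ y, f y ∂stdCauchy := by rw [integral_mul_const, mul_comm]
    _ ≤ D * (S * ((|C| + 1) * besicovitchNorm p P ^ p)) := by gcongr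
    _ = _ := by ring

/-- Pushing w to the right by a small η separates it from the boundary; P changes little under such
a shift, and the constant of the shifted bound does not depend on η. -/
theorem LocalEmbedding.exists_bound {p : ℝ} (hp : 1 ≤ p) (hL : LocalEmbedding p) {m : ℂ}
    (hm : 1 / 2 < m.re) : ∃ C > 0, ∀ w : ℂ → ℂ, IsDirichletLimit w →
      (∀ s : ℂ, 0 ≤ s.re → 1 / 2 < (w s).re) →
      Tendsto (fun σ : ℝ => w σ) atTop (𝓝 m) → ∀ P : DirichletPoly,
      besicovitchFun p (fun t : ℝ => DirichletPoly.eval P (w (Complex.I * t))) ≤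
        C * besicovitchNorm p P := by
  have hp0 : 0 < p := by linarith
  obtain ⟨C, hC0, hC⟩ := hL.exists_bound_of_le_re hp hm
  refine ⟨C, hC0, fun w hw h hmt P => le_of_forall_pos_le_add fun ε hε => ?_⟩
  obtain ⟨δ, hδ, hP⟩ := P.isDirichletLimit.exists_norm_shift_sub_le hε
  have hη : 0 < min δ 1 := by positivity
  have hw' : IsDirichletLimit fun s => w s + ((min δ 1 : ℝ) : ℂ) :=
    hw.add (IsDirichletLimit.const _)
  have h1 := hC _ (min δ 1) hw' hη (min_le_right _ _)
    (fun s hs => by have := h s hs; rw [Complex.add_re, Complex.ofReal_re]; linarith)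
    (hmt.add_const _) P
  have hd := ((hw.eval_comp P).sub (hw'.eval_comp P)).hasPMean hp0
  have h2 := besicovitchFun_add_le hp ((hw'.eval_comp P).hasPMean hp0) hd
    ((hw.eval_comp P).hasPMean hp0) fun t => norm_le_norm_add_norm_sub' _ _
  have h3 := hd.le_of_bound hp0 (B := ε) fun t => by
    rw [norm_sub_rev]
    exact hP _ hη.le (min_le_left _ _) _ (by
      have := h (Complex.I * t) (by simp); linarith)
  linarith

theorem besicovitchFun_sub_comm {p : ℝ} {F G : ℝ → ℂ} : (besicovitchFun p fun t => F t - G t) =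
    besicovitchFun p fun t => G t - F t := by
  unfold besicovitchFun
  simp only [norm_sub_rev]

theorem IsDirichletLimit.besicovitchFun_sub_le {p : ℝ} (hp : 1 ≤ p) {f g h : ℂ → ℂ}
    (hf : IsDirichletLimit f) (hg : IsDirichletLimit g) (hh : IsDirichletLimit h) :
    besicovitchFun p (fun t : ℝ => f (Complex.I * t) - h (Complex.I * t)) ≤
      besicovitchFun p (fun t : ℝ => f (Complex.I * t) - g (Complex.I * t)) +
      besicovitchFun p (fun t : ℝ => g (Complex.I * t) - h (Complex.I * t)) := by
  have hp0 : 0 < p := by linarith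
  exact besicovitchFun_add_le hp ((hf.sub hg).hasPMean hp0) ((hg.sub hh).hasPMean hp0)
    ((hf.sub hh).hasPMean hp0) fun t => norm_sub_le_norm_sub_add_norm_sub _ _ _

/-! ### Norms of approximating sequences -/

section Norms

variable {p : ℝ}

theorem besicovitchNorm_nonneg (hp : 1 ≤ p) (P : DirichletPoly) : 0 ≤ besicovitchNorm p P :=
  (P.hasPMean (by linarith)).nonneg (by linarith)

theorem besicovitchNorm_sub (P Q : DirichletPoly) : besicovitchNorm p (P - Q) =
    besicovitchFun p fun t : ℝ => DirichletPoly.eval P (Complex.I * t) -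
      DirichletPoly.eval Q (Complex.I * t) := by
  unfold besicovitchNorm besicovitchFun
  simp only [DirichletPoly.eval_sub]

theorem abs_besicovitchNorm_sub_le (hp : 1 ≤ p) (P Q : DirichletPoly) :
    |besicovitchNorm p P - besicovitchNorm p Q| ≤ besicovitchNorm p (P - Q) := by
  have hp0 : 0 < p := by linarith
  rw [besicovitchNorm_sub]
  exact (P.hasPMean hp0).abs_sub_le hp (Q.hasPMean hp0)
    ((P.isDirichletLimit.sub Q.isDirichletLimit).hasPMean hp0)

theorem HpApprox.exists_tendsto_norm (hp : 1 ≤ p) {P : ℕ → DirichletPoly} {f : ℂ → ℂ}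
    (h : HpApprox p P f) : ∃ N, Tendsto (fun k => besicovitchNorm p (P k)) atTop (𝓝 N) := by
  refine cauchySeq_tendsto_of_complete (Metric.cauchySeq_iff.2 fun ε hε => ?_)
  obtain ⟨K, hK⟩ := h.cauchy ε hε
  exact ⟨K, fun j hj k hk => (abs_besicovitchNorm_sub_le hp _ _).trans_lt (hK j hj k hk)⟩

theorem bddBelow_hpNorm_set (hp : 1 ≤ p) (f : ℂ → ℂ) : BddBelow {N : ℝ | ∃ P, HpApprox p P f ∧
    Tendsto (fun k => besicovitchNorm p (P k)) atTop (𝓝 N)} := by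
  refine ⟨0, ?_⟩
  rintro N ⟨P, -, hP⟩
  exact ge_of_tendsto' hP fun k => besicovitchNorm_nonneg hp _

/-- As `hpNorm` is an infimum over approximating sequences, it suffices to send each such sequence
for f to one for f ∘ φ; independence of the limit from the sequence is not needed. -/
theorem compositionBounded_of_approx (hp : 1 ≤ p) {φ : ℂ → ℂ} {C : ℝ} (hC : 0 < C)
    (h : ∀ (f : ℂ → ℂ) (P : ℕ → DirichletPoly), HpApprox p P f →
      ∃ Q : ℕ → DirichletPoly, HpApprox p Q (fun s => f (φ s)) ∧
        ∀ k : ℕ, besicovitchNorm p (Q k) ≤ C * besicovitchNorm p (P k) + 1 / ((k : ℝ) + 1)) :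
    CompositionBounded p φ := by
  refine ⟨C, fun f ⟨P, hP⟩ => ⟨?_, ?_⟩⟩
  · obtain ⟨Q, hQ, -⟩ := h f P hP
    exact ⟨Q, hQ⟩
  · rw [← div_le_iff₀' hC]
    obtain ⟨N, hN⟩ := hP.exists_tendsto_norm hp
    refine le_csInf ⟨N, P, hP, hN⟩ ?_
    rintro N ⟨P, hP, hN⟩
    obtain ⟨Q, hQ, hQP⟩ := h f P hP
    obtain ⟨M, hM⟩ := hQ.exists_tendsto_norm hp
    rw [div_le_iff₀' hC]
    refine (csInf_le (bddBelow_hpNorm_set hp _) ⟨Q, hQ, hM⟩).trans ?_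
    have := (hN.const_mul C).add (tendsto_one_div_add_atTop_nhds_zero_nat (𝕜 := ℝ))
    rw [add_zero] at this
    exact le_of_tendsto_of_tendsto' hM this hQP

end Norms

/-! ### Norm continuity up to the imaginary axis -/

/-- Bounded functions whose translates to the right are uniform limits of Dirichlet polynomials
are continuous in norm up to the imaginary axis. -/
theorem exists_besicovitchFun_shift_sub_le {p : ℝ} (hp : 1 ≤ p) {h : ℂ → ℂ} {B : ℝ}
    (hh : ∀ δ : ℝ, 0 < δ → IsDirichletLimit fun s => h (s + δ))
    (hB : ∀ s : ℂ, 0 < s.re → ‖h s‖ ≤ B) {ε : ℝ} (hε : 0 < ε) :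
    ∃ δ₀ > 0, ∀ δ δ' : ℝ, 0 < δ → δ ≤ δ' → δ' ≤ δ₀ →
      besicovitchFun p (fun t : ℝ => h (Complex.I * t + δ) - h (Complex.I * t + δ')) ≤ ε := by
  have hp0 : 0 < p := by linarith
  have hB0 : 0 ≤ B := (norm_nonneg _).trans (hB 1 (by simp))
  set D := 2 * B + 1
  have hD : 0 < D := by positivity
  set N : ℝ → ℝ := fun δ => besicovitchFun 2 (fun t : ℝ => h (Complex.I * t + δ)) ^ 2 with hN
  have hNB : ∀ δ > 0, N δ ≤ B ^ 2 := fun δ hδ => by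
    have h1 := ((hh δ hδ).hasPMean two_pos).le_of_bound two_pos (B := B)
      fun t => hB _ (by simpa using hδ)
    have h0 := ((hh δ hδ).hasPMean two_pos).nonneg two_pos
    simp only [hN]
    gcongr
  have hdiff : ∀ δ δ' : ℝ, 0 < δ → δ ≤ δ' →
      besicovitchFun 2 (fun t : ℝ => h (Complex.I * t + δ) - h (Complex.I * t + δ')) ^ 2 ≤
        N δ - N δ' := fun δ δ' hδ hδδ' => by
    have := (hh δ hδ).besicovitchFun_two_sub_shift_le (sub_nonneg.2 hδδ')
    have e : ∀ t : ℝ, Complex.I * t + ((δ' - δ : ℝ) : ℂ) + δ = Complex.I * t + δ' := fun t => by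
      push_cast; ring
    simpa only [e] using this
  -- Chosen so that D^p / (ε/2)² · κ = ε^p / 2 in the final estimate.
  set κ := (ε ^ p / 2) * ((ε / 2) ^ 2 / D ^ p) with hκ
  have hκ0 : 0 < κ := by positivity
  -- The bounded function N increases as δ decreases, so below a δ₀ where it is within κ of its
  -- supremum it varies by less than κ.
  obtain ⟨_, ⟨δ₀, hδ₀, rfl⟩, hlt⟩ := exists_lt_of_lt_csSup (s := N '' Ioi 0)
    ⟨_, 1, mem_Ioi.2 one_pos, rfl⟩ (sub_lt_self _ hκ0)
  refine ⟨δ₀, hδ₀, fun δ δ' hδ hδδ' hδ' => ?_⟩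
  have hbdd : BddAbove (N '' Ioi 0) := ⟨B ^ 2, by rintro _ ⟨x, hx, rfl⟩; exact hNB x hx⟩
  have h1 : N δ ≤ sSup (N '' Ioi 0) := le_csSup hbdd ⟨δ, hδ, rfl⟩
  have h2 := hdiff δ' δ₀ (hδ.trans_le hδδ') hδ'
  have h3 := (hdiff δ δ' hδ hδδ').trans (by
    linarith [sq_nonneg (besicovitchFun 2 (fun t : ℝ =>
      h (Complex.I * t + δ') - h (Complex.I * t + δ₀)))] : N δ - N δ' ≤ κ)
  have hlim := (hh δ hδ).sub (hh δ' (hδ.trans_le hδδ'))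
  have hm2 := (hlim.hasPMean two_pos).hasMean two_pos
  have hmp := hlim.hasPMean hp0
  refine hmp.le_of_hasMean_le hp0 (hmp.hasMean hp0) hε.le ?_
  -- The passage from 2-means to p-means is of Chebyshev type: values x ≤ ε/2 contribute at most
  -- (ε/2)ᵖ, and larger ones satisfy xᵖ ≤ Dᵖ ≤ Dᵖ(x/(ε/2))².
  have hsum := (hm2.const_mul_real (D ^ p / (ε / 2) ^ 2)).add
    (by have := continuous_norm_rpow two_pos hlim.continuous_line; fun_prop) continuous_const
    (hasMean_const ((ε / 2) ^ p))
  refine ((hmp.hasMean hp0).mono (continuous_norm_rpow hp0 hmp.1)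
    (by have := continuous_norm_rpow two_pos hlim.continuous_line; fun_prop) hsum
    fun t => ?_).trans ?_
  · have hx : ‖h (Complex.I * t + δ) - h (Complex.I * t + δ')‖ ≤ D := by
      have h4 := hB (Complex.I * t + δ) (by simpa using hδ)
      have h5 := hB (Complex.I * t + δ') (by simpa using hδ.trans_le hδδ')
      linarith [norm_sub_le (h (Complex.I * t + δ)) (h (Complex.I * t + δ'))]
    simp only [Real.rpow_two]
    set x := ‖h (Complex.I * t + δ) - h (Complex.I * t + δ')‖
    have hx0 : 0 ≤ x := norm_nonneg _
    rcases le_total x (ε / 2) with hxε | hxε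
    · have : x ^ p ≤ (ε / 2) ^ p := by gcongr
      have : 0 ≤ D ^ p / (ε / 2) ^ 2 * x ^ 2 := by positivity
      linarith
    · have h6 : x ^ p ≤ D ^ p := by gcongr
      have h7 : D ^ p ≤ D ^ p / (ε / 2) ^ 2 * x ^ 2 := by
        rw [div_mul_eq_mul_div, le_div_iff₀ (by positivity)]
        gcongr
      have : 0 ≤ (ε / 2) ^ p := by positivity
      linarith
  · rw [Real.rpow_two]
    have h8 : (ε / 2) ^ p ≤ ε ^ p / 2 := by
      rw [Real.div_rpow hε.le two_pos.le]
      gcongr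
      simpa using Real.rpow_le_rpow_of_exponent_le one_le_two hp
    calc _ ≤ D ^ p / (ε / 2) ^ 2 * κ + ε ^ p / 2 := by gcongr
      _ = ε ^ p := by rw [hκ]; field_simp; ring

/-! ### Dirichlet series and their value at +∞ -/

section DirichletSeries

variable {c : ℕ → ℂ} {φ₀ : ℂ → ℂ}

/-- The partial sums of a Dirichlet series. -/
noncomputable def dirichletPartialSum (c : ℕ → ℂ) (N : ℕ) : DirichletPoly :=
  ∑ n ∈ Finset.Icc 1 N, Finsupp.single n.toPNat' (c n)

theorem eval_dirichletPartialSum (c : ℕ → ℂ) (N : ℕ) (s : ℂ) :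
    DirichletPoly.eval (dirichletPartialSum c N) s =
      ∑ n ∈ Finset.Icc 1 N, c n * (n : ℂ) ^ (-s) := by
  rw [dirichletPartialSum, DirichletPoly.eval_finsetSum]
  refine Finset.sum_congr rfl fun n hn => ?_
  rw [DirichletPoly.eval_single, Nat.toPNat'_coe, if_pos (Nat.lt_of_succ_le (Finset.mem_Icc.1 hn).1)]

theorem dirichletPartialSum_apply (c : ℕ → ℂ) {N : ℕ} {n : ℕ+} (h : (n : ℕ) ≤ N) :
    dirichletPartialSum c N n = c n := by
  rw [dirichletPartialSum, Finsupp.finsetSum_apply, Finset.sum_eq_single (n : ℕ)]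
  · simp
  · intro k hk hkn
    rw [Finsupp.single_apply, if_neg]
    intro h'
    apply hkn
    rw [← h', Nat.toPNat'_coe, if_pos (Nat.lt_of_succ_le (Finset.mem_Icc.1 hk).1)]
  · intro hn
    exact absurd (Finset.mem_Icc.2 ⟨n.pos, h⟩) hn

theorem isDirichletLimit_of_tendstoUniformlyOn (hu : ∀ ε > 0, TendstoUniformlyOn
      (fun (N : ℕ) (s : ℂ) => ∑ n ∈ Finset.Icc 1 N, c n * (n : ℂ) ^ (-s))
      φ₀ atTop (halfPlane ε)) {δ : ℝ} (hδ : 0 < δ) : IsDirichletLimit fun s => φ₀ (s + δ) := by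
  intro ε hε
  obtain ⟨N, hN⟩ := (Metric.tendstoUniformlyOn_iff.1 (hu (δ / 2) (by linarith)) ε hε).exists
  refine ⟨DirichletPoly.shift δ (dirichletPartialSum c N), fun s hs => ?_⟩
  rw [DirichletPoly.eval_shift, eval_dirichletPartialSum, ← dist_eq_norm]
  exact (hN (s + δ) (by simp [halfPlane]; linarith)).le

theorem exists_tendsto_atTop_of_isDirichletLimit
    (h : ∀ δ : ℝ, 0 < δ → IsDirichletLimit fun s => φ₀ (s + δ)) :
    ∃ m, Tendsto (fun σ : ℝ => φ₀ σ) atTop (𝓝 m) := by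
  obtain ⟨m, -, hm⟩ := (h 1 one_pos).exists_mean
  refine ⟨m, (hm.comp (tendsto_atTop_add_const_right _ (-1) tendsto_id)).congr fun σ => ?_⟩
  simp

/-- The value at `+∞` of a Dirichlet series with values in `Re s > 1/2` is not on the boundary of
this half-plane. -/
theorem half_lt_re_of_tendsto (hu : ∀ ε > 0, TendstoUniformlyOn
      (fun (N : ℕ) (s : ℂ) => ∑ n ∈ Finset.Icc 1 N, c n * (n : ℂ) ^ (-s))
      φ₀ atTop (halfPlane ε)) (hmaps : MapsTo φ₀ (halfPlane 0) (halfPlane (1 / 2))) {m : ℂ}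
    (hm : Tendsto (fun σ : ℝ => φ₀ σ) atTop (𝓝 m)) : 1 / 2 < m.re := by
  have hge : 1 / 2 ≤ m.re := ge_of_tendsto ((Complex.continuous_re.tendsto m).comp hm) (by
    filter_upwards [eventually_gt_atTop 0] with σ hσ
    exact (hmaps (by simpa [halfPlane] using hσ : (σ : ℂ) ∈ halfPlane 0)).le)
  refine lt_of_le_of_ne hge fun hme => ?_
  have hv := isDirichletLimit_of_tendstoUniformlyOn hu one_pos
  set v : ℂ → ℂ := fun s => φ₀ (s + ((1 : ℝ) : ℂ)) with hvdef
  have hvm : Tendsto (fun σ : ℝ => v σ) atTop (𝓝 m) :=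
    (hm.comp (tendsto_atTop_add_const_right _ 1 tendsto_id)).congr fun σ => by simp [hvdef]
  have hvre : ∀ t : ℝ, 0 ≤ (v (Complex.I * t)).re - 1 / 2 := fun t => by
    have := hmaps (by simp [halfPlane] : Complex.I * t + ((1 : ℝ) : ℂ) ∈ halfPlane 0)
    exact sub_nonneg.2 (le_of_lt this)
  have hvc := hv.continuous_line
  -- If Re m = 1/2, the nonnegative function v + conj v - 1 = 2(Re v - 1/2) has mean zero.
  have hmean : HasMean (fun t : ℝ => 2 * ((v (Complex.I * t)).re - 1 / 2)) 0 := by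
    have := ((((hv.hasMean_of_tendsto hvm).clm hvc Complex.reCLM).sub
      (Complex.continuous_re.comp hvc) continuous_const
      (hasMean_const (1 / 2 : ℝ))).const_mul_real 2)
    have e : 2 * (Complex.reCLM m - 1 / 2) = 0 := by simp [← hme]
    rwa [e] at this
  -- For n ≠ 1 neither conj v nor 1 has an n-th Fourier coefficient, so that of v is also that of v
  -- + conj v - 1, and is bounded by the mean of this nonnegative function. Hence φ₀ is constant,
  -- equal to m, although its values lie in the open half-plane.
  have hvanish : ∀ n : ℕ+, n ≠ 1 → c n = 0 := by
    intro n hn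
    have hnc := DirichletPoly.continuous_natCast_cpow_I n
    have happ : ∀ ε > 0, ∀ᶠ N in atTop, ∀ t : ℝ, ‖v (Complex.I * t) *
        ((n : ℕ) : ℂ) ^ (Complex.I * t) - DirichletPoly.eval
          (DirichletPoly.shift 1 (dirichletPartialSum c N)) (Complex.I * t) *
          ((n : ℕ) : ℂ) ^ (Complex.I * t)‖ ≤ ε := fun ε hε => by
      filter_upwards [Metric.tendstoUniformlyOn_iff.1 (hu (1 / 2) (by norm_num)) ε hε] with N hN t
      rw [← sub_mul, norm_mul, DirichletPoly.norm_natCast_cpow_I, mul_one,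
        DirichletPoly.eval_shift, eval_dirichletPartialSum, ← dist_eq_norm]
      simpa [hvdef] using (hN (Complex.I * t + 1) (by simp [halfPlane]; norm_num)).le
    obtain ⟨μ, hμ⟩ : ∃ μ, HasMean (fun t : ℝ => v (Complex.I * t) *
        ((n : ℕ) : ℂ) ^ (Complex.I * t)) μ :=
      exists_hasMean_of_approx (hvc.mul hnc) fun ε hε => by
        obtain ⟨N, hN⟩ := (happ ε hε).exists
        exact ⟨_, _, (DirichletPoly.continuous_eval_I _).mul hnc,
          DirichletPoly.hasMean_eval_mul _ n, hN⟩
    have hn0 : Tendsto (fun σ : ℝ => DirichletPoly.eval (Finsupp.single n 1) (σ : ℂ)) atTop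
        (𝓝 0) := by
      have := DirichletPoly.tendsto_eval_atTop (Finsupp.single n 1)
      rwa [Finsupp.single_eq_of_ne hn.symm] at this
    have hconj : HasMean (fun t : ℝ => (starRingEnd ℂ) (v (Complex.I * t)) *
        ((n : ℕ) : ℂ) ^ (Complex.I * t)) 0 := by
      have h1 := (hv.mul (DirichletPoly.isDirichletLimit (Finsupp.single n 1))).hasMean_of_tendsto
        (hvm.mul hn0)
      have h2 := h1.clm (hvc.mul (DirichletPoly.continuous_eval_I _))
        (Complex.conjCLE : ℂ →L[ℝ] ℂ)
      simp only [mul_zero, map_zero] at h2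
      convert h2 using 2 with t
      simp only [ContinuousLinearEquiv.coe_coe, Complex.conjCLE_apply, Pi.mul_apply, map_mul,
        DirichletPoly.eval_single, one_mul]
      rw [DirichletPoly.conj_natCast_cpow_I]
    have hone : HasMean (fun t : ℝ => ((n : ℕ) : ℂ) ^ (Complex.I * t)) 0 := by
      simpa [hn.symm] using DirichletPoly.hasMean_character 1 n
    have hcc : Continuous fun t : ℝ => (starRingEnd ℂ) (v (Complex.I * t)) :=
      Complex.continuous_conj.comp hvc
    have htot := ((hμ.add (hvc.mul hnc) (hcc.mul hnc) hconj).sub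
      ((hvc.mul hnc).add (hcc.mul hnc)) hnc hone)
    have hμ0 : ‖μ + 0 - 0‖ ≤ 0 := by
      refine htot.norm_le ?_ hmean fun t => ?_
      · exact continuous_const.mul ((Complex.continuous_re.comp hvc).sub continuous_const)
      · have e : v (Complex.I * t) * ((n : ℕ) : ℂ) ^ (Complex.I * t) +
            (starRingEnd ℂ) (v (Complex.I * t)) * ((n : ℕ) : ℂ) ^ (Complex.I * t) -
            ((n : ℕ) : ℂ) ^ (Complex.I * t) =
            ((2 * ((v (Complex.I * t)).re - 1 / 2) : ℝ) : ℂ) *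
              ((n : ℕ) : ℂ) ^ (Complex.I * t) := by
          rw [← add_mul, Complex.add_conj]; push_cast; ring
        simp only [Pi.add_apply, Pi.mul_apply]
        rw [e, norm_mul, DirichletPoly.norm_natCast_cpow_I, mul_one, Complex.norm_real,
          Real.norm_of_nonneg (by linarith [hvre t])]
    have hμ1 : μ = 0 := by simpa using hμ0
    have hle : ∀ ε > 0, ‖c n * ((n : ℕ) : ℂ) ^ (-(1 : ℂ))‖ ≤ ε := fun ε hε => by
      obtain ⟨N, hN, hnN⟩ := ((happ ε hε).and (eventually_ge_atTop (n : ℕ))).exists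
      have := ((hμ.sub (hvc.mul hnc) ((DirichletPoly.continuous_eval_I _).mul hnc)
        (DirichletPoly.hasMean_eval_mul _ n)).norm_le continuous_const (hasMean_const ε) hN)
      rwa [hμ1, zero_sub, norm_neg, DirichletPoly.shift_apply,
        dirichletPartialSum_apply c hnN] at this
    have h0 : ‖c n * ((n : ℕ) : ℂ) ^ (-(1 : ℂ))‖ = 0 :=
      le_antisymm (le_of_forall_pos_le_add fun ε hε => by simpa using hle ε hε) (norm_nonneg _)
    have hne : ((n : ℕ) : ℂ) ≠ 0 := by exact_mod_cast n.pos.ne'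
    simpa [Complex.cpow_neg_one, hne] using h0
  have hconst : ∀ s ∈ halfPlane 0, φ₀ s = c 1 := by
    intro s hs
    have hs' : 0 < s.re := hs
    have h1 := (hu (s.re / 2) (by linarith)).tendsto_at (x := s) (by simp [halfPlane]; linarith)
    refine tendsto_nhds_unique h1 (tendsto_const_nhds.congr' ?_)
    filter_upwards [eventually_ge_atTop 1] with N hN
    rw [Finset.sum_eq_single 1]
    · simp
    · intro n hn hn1
      have := hvanish ⟨n, (Finset.mem_Icc.1 hn).1⟩ (fun h => hn1 (congrArg PNat.val h))
      rw [PNat.mk_coe] at this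
      rw [this, zero_mul]
    · simp [hN]
  have hlim : m = c 1 := tendsto_nhds_unique hm (tendsto_const_nhds.congr' (by
    filter_upwards [eventually_gt_atTop 0] with σ hσ
    exact (hconst σ (by simpa [halfPlane] using hσ)).symm))
  have h1 : (1 : ℂ) ∈ halfPlane 0 := by simp [halfPlane]
  have := hmaps h1
  rw [hconst 1 h1, ← hlim] at this
  exact absurd hme this.ne

end DirichletSeries

/-! ### From the local embedding to bounded composition operators -/

theorem LocalEmbedding.compositionBounded {p : ℝ} (hp : 1 ≤ p) (hL : LocalEmbedding p)
    {φ : ℂ → ℂ} (hφ : GordonHedenmalm 0 φ) : CompositionBounded p φ := by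
  have hp0 : 0 < p := by linarith
  obtain ⟨hφm, c, φ₀, hu, heq, hmaps, -⟩ := hφ
  replace hmaps := hmaps rfl
  have hlim := fun δ (hδ : 0 < δ) => isDirichletLimit_of_tendstoUniformlyOn hu hδ
  obtain ⟨m, hm⟩ := exists_tendsto_atTop_of_isDirichletLimit hlim
  obtain ⟨C, hC0, hC⟩ := hL.exists_bound hp (half_lt_re_of_tendsto hu hmaps hm)
  have hre : ∀ s : ℂ, 0 < s.re → 1 / 2 < (φ₀ s).re := fun s hs => hmaps hs
  have hcomp : ∀ δ > 0, ∀ P : DirichletPoly,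
      IsDirichletLimit fun s => DirichletPoly.eval P (φ₀ (s + (δ : ℝ))) :=
    fun δ hδ P => (hlim δ hδ).eval_comp P
  have hnorm : ∀ δ > 0, ∀ P : DirichletPoly, besicovitchFun p (fun t : ℝ =>
      DirichletPoly.eval P (φ₀ (Complex.I * t + (δ : ℝ)))) ≤ C * besicovitchNorm p P := by
    intro δ hδ P
    refine hC _ (hlim δ hδ) (fun s hs => hre _ (by simp; linarith)) ?_ P
    exact (hm.comp (tendsto_atTop_add_const_right _ δ tendsto_id)).congr fun σ => by simp
  have hkey : ∀ (P : DirichletPoly) (ε : ℝ), 0 < ε → ∃ (δ : ℝ) (Q : DirichletPoly), 0 < δ ∧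
      (∀ s : ℂ, 0 ≤ s.re → ‖DirichletPoly.eval P (φ₀ (s + δ)) - DirichletPoly.eval Q s‖ ≤ ε) ∧
      (∀ s ∈ halfPlane (1 / 2), ‖DirichletPoly.eval P (φ₀ (s + δ)) -
        DirichletPoly.eval P (φ₀ s)‖ ≤ ε) ∧
      ∀ δ' : ℝ, 0 < δ' → δ' ≤ δ → besicovitchFun p (fun t : ℝ =>
        DirichletPoly.eval P (φ₀ (Complex.I * t + δ')) -
          DirichletPoly.eval P (φ₀ (Complex.I * t + δ))) ≤ ε := by
    intro P ε hε
    -- Points with Re s > 1/2 are written as (s - 1/2) + 1/2, so the uniform estimate for the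
    -- translate by 1/2 covers them.
    obtain ⟨δ₁, hδ₁, h1⟩ := (hcomp (1 / 2) (by norm_num) P).exists_norm_shift_sub_le hε
    obtain ⟨δ₂, hδ₂, h2⟩ := exists_besicovitchFun_shift_sub_le hp
      (h := fun s => DirichletPoly.eval P (φ₀ s)) (fun δ hδ => hcomp δ hδ P)
      (fun s hs => P.norm_eval_le (by linarith [hre s hs])) hε
    have hδ : 0 < min δ₁ δ₂ := lt_min hδ₁ hδ₂
    obtain ⟨Q, hQ⟩ := hcomp _ hδ P ε hε
    refine ⟨min δ₁ δ₂, Q, hδ, hQ, fun s hs => ?_, fun δ' hδ' hle =>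
      h2 δ' _ hδ' hle (min_le_right _ _)⟩
    have hs' : 1 / 2 < s.re := hs
    have := h1 _ hδ.le (min_le_left _ _) (s - ((1 / 2 : ℝ) : ℂ)) (by
      rw [Complex.sub_re, Complex.ofReal_re]; linarith)
    have e1 : ∀ x : ℂ, s - ((1 / 2 : ℝ) : ℂ) + x + ((1 / 2 : ℝ) : ℂ) = s + x := fun x => by ring
    have e2 : s - ((1 / 2 : ℝ) : ℂ) + ((1 / 2 : ℝ) : ℂ) = s := by ring
    rwa [e1, e2] at this
  refine compositionBounded_of_approx hp hC0 fun f P hP => ?_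
  choose δ Q hδ hQ hpt hcau using fun k : ℕ => hkey (P k) (1 / ((k : ℝ) + 1)) (by positivity)
  have hε := tendsto_one_div_add_atTop_nhds_zero_nat (𝕜 := ℝ)
  have hQn : ∀ k, besicovitchFun p (fun t : ℝ => DirichletPoly.eval (Q k) (Complex.I * t) -
      DirichletPoly.eval (P k) (φ₀ (Complex.I * t + δ k))) ≤ 1 / ((k : ℝ) + 1) := fun k =>
    (((Q k).isDirichletLimit.sub (hcomp _ (hδ k) (P k))).hasPMean hp0).le_of_bound hp0 fun t => by
      rw [norm_sub_rev]; exact hQ k _ (by simp)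
  have hQδ : ∀ k δ', 0 < δ' → δ' ≤ δ k →
      besicovitchFun p (fun t : ℝ => DirichletPoly.eval (Q k) (Complex.I * t) -
      DirichletPoly.eval (P k) (φ₀ (Complex.I * t + (δ' : ℝ)))) ≤ 2 * (1 / ((k : ℝ) + 1)) :=
      fun k δ' h0 hle => by
    have h1 := IsDirichletLimit.besicovitchFun_sub_le hp (Q k).isDirichletLimit
      (hcomp _ (hδ k) (P k)) (hcomp _ h0 (P k))
    have h2 := hcau k δ' h0 hle
    rw [besicovitchFun_sub_comm] at h2
    linarith [hQn k]
  refine ⟨Q, ⟨fun ε hε0 => ?_, fun s hs => ?_⟩, fun k => ?_⟩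
  · obtain ⟨K₁, hK₁⟩ := hP.cauchy (ε / (2 * C)) (by positivity)
    obtain ⟨K₂, hK₂⟩ := eventually_atTop.1
      (hε.eventually (gt_mem_nhds (show 0 < ε / 8 by linarith)))
    refine ⟨max K₁ K₂, fun j hj k hk => ?_⟩
    have hj1 := hK₂ j (le_of_max_le_right hj)
    have hk1 := hK₂ k (le_of_max_le_right hk)
    -- The terms j and k carry different shifts. Both are compared at the smaller one, where the
    -- composition bound applies to Pⱼ - Pₖ; the errors are below ε/4 + ε/4 + ε/2.
    have h0 : 0 < min (δ j) (δ k) := lt_min (hδ j) (hδ k)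
    have h1 := hQδ j _ h0 (min_le_left _ _)
    have h2 := hQδ k _ h0 (min_le_right _ _)
    rw [besicovitchFun_sub_comm] at h2
    have h3 := hnorm _ h0 (P j - P k)
    simp only [DirichletPoly.eval_sub] at h3
    have h4 := hK₁ j (le_of_max_le_left hj) k (le_of_max_le_left hk)
    have h5 : C * besicovitchNorm p (P j - P k) < ε / 2 := by
      calc _ < C * (ε / (2 * C)) := by gcongr
        _ = ε / 2 := by field_simp
    have h6 := IsDirichletLimit.besicovitchFun_sub_le hp (Q j).isDirichletLimit
      (hcomp _ h0 (P j)) (Q k).isDirichletLimit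
    have h7 := IsDirichletLimit.besicovitchFun_sub_le hp (hcomp _ h0 (P j))
      (hcomp _ h0 (P k)) (Q k).isDirichletLimit
    rw [besicovitchNorm_sub]
    linarith
  · have hs' : 1 / 2 < s.re := hs
    have h1 := hP.tendsto (φ s) (hφm hs)
    have h2 : φ s = φ₀ s := by simpa using heq s hs
    have h3 : Tendsto (fun k => DirichletPoly.eval (Q k) s - DirichletPoly.eval (P k) (φ s)) atTop
        (𝓝 0) := by
      refine squeeze_zero_norm (a := fun k : ℕ => 2 * (1 / ((k : ℝ) + 1))) (fun k => ?_)
        (by simpa using hε.const_mul 2)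
      have h4 := hQ k s (by linarith)
      have h5 := hpt k s hs
      rw [h2]
      rw [norm_sub_rev] at h4
      linarith [norm_sub_le_norm_sub_add_norm_sub (DirichletPoly.eval (Q k) s)
        (DirichletPoly.eval (P k) (φ₀ (s + δ k))) (DirichletPoly.eval (P k) (φ₀ s))]
    simpa using h3.add h1
  · have h1 := besicovitchFun_add_le hp
      (((Q k).isDirichletLimit.sub (hcomp _ (hδ k) (P k))).hasPMean hp0)
      ((hcomp _ (hδ k) (P k)).hasPMean hp0) ((Q k).hasPMean hp0) fun t => by
        simpa using norm_add_le (DirichletPoly.eval (Q k) (Complex.I * t) -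
          DirichletPoly.eval (P k) (φ₀ (Complex.I * t + δ k)))
          (DirichletPoly.eval (P k) (φ₀ (Complex.I * t + δ k)))
    have h2 := hnorm _ (hδ k) (P k)
    have h3 := hQn k
    change besicovitchFun p _ ≤ _
    linarith

/-! ### The symbol 𝒯(2⁻ˢ) -/

theorem norm_two_cpow_neg (s : ℂ) : ‖(2 : ℂ) ^ (-s)‖ = (2 : ℝ) ^ (-s.re) := by
  have := Complex.norm_natCast_cpow_of_pos two_pos (-s)
  simpa using this

theorem norm_two_cpow_neg_lt_one {s : ℂ} (hs : 0 < s.re) : ‖(2 : ℂ) ^ (-s)‖ < 1 := by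
  rw [norm_two_cpow_neg]
  exact Real.rpow_lt_one_of_one_lt_of_neg one_lt_two (by linarith)

theorem one_add_ne_zero_of_norm_lt_one {z : ℂ} (hz : ‖z‖ < 1) : 1 + z ≠ 0 := fun h => by
  rw [eq_neg_of_add_eq_zero_right h, norm_neg, norm_one] at hz
  exact lt_irrefl _ hz

theorem half_lt_re_cayleyMap {z : ℂ} (hz : ‖z‖ < 1) : 1 / 2 < (cayleyMap z).re := by
  have h1 : 0 < Complex.normSq (1 + z) :=
    Complex.normSq_pos.2 (one_add_ne_zero_of_norm_lt_one hz)
  have h2 : Complex.normSq z < 1 := by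
    rw [Complex.normSq_eq_norm_sq]; nlinarith [norm_nonneg z]
  have h3 : ((1 - z) / (1 + z)).re = (1 - Complex.normSq z) / Complex.normSq (1 + z) := by
    rw [Complex.div_re, ← add_div]
    congr 1
    simp [Complex.normSq_apply]; ring
  rw [cayleyMap, Complex.add_re, h3]
  have : 0 < (1 - Complex.normSq z) / Complex.normSq (1 + z) := div_pos (by linarith) h1
  norm_num
  exact this

/-- The coefficients of the Dirichlet series of `𝒯(2⁻ˢ)`. -/
noncomputable def cayleyCoeff (n : ℕ) : ℂ :=
  if n = 1 then 3 / 2 else if 2 ^ Nat.log 2 n = n then 2 * (-1) ^ Nat.log 2 n else 0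

/-- With z = 2⁻ˢ, 𝒯(z) = -1/2 + 2/(1 + z), a geometric series in -z. Summing over n ≤ N keeps the
powers zʲ with j ≤ log₂ N, and the subtracted term is the geometric tail. -/
theorem sum_cayleyCoeff {N : ℕ} (hN : 1 ≤ N) {s : ℂ} (hs : 0 < s.re) :
    ∑ n ∈ Finset.Icc 1 N, cayleyCoeff n * (n : ℂ) ^ (-s) =
      cayleyMap (2 ^ (-s)) - 2 * (-(2 : ℂ) ^ (-s)) ^ (Nat.log 2 N + 1) / (1 + 2 ^ (-s)) := by
  set z := (2 : ℂ) ^ (-s) with hz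
  have hz1 : 1 + z ≠ 0 := one_add_ne_zero_of_norm_lt_one (norm_two_cpow_neg_lt_one hs)
  have h1 : ∑ j ∈ Finset.range (Nat.log 2 N + 1), (if j = 0 then 3 / 2 else 2 * (-z) ^ j) =
      ∑ n ∈ Finset.Icc 1 N, cayleyCoeff n * (n : ℂ) ^ (-s) := by
    refine Finset.sum_of_injOn (fun j => 2 ^ j) (Nat.pow_right_injective le_rfl).injOn ?_ ?_ ?_
    · intro j hj
      simp only [Finset.coe_range, mem_Iio] at hj
      simp only [Finset.coe_Icc, mem_Icc]
      exact ⟨Nat.one_le_two_pow, Nat.pow_le_of_le_log (by omega) (by omega)⟩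
    · intro n hn hni
      rw [Finset.mem_Icc] at hn
      rw [cayleyCoeff, if_neg, if_neg, zero_mul]
      · intro h
        exact hni ⟨Nat.log 2 n, by
          simpa using Nat.lt_succ_of_le (Nat.log_mono_right hn.2), h⟩
      · rintro rfl
        exact hni ⟨0, by simp, by simp⟩
    · intro j hj
      have hzj : (((2 ^ j : ℕ)) : ℂ) ^ (-s) = z ^ j := by
        rw [hz, Nat.cast_pow, ← Complex.natCast_cpow_natCast_mul, Complex.cpow_nat_mul,
          Nat.cast_ofNat]
      simp only [cayleyCoeff, Nat.pow_eq_one, Nat.log_pow one_lt_two, hzj]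
      by_cases hj0 : j = 0
      · simp [hj0]
      · simp [hj0]
        rw [neg_pow]; ring
  rw [← h1]
  have h2 : ∀ J : ℕ, ∑ j ∈ Finset.range (J + 1), (if j = 0 then 3 / 2 else 2 * (-z) ^ j) =
      -1 / 2 + 2 * ∑ j ∈ Finset.range (J + 1), (-z) ^ j := fun J => by
    rw [Finset.sum_range_succ', Finset.sum_range_succ' (fun j => (-z) ^ j), mul_add, Finset.mul_sum]
    simp; ring
  have h3 : -z ≠ 1 := fun h => hz1 (by rw [← h]; ring)
  rw [h2, geom_sum_eq h3, cayleyMap]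
  have h4 : -z - 1 ≠ 0 := sub_ne_zero.2 h3
  rw [show -z - 1 = -(1 + z) by ring]
  field_simp
  ring

theorem tendstoUniformlyOn_cayleyCoeff {ε : ℝ} (hε : 0 < ε) : TendstoUniformlyOn
    (fun (N : ℕ) (s : ℂ) => ∑ n ∈ Finset.Icc 1 N, cayleyCoeff n * (n : ℂ) ^ (-s))
    (fun s => cayleyMap ((2 : ℂ) ^ (-s))) atTop (halfPlane ε) := by
  set r : ℝ := (2 : ℝ) ^ (-ε)
  have hr0 : 0 < r := by positivity
  have hr1 : r < 1 := Real.rpow_lt_one_of_one_lt_of_neg one_lt_two (by linarith)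
  have hlog : Tendsto (fun N => Nat.log 2 N) atTop atTop :=
    tendsto_atTop.2 fun b => by
      filter_upwards [eventually_ge_atTop (2 ^ b)] with N hN
      exact Nat.le_log_of_pow_le one_lt_two hN
  have hlim : Tendsto (fun N : ℕ => 2 * r ^ (Nat.log 2 N + 1) / (1 - r)) atTop (𝓝 0) := by
    have h1 := (tendsto_pow_atTop_nhds_zero_of_lt_one hr0.le hr1).comp
      ((tendsto_add_atTop_nat 1).comp hlog)
    simpa using (h1.const_mul 2).div_const (1 - r)
  rw [Metric.tendstoUniformlyOn_iff]
  intro κ hκ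
  filter_upwards [hlim.eventually (gt_mem_nhds hκ), eventually_ge_atTop 1] with N hN hN1 s hs
  have hs' : ε < s.re := hs
  have hs0 : 0 < s.re := hε.trans hs'
  rw [sum_cayleyCoeff hN1 hs0, dist_eq_norm, sub_sub_cancel]
  refine lt_of_le_of_lt ?_ hN
  have hzr : ‖(2 : ℂ) ^ (-s)‖ ≤ r := by
    rw [norm_two_cpow_neg]
    exact Real.rpow_le_rpow_of_exponent_le one_le_two (by linarith)
  have h1z : 1 - r ≤ ‖1 + (2 : ℂ) ^ (-s)‖ := by
    have := norm_sub_norm_le (1 : ℂ) (-(2 : ℂ) ^ (-s))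
    rw [norm_neg, sub_neg_eq_add, norm_one] at this
    linarith
  rw [norm_div, norm_mul, norm_pow, norm_neg]
  have : 0 < 1 - r := by linarith
  norm_num
  gcongr

theorem gordonHedenmalm_cayleyMap :
    GordonHedenmalm 0 (fun s => cayleyMap ((2 : ℂ) ^ (-s))) := by
  refine ⟨fun s hs => half_lt_re_cayleyMap (norm_two_cpow_neg_lt_one ?_), cayleyCoeff,
    fun s => cayleyMap ((2 : ℂ) ^ (-s)), fun ε hε => tendstoUniformlyOn_cayleyCoeff hε,
    fun s _ => by simp, fun _ s hs =>
    half_lt_re_cayleyMap (norm_two_cpow_neg_lt_one hs), fun h => absurd h (by norm_num)⟩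
  have : 1 / 2 < s.re := hs
  linarith

/-! ### Periodicity and the projection on powers of two -/

/-- The period of `2⁻ˢ` in the imaginary direction. -/
noncomputable def twoPeriod : ℝ := 2 * Real.pi / Real.log 2

theorem twoPeriod_pos : 0 < twoPeriod := by
  have := Real.log_pos one_lt_two
  have := Real.pi_pos
  unfold twoPeriod; positivity

theorem two_cpow_add_period (s : ℂ) :
    (2 : ℂ) ^ (-(s + Complex.I * twoPeriod)) = (2 : ℂ) ^ (-s) := by
  have h2 : (2 : ℂ) ≠ 0 := two_ne_zero
  have hl : (Real.log 2 : ℂ) ≠ 0 := by exact_mod_cast (Real.log_pos one_lt_two).ne'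
  rw [neg_add, Complex.cpow_add _ _ h2]
  have : (2 : ℂ) ^ (-(Complex.I * twoPeriod)) = 1 := by
    rw [Complex.cpow_def_of_ne_zero h2, Complex.exp_eq_one_iff]
    refine ⟨-1, ?_⟩
    rw [show (2 : ℂ) = ((2 : ℝ) : ℂ) by norm_num, ← Complex.ofReal_log zero_le_two, twoPeriod]
    push_cast
    field_simp
  rw [this, mul_one]

/-- The condition says that log n / log 2 is an integer: the period leaves exactly the frequencies
of powers of two invariant. -/
theorem natCast_cpow_period_eq_one_iff (n : ℕ+) :
    ((n : ℕ) : ℂ) ^ (-(Complex.I * twoPeriod)) = 1 ↔ ∃ j : ℕ, (n : ℕ) = 2 ^ j := by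
  have hl := Real.log_pos one_lt_two
  have hn0 : (0 : ℝ) < (n : ℕ) := by exact_mod_cast n.pos
  constructor
  · rw [DirichletPoly.natCast_cpow_I, Complex.exp_eq_one_iff]
    rintro ⟨k, hk⟩
    have h1 := congrArg Complex.im hk
    simp only [Complex.mul_im, Complex.mul_re, Complex.I_re, Complex.I_im, Complex.ofReal_re,
      Complex.ofReal_im, Complex.intCast_re, Complex.intCast_im, Complex.re_ofNat,
      Complex.im_ofNat] at h1
    ring_nf at h1
    have h2 : Real.log (n : ℕ) = -k * Real.log 2 := by
      rw [twoPeriod] at h1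
      have hpi := Real.pi_pos
      field_simp at h1
      linarith
    have hk0 : 0 ≤ -k := by
      have h3 : 0 ≤ Real.log (n : ℕ) := Real.log_natCast_nonneg _
      rw [h2] at h3
      have := nonneg_of_mul_nonneg_left h3 hl
      exact_mod_cast this
    obtain ⟨j, hj⟩ := Int.eq_ofNat_of_zero_le hk0
    refine ⟨j, ?_⟩
    have h4 : Real.log (n : ℕ) = Real.log ((2 : ℝ) ^ j) := by
      rw [h2, Real.log_pow]
      congr 1
      exact_mod_cast hj
    have := Real.log_injOn_pos (mem_Ioi.2 hn0) (mem_Ioi.2 (by positivity)) h4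
    exact_mod_cast this
  · rintro ⟨j, hj⟩
    have := two_cpow_add_period 0
    rw [zero_add, neg_zero, Complex.cpow_zero] at this
    rw [hj, Nat.cast_pow, Nat.cast_ofNat, show ((2 : ℂ) ^ j) = (((2 : ℕ) : ℂ) ^ j) by norm_num,
      ← Complex.natCast_cpow_natCast_mul, Complex.cpow_nat_mul, Nat.cast_ofNat, this, one_pow]

open Classical in
/-- The part of a Dirichlet polynomial supported on the powers of two. -/
noncomputable def DirichletPoly.twoPart (Q : DirichletPoly) : DirichletPoly :=
  Finsupp.filter (fun n : ℕ+ => ∃ j : ℕ, (n : ℕ) = 2 ^ j) Q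

open Classical in
theorem DirichletPoly.twoPart_sub (Q R : DirichletPoly) :
    DirichletPoly.twoPart (Q - R) = DirichletPoly.twoPart Q - DirichletPoly.twoPart R :=
  Finsupp.filter_sub _ _ _

/-- The averages of the translates of a Dirichlet polynomial by multiples of the period of `2⁻ˢ`
converge to its part supported on the powers of two. -/
theorem DirichletPoly.exists_twoPart_bound (Q : DirichletPoly) : ∃ K, ∀ (J : ℕ) (s : ℂ),
    0 ≤ s.re → ‖J * DirichletPoly.eval (DirichletPoly.twoPart Q) s -
      ∑ j ∈ Finset.range J, DirichletPoly.eval Q (s + j * (Complex.I * twoPeriod))‖ ≤ K := by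
  classical
  set ζ : ℕ+ → ℂ := fun n => ((n : ℕ) : ℂ) ^ (-(Complex.I * twoPeriod)) with hζ
  have hζ1 : ∀ n, ‖ζ n‖ = 1 := fun n => by
    rw [hζ]; simp only; rw [DirichletPoly.norm_natCast_cpow]; simp
  -- For ζ n ≠ 1 this bounds a geometric sum with unimodular ratio, uniformly in J. For ζ n = 1 the
  -- quotient 2 / 0 is 0, which suffices because these terms cancel exactly.
  refine ⟨∑ n ∈ Q.support, ‖Q n‖ * (2 / ‖1 - ζ n‖), fun J s hs => ?_⟩
  have h1 : DirichletPoly.eval (DirichletPoly.twoPart Q) s =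
      ∑ n ∈ Q.support, (if ζ n = 1 then Q n else 0) * ((n : ℕ) : ℂ) ^ (-s) := by
    unfold DirichletPoly.eval
    rw [Finsupp.sum_of_support_subset (s := Q.support) _ (by
      rw [DirichletPoly.twoPart, Finsupp.support_filter]; exact Finset.filter_subset _ _) _
      (by simp)]
    refine Finset.sum_congr rfl fun n _ => ?_
    rw [DirichletPoly.twoPart, Finsupp.filter_apply]
    simp only [hζ, natCast_cpow_period_eq_one_iff]
  have h2 : ∑ j ∈ Finset.range J, DirichletPoly.eval Q (s + j * (Complex.I * twoPeriod)) =
      ∑ n ∈ Q.support, Q n * ((n : ℕ) : ℂ) ^ (-s) * ∑ j ∈ Finset.range J, ζ n ^ j := by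
    simp only [Finset.mul_sum]
    rw [Finset.sum_comm]
    refine Finset.sum_congr rfl fun j _ => ?_
    unfold DirichletPoly.eval Finsupp.sum
    refine Finset.sum_congr rfl fun n _ => ?_
    dsimp only
    rw [DirichletPoly.natCast_cpow_add, ← mul_neg, Complex.cpow_nat_mul, mul_assoc]
  rw [h1, h2, Finset.mul_sum, ← Finset.sum_sub_distrib]
  refine (norm_sum_le _ _).trans (Finset.sum_le_sum fun n _ => ?_)
  have hn := DirichletPoly.norm_natCast_cpow_le_one n hs
  by_cases h : ζ n = 1
  · rw [if_pos h, h]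
    simp only [one_pow, Finset.sum_const, Finset.card_range, nsmul_eq_mul, mul_one]
    rw [show (J : ℂ) * (Q n * ((n : ℕ) : ℂ) ^ (-s)) - Q n * ((n : ℕ) : ℂ) ^ (-s) * J = 0 by ring,
      norm_zero]
    positivity
  · rw [if_neg h, zero_mul, mul_zero, zero_sub, norm_neg, norm_mul, norm_mul]
    have h3 : ‖∑ j ∈ Finset.range J, ζ n ^ j‖ ≤ 2 / ‖1 - ζ n‖ := by
      have h4 : 0 < ‖1 - ζ n‖ := norm_pos_iff.2 (sub_ne_zero.2 (Ne.symm h))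
      rw [le_div_iff₀ h4, mul_comm, ← norm_mul, mul_neg_geom_sum]
      refine (norm_sub_le _ _).trans ?_
      rw [norm_pow, hζ1, norm_one]; norm_num
    calc _ ≤ ‖Q n‖ * 1 * (2 / ‖1 - ζ n‖) := by gcongr
      _ = _ := by ring

theorem besicovitchFun_const_mul {p : ℝ} (hp : 0 < p) {F : ℝ → ℂ} (hF : HasPMean p F) (c : ℂ) :
    HasPMean p (fun t => c * F t) ∧
      besicovitchFun p (fun t => c * F t) = ‖c‖ * besicovitchFun p F := by
  have h := (hF.hasMean hp).const_mul_real (‖c‖ ^ p)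
  have h' : HasMean (fun t => ‖c * F t‖ ^ p) (‖c‖ ^ p * besicovitchFun p F ^ p) := by
    convert h using 2 with t
    rw [norm_mul, Real.mul_rpow (norm_nonneg _) (norm_nonneg _)]
  refine ⟨⟨continuous_const.mul hF.1, _, h'⟩, ?_⟩
  have h0 := hF.nonneg hp
  rw [(besicovitchFun_eq hp h').1, ← Real.mul_rpow (norm_nonneg _) h0,
    ← Real.rpow_mul (by positivity), mul_one_div_cancel hp.ne', Real.rpow_one]

section Norms

variable {p : ℝ}

theorem besicovitchNorm_shift_I (hp : 1 ≤ p) (Q : DirichletPoly) (τ : ℝ) :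
    besicovitchNorm p (DirichletPoly.shift (Complex.I * τ) Q) = besicovitchNorm p Q := by
  have hp0 : 0 < p := by linarith
  have hQ := (Q.hasPMean hp0)
  have hb : ∀ t : ℝ, ‖‖DirichletPoly.eval Q (Complex.I * t)‖ ^ p‖ ≤
      (Q.sum fun _ a => ‖a‖) ^ p := fun t => by
    rw [Real.norm_of_nonneg (by positivity)]
    have := Q.norm_eval_le (s := Complex.I * t) (by simp)
    gcongr
  have h := (hQ.hasMean hp0).translate (continuous_norm_rpow hp0 hQ.1) hb τ
  have h' : HasMean (fun t : ℝ => ‖DirichletPoly.eval (DirichletPoly.shift (Complex.I * τ) Q)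
      (Complex.I * t)‖ ^ p) (besicovitchNorm p Q ^ p) := by
    have e : ∀ t : ℝ, DirichletPoly.eval (DirichletPoly.shift (Complex.I * τ) Q) (Complex.I * t) =
        DirichletPoly.eval Q (Complex.I * ((t + τ : ℝ) : ℂ)) := fun t => by
      rw [DirichletPoly.eval_shift]; congr 1; push_cast; ring
    simp only [e]
    exact h
  exact (besicovitchFun_eq hp0 h').1.trans (by
    rw [← Real.rpow_mul (besicovitchNorm_nonneg hp Q), mul_one_div_cancel hp0.ne', Real.rpow_one])

theorem besicovitchFun_sum_translates_le (hp : 1 ≤ p) (Q : DirichletPoly) (z : ℕ → ℝ) (J : ℕ) :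
    ∃ R : DirichletPoly, (∀ s, DirichletPoly.eval R s = ∑ j ∈ Finset.range J,
      DirichletPoly.eval Q (s + Complex.I * z j)) ∧
      besicovitchNorm p R ≤ J * besicovitchNorm p Q := by
  have hp0 : 0 < p := by linarith
  induction J with
  | zero =>
    refine ⟨0, fun s => by simp [DirichletPoly.eval], ?_⟩
    rw [Nat.cast_zero, zero_mul]
    exact (DirichletPoly.hasPMean hp0 0).le_of_bound hp0 fun t => by simp [DirichletPoly.eval]
  | succ J ih =>
    obtain ⟨R, hR, hRn⟩ := ih
    refine ⟨R + DirichletPoly.shift (Complex.I * z J) Q, fun s => ?_, ?_⟩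
    · rw [DirichletPoly.eval_add, hR, DirichletPoly.eval_shift, Finset.sum_range_succ]
    · have h1 := besicovitchFun_add_le hp (R.hasPMean hp0)
        ((DirichletPoly.shift (Complex.I * z J) Q).hasPMean hp0)
        ((R + DirichletPoly.shift (Complex.I * z J) Q).hasPMean hp0) fun t => by
          rw [DirichletPoly.eval_add]; exact norm_add_le _ _
      have h2 := besicovitchNorm_shift_I hp Q (z J)
      calc _ ≤ besicovitchNorm p R + besicovitchNorm p (DirichletPoly.shift (Complex.I * z J) Q) :=
            h1
        _ ≤ _ := by rw [h2]; push_cast; linarith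

/-- J times the two-part differs from a sum of J translates, each of the norm of Q, by an amount
bounded independently of J; divide by J and let J → ∞. -/
theorem besicovitchNorm_twoPart_le (hp : 1 ≤ p) (Q : DirichletPoly) :
    besicovitchNorm p (DirichletPoly.twoPart Q) ≤ besicovitchNorm p Q := by
  have hp0 : 0 < p := by linarith
  obtain ⟨K, hK⟩ := Q.exists_twoPart_bound
  have hT := Q.twoPart.hasPMean hp0
  have key : ∀ J : ℕ, (J : ℝ) * besicovitchNorm p (DirichletPoly.twoPart Q) ≤
      K + J * besicovitchNorm p Q := fun J => by
    obtain ⟨R, hR, hRn⟩ := besicovitchFun_sum_translates_le hp Q (fun j => j * twoPeriod) J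
    obtain ⟨h1, h2⟩ := besicovitchFun_const_mul hp0 hT J
    rw [Complex.norm_natCast] at h2
    have hJ : IsDirichletLimit fun s => (J : ℂ) * DirichletPoly.eval Q.twoPart s :=
      (IsDirichletLimit.const _).mul Q.twoPart.isDirichletLimit
    have h3 := (hJ.sub R.isDirichletLimit).hasPMean hp0
    have h4 := besicovitchFun_add_le hp h3 (R.hasPMean hp0) h1 fun t =>
      norm_le_norm_sub_add _ _
    have h5 := h3.le_of_bound hp0 (B := K) fun t => by
      refine le_trans (le_of_eq ?_) (hK J (Complex.I * t) (by simp))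
      rw [hR]
      congr 3
      funext j
      congr 2; push_cast; ring
    calc _ = _ := h2.symm
      _ ≤ _ := h4
      _ ≤ _ := add_le_add h5 hRn
  refine le_of_forall_pos_le_add fun ε hε => ?_
  obtain ⟨J, hJ⟩ := exists_nat_gt (K / ε)
  rw [div_lt_iff₀ hε] at hJ
  have hK0 : 0 ≤ K := (norm_nonneg _).trans (hK 0 0 le_rfl)
  have hJ0 : (0 : ℝ) < J := by
    rcases (Nat.cast_nonneg (α := ℝ) J).eq_or_lt with h | h
    · rw [← h] at hJ; linarith
    · exact h
  have := key J
  refine le_of_mul_le_mul_left ?_ hJ0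
  rw [mul_add]
  linarith

/-- Coefficients are bounded by the Besicovitch norm. -/
theorem norm_coeff_le (hp : 1 ≤ p) (Q : DirichletPoly) (n : ℕ+) :
    ‖Q n‖ ≤ 2 * besicovitchNorm p Q := by
  have hp0 : 0 < p := by linarith
  have hQ := Q.hasPMean hp0
  have hN := besicovitchNorm_nonneg hp Q
  refine le_of_forall_pos_le_add fun ε hε => ?_
  -- The pointwise inequality x ≤ A + A(x/A)ᵖ replaces Hölder, which costs the factor 2; ε keeps A
  -- positive when the norm vanishes.
  set A := besicovitchNorm p Q + ε / 2 with hA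
  have hA0 : 0 < A := by linarith
  have h1 := (hasMean_const A).add continuous_const
    (by have := continuous_norm_rpow hp0 hQ.1; fun_prop)
    ((hQ.hasMean hp0).const_mul_real (A * (A ^ p)⁻¹))
  have h2 := (Q.hasMean_eval_mul n).norm_le
    (by have := continuous_norm_rpow hp0 hQ.1; fun_prop) h1 fun t => by
      rw [norm_mul, DirichletPoly.norm_natCast_cpow_I, mul_one]
      set x := ‖DirichletPoly.eval Q (Complex.I * t)‖
      have hx : 0 ≤ x := norm_nonneg _
      rw [show A * (A ^ p)⁻¹ * x ^ p = A * (x / A) ^ p by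
        rw [Real.div_rpow hx hA0.le]; ring]
      rcases le_total x A with h | h
      · have : 0 ≤ A * (x / A) ^ p := by positivity
        linarith
      · have h3 : x / A ≤ (x / A) ^ p :=
          Real.self_le_rpow_of_one_le ((one_le_div hA0).2 h) hp
        have h4 : x = A * (x / A) := by field_simp
        nlinarith
  have h5 : besicovitchFun p (fun t : ℝ => DirichletPoly.eval Q (Complex.I * t)) ^ p ≤ A ^ p := by
    have : besicovitchFun p (fun t : ℝ => DirichletPoly.eval Q (Complex.I * t)) ≤ A := by
      change besicovitchNorm p Q ≤ A; linarith
    have h0 := hQ.nonneg hp0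
    gcongr
  calc _ ≤ _ := h2
    _ ≤ A + A * (A ^ p)⁻¹ * A ^ p := by gcongr
    _ = 2 * besicovitchNorm p Q + ε := by field_simp; rw [hA]; ring

theorem norm_eval_le_of_two_le_re (hp : 1 ≤ p) : ∃ D > 0, ∀ (Q : DirichletPoly) (s : ℂ),
    2 ≤ s.re → ‖DirichletPoly.eval Q s‖ ≤ D * besicovitchNorm p Q := by
  have hsum : Summable fun n : ℕ+ => 1 / ((n : ℕ) : ℝ) ^ 2 :=
    (Real.summable_one_div_nat_pow.2 one_lt_two).comp_injective PNat.coe_injective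
  refine ⟨2 * ∑' n : ℕ+, 1 / ((n : ℕ) : ℝ) ^ 2, ?_, fun Q s hs => ?_⟩
  · have := hsum.tsum_pos (fun n => by positivity) 1 (by simp)
    positivity
  · have hN := besicovitchNorm_nonneg hp Q
    calc ‖DirichletPoly.eval Q s‖ ≤ ∑ n ∈ Q.support, ‖Q n * ((n : ℕ) : ℂ) ^ (-s)‖ :=
          norm_sum_le _ _
      _ ≤ ∑ n ∈ Q.support, 2 * besicovitchNorm p Q * (1 / ((n : ℕ) : ℝ) ^ 2) := by
        refine Finset.sum_le_sum fun n _ => ?_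
        rw [norm_mul, DirichletPoly.norm_natCast_cpow]
        gcongr
        · exact norm_coeff_le hp Q n
        · rw [one_div, ← Real.rpow_natCast, ← Real.rpow_neg (by positivity)]
          refine Real.rpow_le_rpow_of_exponent_le (by exact_mod_cast n.pos) ?_
          push_cast; linarith
      _ ≤ 2 * besicovitchNorm p Q * ∑' n : ℕ+, 1 / ((n : ℕ) : ℝ) ^ 2 := by
        rw [← Finset.mul_sum]
        gcongr
        exact hsum.sum_le_tsum _ fun n _ => by positivity
      _ = _ := by ring

/-- Powers of two are sparse: bounded coefficients and a geometric series give pointwise control on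
all of Re s ≥ σ > 0. -/
theorem norm_eval_twoPart_le (hp : 1 ≤ p) {σ : ℝ} (hσ : 0 < σ) (Q : DirichletPoly) {s : ℂ}
    (hs : σ ≤ s.re) : ‖DirichletPoly.eval (DirichletPoly.twoPart Q) s‖ ≤
      2 * (1 - (2 : ℝ) ^ (-σ))⁻¹ * besicovitchNorm p Q := by
  set r : ℝ := (2 : ℝ) ^ (-σ) with hr
  have hr0 : 0 < r := by positivity
  have hr1 : r < 1 := Real.rpow_lt_one_of_one_lt_of_neg one_lt_two (by linarith)
  have hN := besicovitchNorm_nonneg hp Q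
  have hsupp : ∀ n ∈ (DirichletPoly.twoPart Q).support, ∃ j : ℕ, (n : ℕ) = 2 ^ j := by
    classical
    intro n hn
    rw [DirichletPoly.twoPart, Finsupp.support_filter, Finset.mem_filter] at hn
    exact hn.2
  have hlog : ∀ n ∈ (DirichletPoly.twoPart Q).support, (n : ℕ) = 2 ^ Nat.log 2 n := by
    intro n hn
    obtain ⟨j, hj⟩ := hsupp n hn
    rw [hj, Nat.log_pow one_lt_two]
  calc ‖DirichletPoly.eval (DirichletPoly.twoPart Q) s‖
      ≤ ∑ n ∈ (DirichletPoly.twoPart Q).support,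
        ‖DirichletPoly.twoPart Q n * ((n : ℕ) : ℂ) ^ (-s)‖ := norm_sum_le _ _
    _ ≤ ∑ n ∈ (DirichletPoly.twoPart Q).support,
        2 * besicovitchNorm p Q * r ^ Nat.log 2 n := by
      refine Finset.sum_le_sum fun n hn => ?_
      rw [norm_mul, DirichletPoly.norm_natCast_cpow]
      gcongr
      · have h1 := norm_coeff_le hp (DirichletPoly.twoPart Q) n
        have h2 := besicovitchNorm_twoPart_le hp Q
        linarith
      · rw [hr, ← Real.rpow_natCast, ← Real.rpow_mul zero_le_two, mul_comm, Real.rpow_mul zero_le_two,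
          Real.rpow_natCast]
        have h3 : ((n : ℕ) : ℝ) = 2 ^ Nat.log 2 n := by exact_mod_cast hlog n hn
        rw [← h3]
        exact Real.rpow_le_rpow_of_exponent_le (by exact_mod_cast n.pos) (by linarith)
    _ = 2 * besicovitchNorm p Q *
        ∑ j ∈ (DirichletPoly.twoPart Q).support.image (fun n : ℕ+ => Nat.log 2 n), r ^ j := by
      rw [← Finset.mul_sum, Finset.sum_image]
      intro n hn m hm hnm
      apply PNat.eq
      rw [hlog n hn, hlog m hm]
      simp only at hnm
      rw [hnm]
    _ ≤ 2 * besicovitchNorm p Q * (1 - r)⁻¹ := by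
      gcongr
      rw [← tsum_geometric_of_lt_one hr0.le hr1]
      exact (summable_geometric_of_lt_one hr0.le hr1).sum_le_tsum _ fun j _ => by positivity
    _ = _ := by ring

end Norms

theorem le_of_forall_natCast_mul_le {x y K : ℝ} (h : ∀ J : ℕ, (J : ℝ) * x ≤ K + J * y) : x ≤ y := by
  by_contra! hlt
  obtain ⟨J, hJ⟩ := exists_nat_gt (K / (x - y))
  rw [div_lt_iff₀ (sub_pos.2 hlt)] at hJ
  linarith [h J]

/-! ### Periodic elements of ℋᵖ -/

section Approximation

variable {p : ℝ} {Q : ℕ → DirichletPoly} {f : ℂ → ℂ}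

theorem isOpen_halfPlane (θ : ℝ) : IsOpen (halfPlane θ) :=
  isOpen_lt continuous_const Complex.continuous_re

theorem HpApprox.eventually_norm_sub_le (hp : 1 ≤ p) (h : HpApprox p Q f) {ε : ℝ} (hε : 0 < ε) :
    ∀ᶠ k in atTop, ∀ s : ℂ, 2 ≤ s.re → ‖DirichletPoly.eval (Q k) s - f s‖ ≤ ε := by
  obtain ⟨D, hD, hDQ⟩ := norm_eval_le_of_two_le_re hp
  obtain ⟨K, hK⟩ := h.cauchy (ε / D) (by positivity)
  filter_upwards [eventually_ge_atTop K] with k hk s hs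
  have h1 := (tendsto_const_nhds (x := DirichletPoly.eval (Q k) s)).sub
    (h.tendsto s (by simp only [halfPlane, mem_ofPred_eq]; linarith))
  refine le_of_tendsto h1.norm ?_
  filter_upwards [eventually_ge_atTop K] with l hl
  rw [← DirichletPoly.eval_sub]
  refine (hDQ _ _ hs).trans ?_
  have := (hK k hk l hl).le
  calc _ ≤ D * (ε / D) := by gcongr
    _ = ε := by field_simp

/-- On Re s ≥ 2 convergence to f is uniform, so it survives averaging over the vertical translates;
these leave f fixed and turn Qₖ into its two-part in the limit. -/
theorem HpApprox.tendsto_twoPart_of_two_le_re (hp : 1 ≤ p) (h : HpApprox p Q f)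
    (hper : ∀ s, f (s + Complex.I * twoPeriod) = f s) {s : ℂ} (hs : 2 ≤ s.re) :
    Tendsto (fun k => DirichletPoly.eval (Q k).twoPart s) atTop (𝓝 (f s)) := by
  have hperj : ∀ j : ℕ, f (s + j * (Complex.I * twoPeriod)) = f s := fun j => by
    induction j with
    | zero => simp
    | succ j ih => rw [← ih, ← hper (s + j * (Complex.I * twoPeriod))]; congr 1; push_cast; ring
  rw [Metric.tendsto_nhds]
  intro ε hε
  filter_upwards [h.eventually_norm_sub_le hp (half_pos hε)] with k hk
  refine lt_of_le_of_lt ?_ (half_lt_self hε)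
  obtain ⟨K, hK⟩ := (Q k).exists_twoPart_bound
  refine le_of_forall_natCast_mul_le (K := K) fun J => ?_
  rw [dist_eq_norm]
  have h1 := hK J s (by linarith)
  have h2 : ‖∑ j ∈ Finset.range J, DirichletPoly.eval (Q k) (s + j * (Complex.I * twoPeriod)) -
      J * f s‖ ≤ J * (ε / 2) := by
    have : (J : ℂ) * f s = ∑ j ∈ Finset.range J, f (s + j * (Complex.I * twoPeriod)) := by
      simp [hperj]
    rw [this, ← Finset.sum_sub_distrib]
    refine (norm_sum_le_of_le _ fun j _ => hk _ ?_).trans (by simp)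
    simpa using hs
  have h3 : (J : ℝ) * ‖DirichletPoly.eval (Q k).twoPart s - f s‖ =
      ‖(J : ℂ) * DirichletPoly.eval (Q k).twoPart s - J * f s‖ := by
    rw [← mul_sub, norm_mul, Complex.norm_natCast]
  rw [h3]
  exact (norm_sub_le_norm_sub_add_norm_sub _ _ _).trans (add_le_add h1 h2)

/-- The two-parts are uniformly Cauchy on each Re s > σ, so their limit is holomorphic on Re s > 0.
It agrees with f on Re s > 2, and the identity theorem extends the equality. -/
theorem HpApprox.tendstoUniformlyOn_twoPart (hp : 1 ≤ p) (h : HpApprox p Q f)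
    (hper : ∀ s, f (s + Complex.I * twoPeriod) = f s) (hf : DifferentiableOn ℂ f (halfPlane 0))
    {σ : ℝ} (hσ : 0 < σ) : TendstoUniformlyOn
      (fun k s => DirichletPoly.eval (Q k).twoPart s) f atTop (halfPlane σ) := by
  have hcau : ∀ σ : ℝ, 0 < σ → UniformCauchySeqOn
      (fun k s => DirichletPoly.eval (Q k).twoPart s) atTop (halfPlane σ) := by
    intro σ hσ
    rw [Metric.uniformCauchySeqOn_iff]
    intro ε hε
    have hr1 : (2 : ℝ) ^ (-σ) < 1 := Real.rpow_lt_one_of_one_lt_of_neg one_lt_two (by linarith)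
    set D := 2 * (1 - (2 : ℝ) ^ (-σ))⁻¹ with hD
    have hD0 : 0 < D := by
      have : 0 < 1 - (2 : ℝ) ^ (-σ) := by linarith
      positivity
    obtain ⟨K, hK⟩ := h.cauchy (ε / D) (by positivity)
    refine ⟨K, fun m hm n hn s hs => ?_⟩
    rw [dist_eq_norm, ← DirichletPoly.eval_sub, ← DirichletPoly.twoPart_sub]
    refine (norm_eval_twoPart_le hp hσ _ (le_of_lt hs)).trans_lt ?_
    have := hK m hm n hn
    calc _ < D * (ε / D) := by rw [← hD]; gcongr
      _ = ε := by field_simp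
  set G : ℂ → ℂ := fun s => limUnder atTop fun k => DirichletPoly.eval (Q k).twoPart s with hG
  have hGt : ∀ s ∈ halfPlane 0, Tendsto (fun k => DirichletPoly.eval (Q k).twoPart s) atTop
      (𝓝 (G s)) := fun s hs => by
    have hs' : 0 < s.re := hs
    exact ((hcau (s.re / 2) (by linarith)).cauchySeq (x := s)
      (by simp only [halfPlane, mem_ofPred_eq]; linarith)).tendsto_limUnder
  have hsub : ∀ σ : ℝ, 0 < σ → halfPlane σ ⊆ halfPlane 0 := fun σ hσ s hs => hσ.trans hs
  have hGu : ∀ σ : ℝ, 0 < σ → TendstoUniformlyOn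
      (fun k s => DirichletPoly.eval (Q k).twoPart s) G atTop (halfPlane σ) := fun σ hσ =>
    (hcau σ hσ).tendstoUniformlyOn_of_tendsto fun s hs => hGt s (hsub σ hσ hs)
  have hGd : DifferentiableOn ℂ G (halfPlane 0) := by
    refine TendstoLocallyUniformlyOn.differentiableOn
      (F := fun k s => DirichletPoly.eval (Q k).twoPart s) (φ := atTop) ?_
      (Eventually.of_forall fun k => (Q k).twoPart.differentiable_eval.differentiableOn)
      (isOpen_halfPlane 0)
    refine tendstoLocallyUniformlyOn_of_forall_exists_nhds fun s hs => ?_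
    have hs' : 0 < s.re := hs
    exact ⟨halfPlane (s.re / 2), mem_nhdsWithin_of_mem_nhds
      ((isOpen_halfPlane _).mem_nhds (by simp only [halfPlane, mem_ofPred_eq]; linarith)),
      hGu _ (by linarith)⟩
  have heq : EqOn G f (halfPlane 0) := by
    refine (hGd.analyticOnNhd (isOpen_halfPlane 0)).eqOn_of_preconnected_of_eventuallyEq
      (hf.analyticOnNhd (isOpen_halfPlane 0)) (convex_halfSpace_re_gt 0).isPreconnected
      (z₀ := 3) (by simp [halfPlane]) ?_
    filter_upwards [(isOpen_halfPlane 2).mem_nhds (by simp [halfPlane]; norm_num : (3 : ℂ) ∈ _)]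
      with s hs
    exact tendsto_nhds_unique (hGt s (hsub 2 two_pos hs))
      (h.tendsto_twoPart_of_two_le_re hp hper (le_of_lt hs))
  exact (hGu σ hσ).congr_right (heq.mono (hsub σ hσ))

/-- Horizontal shifts and the projection on powers of two do not increase the norm, and after both
the approximants converge uniformly on the line Re s = σ. -/
theorem HpApprox.besicovitchFun_line_le (hp : 1 ≤ p) (h : HpApprox p Q f)
    (hper : ∀ s, f (s + Complex.I * twoPeriod) = f s) (hf : DifferentiableOn ℂ f (halfPlane 0))
    {N : ℝ} (hN : Tendsto (fun k => besicovitchNorm p (Q k)) atTop (𝓝 N))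
    {σ : ℝ} (hσ : 0 < σ) (hlim : IsDirichletLimit fun s => f (s + σ)) :
    besicovitchFun p (fun t : ℝ => f (Complex.I * t + σ)) ≤ N := by
  have hp0 : 0 < p := by linarith
  refine le_of_forall_pos_le_add fun ε hε => ?_
  refine ge_of_tendsto (hN.add_const ε) ?_
  filter_upwards [Metric.tendstoUniformlyOn_iff.1
    (h.tendstoUniformlyOn_twoPart hp hper hf (half_pos hσ)) ε hε] with k hk
  set R := DirichletPoly.shift σ (Q k).twoPart with hR
  have hd := (hlim.sub R.isDirichletLimit).hasPMean hp0
  have h1 := besicovitchFun_add_le hp (R.hasPMean hp0) hd (hlim.hasPMean hp0) fun t =>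
    norm_le_norm_add_norm_sub' _ _
  have h2 : besicovitchNorm p R ≤ besicovitchNorm p (Q k) :=
    ((Q k).twoPart.besicovitchNorm_shift_le hp hσ.le).trans (besicovitchNorm_twoPart_le hp _)
  have h3 := hd.le_of_bound hp0 (B := ε) fun t => by
    rw [hR, DirichletPoly.eval_shift, ← dist_eq_norm]
    exact (hk _ (by simp [halfPlane]; linarith)).le
  exact h1.trans (add_le_add h2 h3)

end Approximation

/-! ### Boundary integrals and recovery of the local embedding -/

theorem HasMean.integral_period {f : ℝ → ℝ} {m L : ℝ} (hf : Continuous f) (hL : 0 < L)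
    (hper : Function.Periodic f L) (h : HasMean f m) : ∫ t in (0)..L, f t = L * m := by
  have hT : Tendsto (fun n : ℕ => ((n : ℝ) + 1) * L) atTop atTop :=
    (tendsto_natCast_atTop_atTop.atTop_add tendsto_const_nhds).atTop_mul_const hL
  have h1 : Tendsto (fun _ : ℕ => (1 / L) * ∫ t in (0)..L, f t) atTop (𝓝 m) := by
    refine (h.comp hT).congr fun n => ?_
    have h2 := hper.intervalIntegral_add_zsmul_eq (2 * ((n : ℤ) + 1)) (-(((n : ℝ) + 1) * L))
      fun a b => hf.intervalIntegrable a b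
    have h3 := hper.intervalIntegral_add_eq (-(((n : ℝ) + 1) * L)) 0
    rw [zero_add] at h3
    rw [h3, zsmul_eq_mul, zsmul_eq_mul] at h2
    simp only [Function.comp, smul_eq_mul]
    have e : -(((n : ℝ) + 1) * L) + ((2 * ((n : ℤ) + 1) : ℤ) : ℝ) * L = ((n : ℝ) + 1) * L := by
      push_cast; ring
    rw [e] at h2
    rw [h2]
    have : (0 : ℝ) < (n : ℝ) + 1 := by positivity
    push_cast
    field_simp
  rw [← tendsto_nhds_unique tendsto_const_nhds h1]
  field_simp

theorem two_cpow_I_mul (t : ℝ) : (2 : ℂ) ^ (-(Complex.I * t)) =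
    Complex.exp (-(Complex.I * ((t * Real.log 2 : ℝ) : ℂ))) := by
  have := DirichletPoly.natCast_cpow_I 2 t
  simp only [PNat.val_ofNat, Nat.cast_ofNat] at this
  rw [this]; congr 1; push_cast; ring

/-- With z = exp(-2ix), 1 + z = 2 cos x · exp(-ix) and 1 - z = 2i sin x · exp(-ix), so the quotient
is i tan x. -/
theorem cayleyMap_two_cpow {t : ℝ} (ht : Real.cos (t * (Real.log 2 / 2)) ≠ 0) :
    1 + (2 : ℂ) ^ (-(Complex.I * t)) ≠ 0 ∧ cayleyMap ((2 : ℂ) ^ (-(Complex.I * t))) =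
      1 / 2 + Complex.I * (Real.tan (t * (Real.log 2 / 2)) : ℝ) := by
  set x := t * (Real.log 2 / 2) with hx
  have hcos : (Complex.cos x) ≠ 0 := by
    rw [← Complex.ofReal_cos]; exact_mod_cast ht
  have hz : (2 : ℂ) ^ (-(Complex.I * t)) =
      Complex.exp (-(x * Complex.I)) * Complex.exp (-(x * Complex.I)) := by
    rw [two_cpow_I_mul, ← Complex.exp_add]; congr 1; rw [hx]; push_cast; ring
  have hexp : Complex.exp (-(x * Complex.I)) = Complex.cos x - Complex.sin x * Complex.I := by
    rw [← neg_mul, Complex.exp_mul_I, Complex.cos_neg, Complex.sin_neg]; ring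
  have hcs : (Complex.cos x) ^ 2 + (Complex.sin x) ^ 2 = 1 := Complex.cos_sq_add_sin_sq _
  have h1 : 1 + (2 : ℂ) ^ (-(Complex.I * t)) =
      2 * Complex.cos x * Complex.exp (-(x * Complex.I)) := by
    rw [hz, hexp]
    linear_combination -hcs + (Complex.sin x) ^ 2 * Complex.I_sq
  have h2 : 1 - (2 : ℂ) ^ (-(Complex.I * t)) =
      2 * Complex.I * Complex.sin x * Complex.exp (-(x * Complex.I)) := by
    rw [hz, hexp]
    linear_combination -hcs + (Complex.sin x) ^ 2 * Complex.I_sq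
  have h3 := Complex.exp_ne_zero (-(x * Complex.I))
  refine ⟨by rw [h1]; exact mul_ne_zero (mul_ne_zero two_ne_zero hcos) h3, ?_⟩
  rw [cayleyMap, h1, h2, Complex.ofReal_tan, Complex.tan_eq_sin_div_cos]
  field_simp

/-- Integrals of `|P|ᵖ` over the segment `[1/2, 1/2 + i]` are controlled by `P(𝒯(2⁻ˢ))`. -/
theorem integral_le_of_hpApprox {p : ℝ} (hp : 1 ≤ p) (P : DirichletPoly) {Q : ℕ → DirichletPoly}
    (h : HpApprox p Q fun s => DirichletPoly.eval P (cayleyMap ((2 : ℂ) ^ (-s)))) {N : ℝ}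
    (hN : Tendsto (fun k => besicovitchNorm p (Q k)) atTop (𝓝 N)) :
    ∫ y in (0 : ℝ)..1, ‖DirichletPoly.eval P (1 / 2 + Complex.I * y)‖ ^ p ≤
      2 * Real.pi * N ^ p := by
  have hp0 : 0 < p := by linarith
  have hpi := Real.pi_pos
  have hl := Real.log_pos one_lt_two
  set f : ℂ → ℂ := fun s => DirichletPoly.eval P (cayleyMap ((2 : ℂ) ^ (-s))) with hf
  have hper : ∀ s, f (s + Complex.I * twoPeriod) = f s := fun s => by
    simp only [hf, two_cpow_add_period]
  have hcpow : Differentiable ℂ fun s : ℂ => (2 : ℂ) ^ (-s) := fun s =>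
    (differentiableAt_id.neg).const_cpow (Or.inl two_ne_zero)
  have hfd : ∀ s : ℂ, 1 + (2 : ℂ) ^ (-s) ≠ 0 → DifferentiableAt ℂ f s := fun s hs => by
    refine (P.differentiable_eval _).comp s ?_
    unfold cayleyMap
    exact (differentiableAt_const _).add (((differentiableAt_const _).sub (hcpow s)).div
      ((differentiableAt_const _).add (hcpow s)) hs)
  have hfd0 : DifferentiableOn ℂ f (halfPlane 0) := fun s hs =>
    (hfd s (one_add_ne_zero_of_norm_lt_one
      (norm_two_cpow_neg_lt_one hs))).differentiableWithinAt
  have hlim : ∀ σ : ℝ, 0 < σ → IsDirichletLimit fun s => f (s + σ) := fun σ hσ =>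
    (isDirichletLimit_of_tendstoUniformlyOn (fun ε hε => tendstoUniformlyOn_cayleyCoeff hε)
      hσ).eval_comp P
  have hN0 : 0 ≤ N := ge_of_tendsto' hN fun k => besicovitchNorm_nonneg hp _
  -- T · log 2 / 2 = π/4, so t ↦ tan(t log 2 / 2) maps [0, T] onto [0, 1].
  set T := Real.pi / (2 * Real.log 2) with hT
  have hT0 : 0 < T := by positivity
  have hTL : T ≤ twoPeriod := by
    rw [hT, twoPeriod, div_le_div_iff₀ (by positivity) hl]; nlinarith [mul_pos hpi hl]
  have hσ : ∀ σ : ℝ, 0 < σ →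
      ∫ t in (0 : ℝ)..T, ‖f (Complex.I * t + σ)‖ ^ p ≤ twoPeriod * N ^ p := by
    intro σ hσ
    have hm := (hlim σ hσ).hasPMean hp0
    have hc := continuous_norm_rpow hp0 hm.1
    have h1 := (hm.hasMean hp0).integral_period hc twoPeriod_pos fun t => by
      have := hper (Complex.I * t + σ)
      rw [show Complex.I * t + σ + Complex.I * twoPeriod =
        Complex.I * ((t + twoPeriod : ℝ) : ℂ) + σ by push_cast; ring] at this
      simp only [this]
    have h2 := h.besicovitchFun_line_le hp hper hfd0 hN hσ (hlim σ hσ)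
    have h3 := hm.nonneg hp0
    calc _ ≤ ∫ t in (0 : ℝ)..twoPeriod, ‖f (Complex.I * t + σ)‖ ^ p := by
          refine intervalIntegral.integral_mono_interval le_rfl hT0.le hTL
            (Eventually.of_forall fun t => by simp only [Pi.zero_apply]; positivity)
            (hc.intervalIntegrable _ _)
      _ ≤ _ := by
        rw [h1]
        have := twoPeriod_pos
        gcongr
  -- Keeps 2⁻ⁱᵗ away from the pole -1 of 𝒯, and bounds the derivative of the tangent substitution by
  -- log 2.
  have hcos : ∀ t ∈ Icc 0 T, 1 / 2 ≤ Real.cos (t * (Real.log 2 / 2)) ^ 2 := fun t ht => by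
    have h1 : t * (Real.log 2 / 2) ≤ Real.pi / 4 := by
      calc _ ≤ T * (Real.log 2 / 2) := by have := ht.2; gcongr
        _ = _ := by rw [hT]; field_simp; norm_num
    have h2 : 0 ≤ t * (Real.log 2 / 2) := mul_nonneg ht.1 (by positivity)
    have h3 : Real.cos (Real.pi / 4) ≤ Real.cos (t * (Real.log 2 / 2)) :=
      Real.cos_le_cos_of_nonneg_of_le_pi h2 (by linarith) h1
    rw [Real.cos_pi_div_four] at h3
    have h4 : (√2 / 2) ^ 2 = 1 / 2 := by rw [div_pow, Real.sq_sqrt zero_le_two]; norm_num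
    rw [← h4]
    gcongr
  have hcos0 : ∀ t ∈ Icc 0 T, Real.cos (t * (Real.log 2 / 2)) ≠ 0 := fun t ht h0 => by
    have := hcos t ht
    rw [h0] at this; norm_num at this
  set g : ℝ → ℝ := fun y => ‖DirichletPoly.eval P (1 / 2 + Complex.I * y)‖ ^ p with hg
  have hgc : Continuous g := continuous_norm_rpow hp0 (P.continuous_eval_line _)
  have hfg : ∀ t ∈ Icc 0 T, ‖f (Complex.I * t)‖ ^ p = g (Real.tan (t * (Real.log 2 / 2))) :=
    fun t ht => by simp only [hf, hg, (cayleyMap_two_cpow (hcos0 t ht)).2]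
  have h0 : ∫ t in (0 : ℝ)..T, ‖f (Complex.I * t)‖ ^ p ≤ twoPeriod * N ^ p := by
    -- The boundary is reached by dominated convergence along σ = 1/(k+1): P is bounded on the range
    -- of the Cayley map, and f is continuous at it for t in [0, T].
    have hlim0 : Tendsto (fun k : ℕ => ∫ t in (0 : ℝ)..T,
        ‖f (Complex.I * t + ((1 / ((k : ℝ) + 1) : ℝ) : ℂ))‖ ^ p) atTop
        (𝓝 (∫ t in (0 : ℝ)..T, ‖f (Complex.I * t)‖ ^ p)) := by
      refine intervalIntegral.tendsto_integral_filter_of_dominated_convergence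
        (fun _ => (P.sum fun _ a => ‖a‖) ^ p) ?_ ?_ intervalIntegrable_const ?_
      · exact Eventually.of_forall fun k => (continuous_norm_rpow hp0
          (hlim _ (by positivity)).continuous_line).aestronglyMeasurable
      · refine Eventually.of_forall fun k => Eventually.of_forall fun t _ => ?_
        rw [Real.norm_of_nonneg (by positivity)]
        have : ‖f (Complex.I * t + ((1 / ((k : ℝ) + 1) : ℝ) : ℂ))‖ ≤ P.sum fun _ a => ‖a‖ := by
          refine P.norm_eval_le (le_trans (by norm_num)
            (half_lt_re_cayleyMap (norm_two_cpow_neg_lt_one ?_)).le)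
          rw [Complex.add_re, Complex.ofReal_re]
          simp; positivity
        gcongr
      · refine Eventually.of_forall fun t ht => ?_
        rw [uIoc_of_le hT0.le] at ht
        have hd := hfd _ (cayleyMap_two_cpow (hcos0 t (Ioc_subset_Icc_self ht))).1
        have h1 : Tendsto (fun k : ℕ => Complex.I * t + ((1 / ((k : ℝ) + 1) : ℝ) : ℂ)) atTop
            (𝓝 (Complex.I * t)) := by
          have := (Complex.continuous_ofReal.tendsto 0).comp
            (tendsto_one_div_add_atTop_nhds_zero_nat (𝕜 := ℝ))
          simpa using this.const_add (Complex.I * t)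
        exact ((hd.continuousAt.tendsto.comp h1).norm).rpow_const (Or.inr hp0.le)
    exact le_of_tendsto' hlim0 fun k => hσ _ (by positivity)
  have hTuIcc : uIcc 0 T = Icc 0 T := uIcc_of_le hT0.le
  have hderiv : ∀ t ∈ uIcc 0 T, HasDerivAt (fun t => Real.tan (t * (Real.log 2 / 2)))
      (1 / Real.cos (t * (Real.log 2 / 2)) ^ 2 * (Real.log 2 / 2)) t := fun t ht => by
    rw [hTuIcc] at ht
    exact (Real.hasDerivAt_tan (hcos0 t ht)).comp t
      (by simpa using (hasDerivAt_id t).mul_const (Real.log 2 / 2))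
  have hd'c : ContinuousOn (fun t => 1 / Real.cos (t * (Real.log 2 / 2)) ^ 2 * (Real.log 2 / 2))
      (uIcc 0 T) := by
    rw [hTuIcc]
    refine ContinuousOn.mul (ContinuousOn.div continuousOn_const (by fun_prop) fun t ht =>
      pow_ne_zero 2 (hcos0 t ht)) continuousOn_const
  have hsub := intervalIntegral.integral_comp_mul_deriv hderiv hd'c hgc
  have hTtan : Real.tan (T * (Real.log 2 / 2)) = 1 := by
    rw [show T * (Real.log 2 / 2) = Real.pi / 4 by rw [hT]; field_simp; norm_num,
      Real.tan_pi_div_four]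
  rw [zero_mul, Real.tan_zero, hTtan] at hsub
  have htc : ContinuousOn (fun t => Real.tan (t * (Real.log 2 / 2))) (uIcc 0 T) := fun t ht =>
    (hderiv t ht).continuousAt.continuousWithinAt
  have hgtc : ContinuousOn (g ∘ fun t => Real.tan (t * (Real.log 2 / 2))) (uIcc 0 T) :=
    hgc.comp_continuousOn htc
  have hfi : ∫ t in (0 : ℝ)..T, ‖f (Complex.I * t)‖ ^ p =
      ∫ t in (0 : ℝ)..T, (g ∘ fun t => Real.tan (t * (Real.log 2 / 2))) t :=
    intervalIntegral.integral_congr fun t ht => hfg t (hTuIcc ▸ ht)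
  calc ∫ y in (0 : ℝ)..1, g y = _ := hsub.symm
    _ ≤ ∫ t in (0 : ℝ)..T, (g ∘ fun t => Real.tan (t * (Real.log 2 / 2))) t * Real.log 2 := by
      refine intervalIntegral.integral_mono_on hT0.le (hgtc.mul hd'c).intervalIntegrable
        (hgtc.mul continuousOn_const).intervalIntegrable fun t ht => ?_
      have h1 := hcos t ht
      refine mul_le_mul_of_nonneg_left ?_ (by simp only [Function.comp, hg]; positivity)
      rw [div_mul_div_comm, one_mul, div_le_iff₀ (by positivity)]
      nlinarith
    _ = Real.log 2 * ∫ t in (0 : ℝ)..T, ‖f (Complex.I * t)‖ ^ p := by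
      rw [intervalIntegral.integral_mul_const, hfi, mul_comm]
    _ ≤ Real.log 2 * (twoPeriod * N ^ p) := by gcongr
    _ = 2 * Real.pi * N ^ p := by rw [twoPeriod]; field_simp

theorem localEmbedding_of_compositionBounded {p : ℝ} (hp : 1 ≤ p)
    (h : CompositionBounded p (fun s => cayleyMap ((2 : ℂ) ^ (-s)))) : LocalEmbedding p := by
  have hp0 : 0 < p := by linarith
  have hpi := Real.pi_pos
  obtain ⟨C, hC⟩ := h
  have key : ∀ P : DirichletPoly,
      ∫ y in (0 : ℝ)..1, ‖DirichletPoly.eval P (1 / 2 + Complex.I * y)‖ ^ p ≤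
        2 * Real.pi * |C| ^ p * besicovitchNorm p P ^ p := by
    intro P
    set X := ∫ y in (0 : ℝ)..1, ‖DirichletPoly.eval P (1 / 2 + Complex.I * y)‖ ^ p with hX
    have hX0 : 0 ≤ X := intervalIntegral.integral_nonneg zero_le_one fun y _ => by positivity
    have happ : HpApprox p (fun _ => P) (DirichletPoly.eval P) := by
      refine ⟨fun ε hε => ⟨0, fun j _ k _ => ?_⟩, fun s _ => tendsto_const_nhds⟩
      rw [sub_self]
      exact ((DirichletPoly.hasPMean hp0 0).le_of_bound hp0 (B := 0) fun t => by
        simp [DirichletPoly.eval]).trans_lt hε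
    obtain ⟨⟨Q, hQ⟩, hle⟩ := hC (DirichletPoly.eval P) ⟨_, happ⟩
    have hPN := besicovitchNorm_nonneg hp P
    have hP1 : hpNorm p (DirichletPoly.eval P) ≤ besicovitchNorm p P :=
      csInf_le (bddBelow_hpNorm_set hp _) ⟨_, happ, tendsto_const_nhds⟩
    have hP0 : 0 ≤ hpNorm p (DirichletPoly.eval P) := Real.sInf_nonneg (by
      rintro N ⟨R, -, hR⟩
      exact ge_of_tendsto' hR fun k => besicovitchNorm_nonneg hp _)
    obtain ⟨N₀, hN₀⟩ := hQ.exists_tendsto_norm hp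
    have hlow : (X / (2 * Real.pi)) ^ (1 / p) ≤
        hpNorm p fun s => DirichletPoly.eval P (cayleyMap ((2 : ℂ) ^ (-s))) := by
      -- The integral estimate holds for every approximating sequence, hence for the infimum;
      -- non-emptiness is essential because the infimum of the empty set is 0.
      refine le_csInf ⟨N₀, Q, hQ, hN₀⟩ ?_
      rintro N ⟨R, hR, hN⟩
      have hN0 : 0 ≤ N := ge_of_tendsto' hN fun k => besicovitchNorm_nonneg hp _
      have h1 := integral_le_of_hpApprox hp P hR hN
      have h2 : X / (2 * Real.pi) ≤ N ^ p := by
        rw [div_le_iff₀ (by positivity), mul_comm]; exact h1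
      calc _ ≤ (N ^ p) ^ (1 / p) := by gcongr
        _ = N := by rw [← Real.rpow_mul hN0, mul_one_div_cancel hp0.ne', Real.rpow_one]
    have hup : (X / (2 * Real.pi)) ^ (1 / p) ≤ |C| * besicovitchNorm p P := by
      calc _ ≤ _ := hlow
        _ ≤ C * hpNorm p (DirichletPoly.eval P) := hle
        _ ≤ |C| * hpNorm p (DirichletPoly.eval P) := by gcongr; exact le_abs_self C
        _ ≤ _ := by gcongr
    have h3 : X / (2 * Real.pi) ≤ (|C| * besicovitchNorm p P) ^ p := by
      calc X / (2 * Real.pi) = ((X / (2 * Real.pi)) ^ (1 / p)) ^ p := by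
            rw [← Real.rpow_mul (by positivity), one_div_mul_cancel hp0.ne', Real.rpow_one]
        _ ≤ _ := by gcongr
    rw [Real.mul_rpow (abs_nonneg _) hPN, div_le_iff₀ (by positivity)] at h3
    linarith
  refine ⟨2 * Real.pi * |C| ^ p, fun P τ => ?_⟩
  -- A vertical translation carries [τ, τ + 1] to [0, 1] without changing the norm.
  have h1 := key (DirichletPoly.shift (Complex.I * τ) P)
  rw [besicovitchNorm_shift_I hp] at h1
  refine le_trans (le_of_eq ?_) h1
  have h2 := intervalIntegral.integral_comp_add_right (a := 0) (b := 1)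
    (fun y : ℝ => ‖DirichletPoly.eval P (1 / 2 + Complex.I * y)‖ ^ p) τ
  rw [zero_add, add_comm 1 τ] at h2
  rw [← h2]
  refine intervalIntegral.integral_congr fun y _ => ?_
  simp only [DirichletPoly.eval_shift]
  congr 3; push_cast; ring

theorem theorem3 (p : ℝ) (hp : 1 ≤ p) :
    List.TFAE [
      LocalEmbedding p,
      ∀ φ : ℂ → ℂ, GordonHedenmalm 0 φ → CompositionBounded p φ,
      CompositionBounded p (fun s => cayleyMap ((2 : ℂ) ^ (-s)))] := by
  tfae_have 1 → 2 := fun h φ hφ => h.compositionBounded hp hφ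
  tfae_have 2 → 3 := fun h => h _ gordonHedenmalm_cayleyMap
  tfae_have 3 → 1 := localEmbedding_of_compositionBounded hp
  tfae_finish
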